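/- Conventions. Let $A$ be a finite alphabet and $w$ a nonempty word (the pattern) over $A$. A $w$-matching machine is a tuple $M=(Q,o,F,\eta,\delta,\gamma)$ with $Q$ a finite set of states, $o\in Q$ the initial state, $F\subseteq Q$ the set of pre-match states, $\eta:Q\to\mathbb N$ with $\eta(q)<|w|$ for all $q\in F$, $\delta:Q\times A\to Q$ and $\gamma:Q\times A\to\mathbb N$, such that $Q$ contains a sink state $\odot$ with $\delta(\odot,x)=\odot$ and $\gamma(\odot,x)=0$ for all $x\in A$. Its order is $\max_{q\in Q}\eta(q)$. On a text $t\in A^{*}$ it starts with $(q,p)=(o,0)$ and, as long as $p\le |t|-|w|$, it reads the letter $x=t_{p+\eta(q)}$ (an arbitrary fixed padding letter if $p+\eta(q)\ge |t|$), prints $p$ if $q\in F$ and $x=w_{\eta(q)}$ (a match transition), and replaces $(q,p)$ by $(\delta(q,x),\,p+\gamma(q,x))$. The number of iterations is denoted $a_M(t)$. The machine is valid if on every text $t$ the set of printed positions is exactly the set of positions at which $w$ occurs in $t$. An iid model is a probability distribution $\pi$ on $A$ (with real values), and the asymptotic speed of $M$ under $\pi$ is $$\mathrm{AS}_\pi(M)=\lim_{N\to\infty}\sum_{t\in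 A^{N}}\frac{N}{a_M(t)}\prod_{i=0}^{N-1}\pi(t_i).$$ Statement. There is an algorithm which, given a finite alphabet $A=\{0,\dots,s-1\}$, a nonempty pattern $w$ over $A$, an integer $n\ge |w|-1$ and an iid model $\pi$ on $A$, halts after finitely many steps, using a finite amount of memory, and outputs (the complete table of) a valid $w$-matching machine $M$ of order at most $n$ whose asymptotic speed under $\pi$ exists and is the greatest among all valid $w$-matching machines of order at most $n$: every valid $w$-matching machine $M'$ of order at most $n$ has an asymptotic speed under $\pi$, and $\mathrm{AS}_\pi(M')\le \mathrm{AS}_\pi(M)$. Moreover all states of $M$ other than the sink are reachable on some text, and from each of its pre-match states a match transition occurs on some text. The output does not depend on the padding letter, and these properties hold for every choice of it. Here the discrete data $(s,w,n)$ are given as usual finite inputs, and the real numbers $\pi(0),\dots,\pi(s-1)$ are accessed by exact arithmetic: at each step a Turing-computable function of $(s,w,n)$ and of the answers received so far determines either an output, or an integer polynomial $P$ for which the algorithm asks whether $P(\pi(0),\dots,\pi(s-1))\ge 0$. -/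

import Mathlib

open Filter Topology

namespace PatternMatching

/-- A `w`-matching machine `(Q, init, prematch, next, trans, shift)` on the alphabet `A`, for a
pattern `w`. By convention its set of states contains a sink state. -/
structure MatchingMachine (A : Type*) (Q : Type*) (w : List A) where
  /-- the initial state -/
  init : Q
  /-- the sink state -/
  sink : Q
  /-- the pre-match states -/
  prematch : Finset Q
  /-- the next-position-to-check function -/
  next : Q → ℕ
  /-- the transition state function -/
  trans : Q → A → Q
  /-- the shift function -/
  shift : Q → A → ℕ
  next_lt : ∀ q ∈ prematch, next q < w.length
  trans_sink : ∀ x, trans sink x = sink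
  shift_sink : ∀ x, shift sink x = 0

/-- The pattern `w` occurs at the position `p` of the text `t`. -/
def OccursAt {A : Type*} (w t : List A) (p : ℕ) : Prop :=
  p + w.length ≤ t.length ∧ (t.drop p).take w.length = w

namespace MatchingMachine

variable {A Q : Type*} {w : List A}

/-- The order of a machine: its greatest next-position-to-check. -/
def order [Fintype Q] (M : MatchingMachine A Q w) : ℕ := Finset.univ.sup M.next

/-- The pair (current state, current position) at the beginning of the `i`-th iteration of the
generic algorithm on the text `t`. A machine of order at least `|w|` may look beyond the end of the
text; such an access returns the letter `pad`. (The loop guard is not tested here, see `Running`.) -/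
def config (M : MatchingMachine A Q w) (pad : A) (t : List A) : ℕ → Q × ℕ
  | 0 => (M.init, 0)
  | i + 1 =>
    let c := config M pad t i
    let x := t.getD (c.2 + M.next c.1) pad
    (M.trans c.1 x, c.2 + M.shift c.1 x)

/-- The current state at the beginning of the `i`-th iteration. -/
def stateAt (M : MatchingMachine A Q w) (pad : A) (t : List A) (i : ℕ) : Q :=
  (M.config pad t i).1

/-- The current position at the beginning of the `i`-th iteration. -/
def posAt (M : MatchingMachine A Q w) (pad : A) (t : List A) (i : ℕ) : ℕ :=
  (M.config pad t i).2

/-- The letter accessed during the `i`-th iteration. -/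
def letterAt (M : MatchingMachine A Q w) (pad : A) (t : List A) (i : ℕ) : A :=
  t.getD (M.posAt pad t i + M.next (M.stateAt pad t i)) pad

/-- The `i`-th iteration is executed: the loop guard `pos ≤ |t| - |w|` holds. As positions never
decrease, it then holds at all the earlier iterations. -/
def Running (M : MatchingMachine A Q w) (pad : A) (t : List A) (i : ℕ) : Prop :=
  M.posAt pad t i + w.length ≤ t.length

/-- The `i`-th iteration is executed and performs a match transition, i.e. the generic algorithm
prints an occurrence at its current position. -/
def MatchAt (M : MatchingMachine A Q w) (pad : A) (t : List A) (i : ℕ) : Prop :=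
  M.Running pad t i ∧ M.stateAt pad t i ∈ M.prematch ∧
    w[M.next (M.stateAt pad t i)]? = some (M.letterAt pad t i)

/-- On every text, the positions printed are all, and only, the occurrence positions of `w`. -/
def Valid (M : MatchingMachine A Q w) (pad : A) : Prop :=
  ∀ (t : List A) (p : ℕ),
    (∃ i, M.MatchAt pad t i ∧ M.posAt pad t i = p) ↔ OccursAt w t p

/-- The standing assumptions on machines: all states but the sink are reachable, and from
each pre-match state a match transition occurs on some text. -/
def Trim (M : MatchingMachine A Q w) (pad : A) : Prop :=
  (∀ q, q ≠ M.sink → ∃ t i, M.Running pad t i ∧ M.stateAt pad t i = q) ∧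
  (∀ q ∈ M.prematch, ∃ t i, M.MatchAt pad t i ∧ M.stateAt pad t i = q)

/-- The number of text accesses (equivalently, of iterations) on the text `t`. -/
noncomputable def accesses (M : MatchingMachine A Q w) (pad : A) (t : List A) : ℕ :=
  {i | M.Running pad t i}.ncard

/-- `v` is the asymptotic speed of `M` under the iid model `π`: the limit of the expected ratio of
the text length `N` to the number of accesses, over the random texts of length `N`. -/
def HasSpeed [Fintype A] (M : MatchingMachine A Q w) (pad : A) (π : A → ℝ) (v : ℝ) : Prop :=
  Tendsto
    (fun N : ℕ => ∑ t : Fin N → A,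
      (N : ℝ) / (M.accesses pad (List.ofFn t) : ℝ) * ∏ i, π (t i))
    atTop (𝓝 v)

end MatchingMachine

/-- Finite descriptions of machines: the initial state, the sink, and for each state, whether it is
pre-match, its next-position-to-check, and the target and the shift for each letter. -/
abbrev MachineCode : Type := ℕ × ℕ × List (Bool × ℕ × List (ℕ × ℕ))

/-- The description of a machine with states `0, …, m - 1` on the alphabet `0, …, s - 1`. -/
def MatchingMachine.code {s m : ℕ} {w : List (Fin s)} (M : MatchingMachine (Fin s) (Fin m) w) :
    MachineCode :=
  (M.init, M.sink, List.ofFn fun q =>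
    (decide (q ∈ M.prematch), M.next q, List.ofFn fun x => ((M.trans q x : ℕ), M.shift q x)))

/-- Integer polynomials in variables `x₀, x₁, …`: lists of monomials, each of them given by its
coefficient and the list (with repetitions) of the indices of its variables. -/
abbrev IntPoly : Type := List (ℤ × List ℕ)

/-- The value of an integer polynomial at a real point. -/
noncomputable def IntPoly.value (P : IntPoly) (x : ℕ → ℝ) : ℝ :=
  (P.map fun c => (c.1 : ℝ) * (c.2.map x).prod).sum

/-- An algorithm with a discrete input in `α`, a real input `x₀, x₁, …` and an output in `β`,
in the model of exact real arithmetic. From the discrete input and the answers received so far (most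
recent first), it either asks whether `P(x) ≥ 0` for some integer polynomial `P`, or halts
with an output. -/
abbrev ExactAlgorithm (α β : Type) : Type := α × List Bool → IntPoly ⊕ β

/-- The output, if any, of at most `T` steps of the algorithm after the answers `h`. -/
noncomputable def ExactAlgorithm.run {α β : Type} (F : ExactAlgorithm α β) (a : α) (x : ℕ → ℝ) :
    ℕ → List Bool → Option β
  | 0, _ => none
  | T + 1, h =>
    match F (a, h) with
    | Sum.inr b => some b
    | Sum.inl P => ExactAlgorithm.run F a x T (decide (0 ≤ IntPoly.value P x) :: h)

/-- The algorithm halts on the input `(a, x)`, after finitely many steps, with the output `b`. -/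
def ExactAlgorithm.Outputs {α β : Type} (F : ExactAlgorithm α β) (a : α) (x : ℕ → ℝ) (b : β) :
    Prop :=
  ∃ T, ExactAlgorithm.run F a x T [] = some b

/-- The probabilities of the letters as a sequence of reals, with zeros after the last letter. -/
noncomputable def letterProbs {s : ℕ} (π : Fin s → ℝ) (i : ℕ) : ℝ :=
  if h : i < s then π ⟨i, h⟩ else 0

end PatternMatching

namespace PatternMatching

/-! ### Knowledge about a window of text, encoded as a natural number

The digit `i` of `K` in base `s + 1` is `0` when the letter at the offset `i` is unknown, and `x + 1`
when it is known to be `x`. -/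

/-! The letters of a random text are independent, so at each moment the future of a run depends only
on the letters already read in the window of offsets `0, …, n` (the knowledge `K`), on the machine
state, and on whether the current position was printed. An unread letter is fresh whatever the past.
Choosing the next offset to read is an action and the shift is its reward. An ideal strategy shifts
as soon as its knowledge excludes, or makes it print, an occurrence at the current position. The
asymptotic speed is thus the average reward of a finite Markov decision process on live knowledge.

Its optimality equation, `g + h K` equals the maximum over `i ≤ n` of the mean of `after s w h K i
x`, is solved in `exists_gain` by letting a discount factor tend to one. The discounted values
satisfy two monotonicity properties, `SkipGain` and `ReadGain`: free skips and free letters never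
hurt. Conversely a letter or a skip obtained by an actual reading costs a bounded amount. Coupling
two runs from different knowledge then bounds the oscillation of the discounted values uniformly in
the discount (`hat_le_hat_add`), so a limit exists by compactness, with a gain independent of the
initial knowledge.

An arbitrary valid machine becomes a finite chain once its state records knowledge and a printing
flag. Validity forces it to skip only positions that are dead or printed and, with at least two
letters, to know whatever it prints; otherwise an unread letter could be changed to make it wrong.
Its gain solves a Poisson equation (`exists_poisson`), and `Valid.hasSpeed` identifies the speed
with that gain at the initial state. The chain may have several recurrent classes, so the gain is a
harmonic function and not a constant; two martingale estimates in mean square replace an ergodic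
theorem. Comparing the Poisson equation with the optimality equation bounds every speed by `g`
(`Valid.exists_hasSpeed_le`), and an optimal strategy, made into a machine, reaches `g`
(`exists_le_hasSpeed`).

For the algorithm, fixing the optimal actions turns the optimality equation into a finite system of
affine inequalities over the field generated by the letter probabilities. A real solution yields one
in that field (`exists_solution_in_subfield`), hence, after clearing denominators, a finite
certificate made of integer polynomials, checked by finitely many sign queries. Asking all sign
queries in turn and trying all candidates must eventually find a certificate, and any certificate
confirmed by true answers is sound (`search_spec`). -/

/-- The digit of `K` at the offset `i`, in base `s + 1`. -/
def dig (s K i : ℕ) : ℕ := K / (s + 1) ^ i % (s + 1)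

/-- The knowledge `K` after the letter `x` was read at the offset `i`. -/
def rd (s K i x : ℕ) : ℕ := if dig s K i = 0 then K + (x + 1) * (s + 1) ^ i else K

/-- An occurrence of `w` at the offset `0` is compatible with `K`. -/
def Live (s : ℕ) (w : List ℕ) (K : ℕ) : Prop :=
  ∀ j < w.length, dig s K j = 0 ∨ dig s K j = w.getD j 0 + 1

/-- An occurrence of `w` at the offset `0` is certain under `K`. -/
def Full (s : ℕ) (w : List ℕ) (K : ℕ) : Prop :=
  ∀ j < w.length, dig s K j = w.getD j 0 + 1

instance (s : ℕ) (w : List ℕ) (K : ℕ) : Decidable (Live s w K) := by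
  unfold Live; infer_instance

instance (s : ℕ) (w : List ℕ) (K : ℕ) : Decidable (Full s w K) := by
  unfold Full; infer_instance

theorem dig_zero_right (s K : ℕ) : dig s K 0 = K % (s + 1) := by simp [dig]

theorem dig_zero_left (s i : ℕ) : dig s 0 i = 0 := by simp [dig]

theorem dig_div_pow (s K k i : ℕ) : dig s (K / (s + 1) ^ k) i = dig s K (i + k) := by
  simp [dig, Nat.div_div_eq_div_mul, pow_add, mul_comm]

theorem dig_div (s K i : ℕ) : dig s (K / (s + 1)) i = dig s K (i + 1) := by
  simpa using dig_div_pow s K 1 i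

theorem dig_le (s K i : ℕ) : dig s K i ≤ s :=
  Nat.lt_succ_iff.mp (Nat.mod_lt _ (Nat.succ_pos s))

theorem rd_known {s K i : ℕ} (h : dig s K i ≠ 0) (x : ℕ) : rd s K i x = K := by simp [rd, h]

theorem lt_rd {s K i : ℕ} (h : dig s K i = 0) (x : ℕ) : K < rd s K i x := by
  simp only [rd, h, if_true]
  exact Nat.lt_add_of_pos_right (by positivity)

theorem rd_div_succ (s K i x : ℕ) : rd s K (i + 1) x / (s + 1) = rd s (K / (s + 1)) i x := by
  unfold rd
  rw [dig_div]
  split_ifs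
  · rw [pow_succ, ← mul_assoc, Nat.add_mul_div_right _ _ (Nat.succ_pos s)]
  · rfl

theorem rd_div_zero {s x : ℕ} (hx : x < s) (K : ℕ) : rd s K 0 x / (s + 1) = K / (s + 1) := by
  unfold rd
  split_ifs with h
  · rw [dig_zero_right] at h
    obtain ⟨c, rfl⟩ := Nat.dvd_of_mod_eq_zero h
    rw [pow_zero, mul_one, Nat.mul_add_div (Nat.succ_pos s), Nat.div_eq_of_lt (by omega),
      Nat.mul_div_cancel_left _ (Nat.succ_pos s), add_zero]
  · rfl

theorem rd_div_pow {s K i x : ℕ} : ∀ {a : ℕ}, a ≤ i →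
    rd s K i x / (s + 1) ^ a = rd s (K / (s + 1) ^ a) (i - a) x
  | 0, _ => by simp
  | a + 1, h => by
    rw [pow_succ, ← Nat.div_div_eq_div_mul, rd_div_pow (by omega : a ≤ i),
      show i - a = (i - (a + 1)) + 1 by omega, rd_div_succ, Nat.div_div_eq_div_mul]

theorem dig_rd {s x : ℕ} (hx : x < s) : ∀ (i j K : ℕ),
    dig s (rd s K i x) j = if j = i ∧ dig s K i = 0 then x + 1 else dig s K j
  | 0, 0, K => by
    by_cases h : dig s K 0 = 0
    · have h' := h
      rw [dig_zero_right] at h'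
      simp only [rd, h, if_true, dig_zero_right, pow_zero, mul_one, and_self]
      rw [Nat.add_mod, h', zero_add, Nat.mod_mod, Nat.mod_eq_of_lt (by omega)]
    · simp [rd, h]
  | 0, j + 1, K => by
    rw [← dig_div, rd_div_zero hx, dig_div]; simp
  | i + 1, 0, K => by
    rw [dig_zero_right, dig_zero_right]
    unfold rd
    split_ifs with h1 h2 h2
    · simp at h2
    · rw [pow_succ, ← mul_assoc, Nat.add_mul_mod_self_right]
    · simp at h2
    · rfl
  | i + 1, j + 1, K => by
    rw [← dig_div, rd_div_succ, dig_rd hx i j, dig_div, dig_div]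
    simp

theorem dig_rd_of_ne {s x : ℕ} (hx : x < s) {i j : ℕ} (h : j ≠ i) (K : ℕ) :
    dig s (rd s K i x) j = dig s K j := by simp [dig_rd hx, h]

theorem dig_rd_self {s x : ℕ} (hx : x < s) {i K : ℕ} (h : dig s K i = 0) :
    dig s (rd s K i x) i = x + 1 := by simp [dig_rd hx, h]

theorem dig_rd_of_known {s x : ℕ} (hx : x < s) {i j K : ℕ} (h : dig s K j ≠ 0) :
    dig s (rd s K i x) j = dig s K j := by
  rw [dig_rd hx, if_neg]
  rintro ⟨rfl, h'⟩
  exact h h'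

theorem dig_rd_self_ne {s x : ℕ} (hx : x < s) (i K : ℕ) : dig s (rd s K i x) i ≠ 0 := by
  by_cases h : dig s K i = 0
  · simp [dig_rd_self hx h]
  · rwa [rd_known h]

theorem rd_comm {s x y : ℕ} (hx : x < s) (hy : y < s) {i j : ℕ} (h : i ≠ j) (K : ℕ) :
    rd s (rd s K i x) j y = rd s (rd s K j y) i x := by
  have h1 : dig s (rd s K i x) j = dig s K j := dig_rd_of_ne hx h.symm K
  have h2 : dig s (rd s K j y) i = dig s K i := dig_rd_of_ne hy h K
  conv_lhs => rw [rd, h1]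
  conv_rhs => rw [rd, h2]
  unfold rd
  split_ifs <;> omega

theorem rd_rd_self {s x : ℕ} (hx : x < s) (i K y : ℕ) :
    rd s (rd s K i x) i y = rd s K i x := rd_known (dig_rd_self_ne hx i K) y

theorem rd_lt {s x : ℕ} (hx : x < s) : ∀ {n i K : ℕ}, K < (s + 1) ^ (n + 1) → i ≤ n →
    rd s K i x < (s + 1) ^ (n + 1)
  | n, 0, K, hK, _ => by
    rw [pow_succ, ← Nat.div_lt_iff_lt_mul (Nat.succ_pos s)] at hK ⊢
    rwa [rd_div_zero hx]
  | 0, i + 1, K, _, h => by omega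
  | n + 1, i + 1, K, hK, h => by
    rw [pow_succ, ← Nat.div_lt_iff_lt_mul (Nat.succ_pos s)] at hK ⊢
    rw [rd_div_succ]
    exact rd_lt hx hK (by omega)

theorem dig_of_lt {s K i : ℕ} (h : K < (s + 1) ^ i) : dig s K i = 0 := by
  simp [dig, Nat.div_eq_of_lt h]

theorem Full.live {s : ℕ} {w : List ℕ} {K : ℕ} (h : Full s w K) : Live s w K :=
  fun j hj => Or.inr (h j hj)

theorem live_zero (s : ℕ) (w : List ℕ) : Live s w 0 := fun j _ => Or.inl (dig_zero_left s j)

theorem Live.of_rd {s x : ℕ} (hx : x < s) {w : List ℕ} {K i : ℕ} (h : Live s w (rd s K i x)) :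
    Live s w K := by
  intro j hj
  by_cases h0 : dig s K j = 0
  · exact Or.inl h0
  · rw [← dig_rd_of_known hx h0 (i := i)]
    exact h j hj

theorem Full.rd {s x : ℕ} (hx : x < s) {w : List ℕ} {K i : ℕ} (h : Full s w K) :
    Full s w (rd s K i x) := by
  intro j hj
  rw [dig_rd_of_known hx (by rw [h j hj]; omega), h j hj]

theorem full_or_not_live {s : ℕ} {w : List ℕ} {K : ℕ} (h : ∀ j < w.length, dig s K j ≠ 0) :
    Full s w K ∨ ¬ Live s w K := by
  by_cases hl : Live s w K
  · exact Or.inl fun j hj => (hl j hj).resolve_left (h j hj)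
  · exact Or.inr hl

theorem div_lt_self_of_not_live {s : ℕ} (hs : 0 < s) {w : List ℕ} {K : ℕ} (h : ¬ Live s w K) :
    K / (s + 1) < K := by
  refine Nat.div_lt_self (Nat.pos_of_ne_zero ?_) (by omega)
  rintro rfl
  exact h (live_zero s w)

/-! ### Skipping dead offsets, and potentials extended to dead knowledge. -/

/-- The least offset at which an occurrence of `w` is compatible with `K`. -/
def skip (s : ℕ) (w : List ℕ) (K : ℕ) : ℕ :=
  (List.range (K + 1)).findIdx fun k => decide (Live s w (K / (s + 1) ^ k))

/-- The knowledge `K` seen from the least offset at which `w` may occur. -/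
def norm (s : ℕ) (w : List ℕ) (K : ℕ) : ℕ := K / (s + 1) ^ skip s w K

theorem skip_eq_of {s : ℕ} (hs : 0 < s) {w : List ℕ} {K k : ℕ} (h : Live s w (K / (s + 1) ^ k))
    (h' : ∀ k' < k, ¬ Live s w (K / (s + 1) ^ k')) : skip s w K = k := by
  have hk : k < K + 1 := by
    by_contra hk
    -- As `K < (s + 1) ^ K`, shifting by `K` erases all the knowledge, and empty knowledge is live.
    -- The search over `List.range (K + 1)` therefore always succeeds.
    refine h' K (by omega) ?_
    rw [Nat.div_eq_of_lt (Nat.lt_pow_self (by omega))]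
    exact live_zero s w
  unfold skip
  rw [List.findIdx_eq (by simpa using hk)]
  simpa using ⟨h, fun j hj => h' j hj⟩

theorem skip_spec {s : ℕ} (hs : 0 < s) (w : List ℕ) (K : ℕ) :
    Live s w (norm s w K) ∧ ∀ k < skip s w K, ¬ Live s w (K / (s + 1) ^ k) := by
  have hex : ∃ k, Live s w (K / (s + 1) ^ k) :=
    ⟨K, by rw [Nat.div_eq_of_lt (Nat.lt_pow_self (by omega))]; exact live_zero s w⟩
  have h := skip_eq_of hs (Nat.find_spec hex) (fun k' hk' => Nat.find_min hex hk')
  unfold norm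
  rw [h]
  exact ⟨Nat.find_spec hex, fun k hk => Nat.find_min hex hk⟩

theorem skip_of_live {s : ℕ} (hs : 0 < s) {w : List ℕ} {K : ℕ} (h : Live s w K) :
    skip s w K = 0 := skip_eq_of hs (by simpa using h) (by simp)

/-- This recursion, which drops one dead offset at a time, supports all the later strong inductions
on `K`: dead knowledge is nonzero, so the division strictly decreases it. -/
theorem skip_of_not_live {s : ℕ} (hs : 0 < s) {w : List ℕ} {K : ℕ} (h : ¬ Live s w K) :
    skip s w K = 1 + skip s w (K / (s + 1)) := by
  obtain ⟨h1, h2⟩ := skip_spec hs w (K / (s + 1))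
  unfold norm at h1
  refine skip_eq_of hs ?_ ?_
  · rwa [pow_add, pow_one, ← Nat.div_div_eq_div_mul]
  · intro k hk
    rcases k with _ | k
    · simpa using h
    · rw [pow_succ', ← Nat.div_div_eq_div_mul]
      exact h2 k (by omega)

theorem norm_of_live {s : ℕ} (hs : 0 < s) {w : List ℕ} {K : ℕ} (h : Live s w K) :
    norm s w K = K := by simp [norm, skip_of_live hs h]

theorem norm_of_not_live {s : ℕ} (hs : 0 < s) {w : List ℕ} {K : ℕ} (h : ¬ Live s w K) :
    norm s w K = norm s w (K / (s + 1)) := by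
  unfold norm
  rw [skip_of_not_live hs h, pow_add, pow_one, ← Nat.div_div_eq_div_mul]

theorem norm_le (s : ℕ) (w : List ℕ) (K : ℕ) : norm s w K ≤ K := Nat.div_le_self _ _

theorem skip_le {s : ℕ} (hs : 0 < s) (w : List ℕ) : ∀ {d K : ℕ}, K < (s + 1) ^ d →
    skip s w K ≤ d
  | 0, K, h => by
    have : K = 0 := by simpa using h
    subst this
    rw [skip_of_live hs (live_zero s w)]
  | d + 1, K, h => by
    by_cases hl : Live s w K
    · rw [skip_of_live hs hl]; omega
    · rw [skip_of_not_live hs hl]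
      rw [pow_succ, ← Nat.div_lt_iff_lt_mul (Nat.succ_pos s)] at h
      have : skip s w (K / (s + 1)) ≤ d := skip_le hs w h
      omega

/-- The value of a potential `f` on live knowledge, extended to all knowledge, relatively to the
offset `0`. -/
noncomputable def hat (s : ℕ) (w : List ℕ) (f : ℕ → ℝ) (K : ℕ) : ℝ :=
  skip s w K + f (norm s w K)

theorem hat_of_live {s : ℕ} (hs : 0 < s) {w : List ℕ} (f : ℕ → ℝ) {K : ℕ} (h : Live s w K) :
    hat s w f K = f K := by simp [hat, skip_of_live hs h, norm_of_live hs h]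

theorem hat_of_not_live {s : ℕ} (hs : 0 < s) {w : List ℕ} (f : ℕ → ℝ) {K : ℕ}
    (h : ¬ Live s w K) : hat s w f K = 1 + hat s w f (K / (s + 1)) := by
  simp [hat, skip_of_not_live hs h, norm_of_not_live hs h, add_assoc]

/-- The reading of `x` at the offset `i` completes (or confirms) an occurrence at the offset `0`. -/
def Prints (s : ℕ) (w : List ℕ) (K i x : ℕ) : Prop := i < w.length ∧ Full s w (rd s K i x)

instance (s : ℕ) (w : List ℕ) (K i x : ℕ) : Decidable (Prints s w K i x) := by
  unfold Prints; infer_instance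

/-- The value of the potential `f` after reading `x` at the offset `i`. -/
noncomputable def after (s : ℕ) (w : List ℕ) (f : ℕ → ℝ) (K i x : ℕ) : ℝ :=
  if Prints s w K i x then 1 + hat s w f (rd s K i x / (s + 1)) else hat s w f (rd s K i x)

/-- Reading at the offset `i` brings some information, or prints an occurrence. -/
def Useful (s : ℕ) (w : List ℕ) (K i : ℕ) : Prop :=
  dig s K i = 0 ∨ (i < w.length ∧ Full s w K)

instance (s : ℕ) (w : List ℕ) (K i : ℕ) : Decidable (Useful s w K i) := by
  unfold Useful; infer_instance

/-- Such a reading changes no knowledge and prints nothing. It is therefore dominated, and optimal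
strategies may be restricted to useful readings, which is what later makes their machines progress.
-/
theorem after_of_not_useful {s : ℕ} {w : List ℕ} (f : ℕ → ℝ) {K i : ℕ} (h : ¬ Useful s w K i)
    (x : ℕ) : after s w f K i x = hat s w f K := by
  rw [Useful, not_or, not_and] at h
  have hp : ¬ Prints s w K i x := by
    rintro ⟨h1, h2⟩
    rw [rd_known h.1] at h2
    exact h.2 h1 h2
  simp [after, hp, rd_known h.1]

theorem exists_useful {s : ℕ} {w : List ℕ} (hw : w ≠ []) {K : ℕ} (h : Live s w K) :
    ∃ i < w.length, Useful s w K i := by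
  by_cases hf : Full s w K
  · exact ⟨0, List.length_pos_iff.mpr hw, Or.inr ⟨List.length_pos_iff.mpr hw, hf⟩⟩
  · unfold Full at hf
    push Not at hf
    obtain ⟨i, hi, hne⟩ := hf
    exact ⟨i, hi, Or.inl ((h i hi).resolve_right hne)⟩

end PatternMatching

namespace PatternMatching

/-! ### Averages over the letters -/

/-- The mean of `f` under the weights `π`. -/
def avg {s : ℕ} (π : Fin s → ℝ) (f : Fin s → ℝ) : ℝ := ∑ x, π x * f x

section avg
variable {s : ℕ} {π : Fin s → ℝ}

theorem avg_mono (hπ : π ∈ stdSimplex ℝ (Fin s)) {f g : Fin s → ℝ} (h : ∀ x, f x ≤ g x) :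
    avg π f ≤ avg π g :=
  Finset.sum_le_sum fun x _ => mul_le_mul_of_nonneg_left (h x) (hπ.1 x)

theorem avg_const (hπ : π ∈ stdSimplex ℝ (Fin s)) (c : ℝ) : avg π (fun _ => c) = c := by
  simp [avg, ← Finset.sum_mul, hπ.2]

theorem avg_add (f g : Fin s → ℝ) : avg π (fun x => f x + g x) = avg π f + avg π g := by
  simp [avg, mul_add, Finset.sum_add_distrib]

theorem avg_sub (f g : Fin s → ℝ) : avg π (fun x => f x - g x) = avg π f - avg π g := by
  simp [avg, mul_sub, Finset.sum_sub_distrib]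

theorem avg_mul_left (c : ℝ) (f : Fin s → ℝ) : avg π (fun x => c * f x) = c * avg π f := by
  simp only [avg, Finset.mul_sum]
  exact Finset.sum_congr rfl fun x _ => by ring

theorem avg_const_add (hπ : π ∈ stdSimplex ℝ (Fin s)) (c : ℝ) (f : Fin s → ℝ) :
    avg π (fun x => c + f x) = c + avg π f := by rw [avg_add, avg_const hπ]

theorem avg_add_const (hπ : π ∈ stdSimplex ℝ (Fin s)) (c : ℝ) (f : Fin s → ℝ) :
    avg π (fun x => f x + c) = avg π f + c := by rw [avg_add, avg_const hπ]

theorem avg_comm (f : Fin s → Fin s → ℝ) :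
    avg π (fun x => avg π fun y => f x y) = avg π (fun y => avg π fun x => f x y) := by
  simp only [avg, Finset.mul_sum]
  rw [Finset.sum_comm]
  exact Finset.sum_congr rfl fun x _ => Finset.sum_congr rfl fun y _ => by ring

theorem avg_le_const (hπ : π ∈ stdSimplex ℝ (Fin s)) {f : Fin s → ℝ} {c : ℝ}
    (h : ∀ x, f x ≤ c) : avg π f ≤ c := (avg_mono hπ h).trans_eq (avg_const hπ c)

theorem const_le_avg (hπ : π ∈ stdSimplex ℝ (Fin s)) {f : Fin s → ℝ} {c : ℝ}
    (h : ∀ x, c ≤ f x) : c ≤ avg π f := (avg_const hπ c).symm.trans_le (avg_mono hπ h)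

theorem tendsto_avg {ι : Type*} {l : Filter ι} {f : ι → Fin s → ℝ} {g : Fin s → ℝ}
    (h : ∀ x, Tendsto (fun i => f i x) l (𝓝 (g x))) :
    Tendsto (fun i => avg π (f i)) l (𝓝 (avg π g)) :=
  tendsto_finsetSum _ fun x _ => (h x).const_mul (π x)

end avg

/-! ### Discounted values of the reading strategies -/

open Classical in
/-- The offset `i` if it is useful, otherwise some useful offset. -/
noncomputable def act (s : ℕ) (w : List ℕ) (K i : ℕ) : ℕ :=
  if Useful s w K i then i else if h : ∃ j < w.length, Useful s w K j then h.choose else 0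

theorem act_of_useful {s : ℕ} {w : List ℕ} {K i : ℕ} (h : Useful s w K i) :
    act s w K i = i := if_pos h

theorem act_le {s n : ℕ} {w : List ℕ} (hn : w.length ≤ n + 1) {K i : ℕ} (hi : i ≤ n) :
    act s w K i ≤ n := by
  unfold act
  split_ifs with h1 h2
  · exact hi
  · have := h2.choose_spec.1
    omega
  · omega

theorem useful_act {s : ℕ} {w : List ℕ} (hw : w ≠ []) {K : ℕ} (h : Live s w K) (i : ℕ) :
    Useful s w K (act s w K i) := by
  unfold act
  split_ifs with h1 h2
  · exact h1
  · exact h2.choose_spec.2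
  · exact absurd (exists_useful hw h) h2

/-- The best mean value of `f` after one useful reading from `K`. -/
noncomputable def best {s : ℕ} (w : List ℕ) (n : ℕ) (π : Fin s → ℝ) (f : ℕ → ℝ) (K : ℕ) : ℝ :=
  (Finset.range (n + 1)).sup' Finset.nonempty_range_add_one
    fun i => avg π fun x => after s w f K (act s w K i) x

/-- The optimal value, with discount `β`, of `k` readings. -/
noncomputable def val {s : ℕ} (w : List ℕ) (n : ℕ) (π : Fin s → ℝ) (β : ℝ) : ℕ → ℕ → ℝ
  | 0, _ => 0
  | k + 1, K => if K < (s + 1) ^ (n + 1) then β * best w n π (val w n π β k) K else 0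

section
variable {s : ℕ} {w : List ℕ} {n : ℕ} {π : Fin s → ℝ}

theorem hat_mono {f g : ℕ → ℝ} (h : ∀ K, f K ≤ g K) (K : ℕ) : hat s w f K ≤ hat s w g K := by
  unfold hat
  linarith [h (norm s w K)]

theorem hat_nonneg {f : ℕ → ℝ} (h : ∀ K, 0 ≤ f K) (K : ℕ) : 0 ≤ hat s w f K :=
  add_nonneg (Nat.cast_nonneg _) (h _)

theorem after_mono {f g : ℕ → ℝ} (h : ∀ K, f K ≤ g K) (K i x : ℕ) :
    after s w f K i x ≤ after s w g K i x := by
  unfold after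
  split_ifs
  · linarith [hat_mono (s := s) (w := w) h (rd s K i x / (s + 1))]
  · exact hat_mono h _

theorem after_nonneg {f : ℕ → ℝ} (h : ∀ K, 0 ≤ f K) (K i x : ℕ) : 0 ≤ after s w f K i x := by
  unfold after
  split_ifs
  · linarith [hat_nonneg (s := s) (w := w) h (rd s K i x / (s + 1))]
  · exact hat_nonneg h _

theorem le_best (f : ℕ → ℝ) (K : ℕ) {i : ℕ} (hi : i ≤ n) :
    (avg π fun x => after s w f K (act s w K i) x) ≤ best w n π f K :=
  Finset.le_sup' (fun i => avg π fun x : Fin s => after s w f K (act s w K i) x)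
    (Finset.mem_range.mpr (by omega))

theorem best_le_iff (f : ℕ → ℝ) (K : ℕ) (c : ℝ) : best w n π f K ≤ c ↔
    ∀ i ≤ n, (avg π fun x => after s w f K (act s w K i) x) ≤ c := by
  simp [best, Finset.sup'_le_iff]

theorem best_mono (hπ : π ∈ stdSimplex ℝ (Fin s)) {f g : ℕ → ℝ} (h : ∀ K, f K ≤ g K) (K : ℕ) :
    best w n π f K ≤ best w n π g K :=
  (best_le_iff _ _ _).mpr fun _ hi =>
    (avg_mono hπ fun x => after_mono h K _ x).trans (le_best g K hi)

theorem best_nonneg (hπ : π ∈ stdSimplex ℝ (Fin s)) {f : ℕ → ℝ} (h : ∀ K, 0 ≤ f K) (K : ℕ) :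
    0 ≤ best w n π f K :=
  (const_le_avg hπ fun x => after_nonneg h K _ x).trans (le_best f K (Nat.zero_le n))

theorem val_nonneg (hπ : π ∈ stdSimplex ℝ (Fin s)) {β : ℝ} (h0 : 0 ≤ β) :
    ∀ k K, 0 ≤ val w n π β k K
  | 0, _ => le_rfl
  | k + 1, K => by
    unfold val
    split_ifs
    · exact mul_nonneg h0 (best_nonneg hπ (val_nonneg hπ h0 k) K)
    · exact le_rfl

theorem val_le_succ (hπ : π ∈ stdSimplex ℝ (Fin s)) {β : ℝ} (h0 : 0 ≤ β) :
    ∀ k K, val w n π β k K ≤ val w n π β (k + 1) K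
  | 0, K => val_nonneg hπ h0 1 K
  | k + 1, K => by
    rw [val, val]
    split_ifs
    · exact mul_le_mul_of_nonneg_left (best_mono hπ (val_le_succ hπ h0 k) K) h0
    · exact le_rfl

theorem div_lt_window {K : ℕ} (hK : K < (s + 1) ^ (n + 1)) : K / (s + 1) < (s + 1) ^ (n + 1) :=
  (Nat.div_le_self _ _).trans_lt hK

theorem hat_le (hs : 0 < s) {f : ℕ → ℝ} {c : ℝ} (h : ∀ K, f K ≤ c) {d K : ℕ}
    (hK : K < (s + 1) ^ d) : hat s w f K ≤ d + c := by
  unfold hat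
  have : (skip s w K : ℝ) ≤ d := by exact_mod_cast skip_le hs w hK
  linarith [h (norm s w K)]

theorem after_le (hs : 0 < s) {f : ℕ → ℝ} {c : ℝ} (h : ∀ K, f K ≤ c) {K i x : ℕ} (hx : x < s)
    (hK : K < (s + 1) ^ (n + 1)) (hi : i ≤ n) : after s w f K i x ≤ n + 1 + c := by
  have hr := rd_lt hx hK hi
  unfold after
  split_ifs
  · have : rd s K i x / (s + 1) < (s + 1) ^ n := by
      rwa [pow_succ, ← Nat.div_lt_iff_lt_mul (by omega)] at hr
    linarith [hat_le (w := w) hs h this]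
  · have := hat_le (w := w) hs h hr
    push_cast at this
    linarith

/-- One reading gains at most `n + 1` positions, since the knowledge lies within the window. The
bound is not sharp: it only needs to be preserved by the recursion and to be of order `1 / (1 - β)`.
-/
theorem val_le (hs : 0 < s) (hn : w.length ≤ n + 1) (hπ : π ∈ stdSimplex ℝ (Fin s)) {β : ℝ}
    (h0 : 0 ≤ β) (h1 : β < 1) : ∀ k K, val w n π β k K ≤ (n + 1) / (1 - β)
  | 0, _ => by unfold val; have : 0 < 1 - β := by linarith
               positivity
  | k + 1, K => by
    have hb : 0 < 1 - β := by linarith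
    unfold val
    split_ifs with hK
    · have : best w n π (val w n π β k) K ≤ n + 1 + (n + 1) / (1 - β) :=
        (best_le_iff _ _ _).mpr fun i hi => avg_le_const hπ fun x =>
          after_le hs (val_le hs hn hπ h0 h1 k) x.2 hK (act_le hn hi)
      calc _ ≤ β * (n + 1 + (n + 1) / (1 - β)) := mul_le_mul_of_nonneg_left this h0
        _ = (n + 1) / (1 - β) - (n + 1) * (1 - β) := by field_simp; ring
        _ ≤ _ := by
          have : 0 ≤ ((n : ℝ) + 1) * (1 - β) := by positivity
          linarith
    · positivity

/-! ### Free skips and free letters never hurt. -/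

/-- Skipping the offset `0` for free is never a loss. -/
def SkipGain (s : ℕ) (w : List ℕ) (n : ℕ) (f : ℕ → ℝ) : Prop :=
  ∀ K < (s + 1) ^ (n + 1), hat s w f K ≤ 1 + hat s w f (K / (s + 1))

/-- Free information is never a loss on average. -/
def ReadGain {s : ℕ} (w : List ℕ) (n : ℕ) (π : Fin s → ℝ) (f : ℕ → ℝ) : Prop :=
  ∀ K < (s + 1) ^ (n + 1), ∀ i ≤ n, hat s w f K ≤ avg π fun x => hat s w f (rd s K i x)

theorem SkipGain.hat_rd_le_after {f : ℕ → ℝ} (h : SkipGain s w n f) {K i x : ℕ} (hx : x < s)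
    (hK : K < (s + 1) ^ (n + 1)) (hi : i ≤ n) : hat s w f (rd s K i x) ≤ after s w f K i x := by
  unfold after
  split_ifs
  · exact h _ (rd_lt hx hK hi)
  · exact le_rfl

theorem SkipGain.after_le {f : ℕ → ℝ} (h : SkipGain s w n f) {K i x : ℕ} (hx : x < s)
    (hK : K < (s + 1) ^ (n + 1)) (hi : i ≤ n) :
    after s w f K i x ≤ 1 + hat s w f (rd s K i x / (s + 1)) := by
  unfold after
  split_ifs
  · exact le_rfl
  · exact h _ (rd_lt hx hK hi)

theorem after_of_not_live {f : ℕ → ℝ} {K i x : ℕ} (hx : x < s) (h : ¬ Live s w K) :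
    after s w f K i x = hat s w f (rd s K i x) :=
  if_neg fun h' => h (h'.2.live.of_rd hx)

/-- Once the offset `0` is dropped, a letter read there is forgotten, and a letter read at `i + 1`
is one read at `i` in the shifted knowledge. The predicate `P` lets the same case distinction serve
upper and lower bounds. -/
theorem avg_hat_rd_div (hπ : π ∈ stdSimplex ℝ (Fin s)) {f : ℕ → ℝ} {c K i : ℕ} {P : ℝ → Prop}
    (hi : i ≤ c) (h0 : P (hat s w f (K / (s + 1))))
    (h1 : ∀ j ≤ c, P (avg π fun x => hat s w f (rd s (K / (s + 1)) j x))) :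
    P (avg π fun x => hat s w f (rd s K i x / (s + 1))) := by
  rcases i with _ | i
  · simp only [rd_div_zero (Fin.is_lt _)]
    rwa [avg_const hπ]
  · simp only [rd_div_succ]
    exact h1 i (by omega)

theorem avg_hat_rd_of_not_live (hs : 0 < s) (hπ : π ∈ stdSimplex ℝ (Fin s)) (f : ℕ → ℝ)
    {K : ℕ} (h : ¬ Live s w K) (i : ℕ) :
    (avg π fun x => hat s w f (rd s K i x)) =
      1 + avg π fun x => hat s w f (rd s K i x / (s + 1)) := by
  rw [← avg_const_add hπ]
  congr 1
  funext x
  exact hat_of_not_live hs f fun h' => h (h'.of_rd x.2)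

/-- A useful offset is one of the actions in `best`. A useless one gives the mean `val w n π β k K`,
and multiplying this nonnegative number by `β` only lowers it, while one more reading only raises
it. -/
theorem mul_avg_after_le (hs : 0 < s) (hπ : π ∈ stdSimplex ℝ (Fin s)) {β : ℝ}
    (h0 : 0 ≤ β) (h1 : β < 1) (k : ℕ) {K j : ℕ} (hK : K < (s + 1) ^ (n + 1)) (hl : Live s w K)
    (hj : j ≤ n) :
    (β * avg π fun x => after s w (val w n π β k) K j x) ≤ val w n π β (k + 1) K := by
  by_cases hu : Useful s w K j
  · rw [val, if_pos hK]
    refine mul_le_mul_of_nonneg_left ?_ h0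
    simpa [act_of_useful hu] using le_best (π := π) (w := w) (val w n π β k) K hj
  · simp only [after_of_not_useful _ hu]
    rw [avg_const hπ, hat_of_live hs _ hl]
    have := val_nonneg (w := w) (n := n) hπ h0 k K
    have := val_le_succ (w := w) (n := n) hπ h0 k K
    nlinarith

/-- With one more reading available, the letter at the offset `j` can be bought at the price of a
discount. For dead knowledge the first offset is dropped on both sides before recursing. -/
theorem mul_avg_hat_rd_le (hs : 0 < s) (hπ : π ∈ stdSimplex ℝ (Fin s)) {β : ℝ}
    (h0 : 0 ≤ β) (h1 : β < 1) {k : ℕ} (hD : SkipGain s w n (val w n π β k)) :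
    ∀ K < (s + 1) ^ (n + 1), ∀ j ≤ n,
    (β * avg π fun x => hat s w (val w n π β k) (rd s K j x)) ≤ hat s w (val w n π β (k + 1)) K := by
  intro K
  induction K using Nat.strong_induction_on with
  | _ K ih =>
    intro hK j hj
    by_cases hl : Live s w K
    · rw [hat_of_live hs _ hl]
      exact (mul_le_mul_of_nonneg_left (avg_mono hπ fun x => hD.hat_rd_le_after x.2 hK hj) h0).trans
        (mul_avg_after_le hs hπ h0 h1 k hK hl hj)
    · rw [avg_hat_rd_of_not_live hs hπ _ hl, hat_of_not_live hs _ hl]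
      have hb := div_lt_window hK
      have := avg_hat_rd_div (w := w) (K := K) (c := n) (f := val w n π β k)
        (P := fun r => β * r ≤ hat s w (val w n π β (k + 1)) (K / (s + 1))) hπ hj
        (by
          have h2 := hat_mono (s := s) (w := w) (val_le_succ (w := w) (n := n) hπ h0 k)
            (K / (s + 1))
          have h3 := hat_nonneg (s := s) (w := w) (val_nonneg (w := w) (n := n) hπ h0 k)
            (K / (s + 1))
          nlinarith)
        (ih _ (div_lt_self_of_not_live hs hl) hb)
      linarith

theorem mul_avg_hat_rd_div_le (hs : 0 < s) (hπ : π ∈ stdSimplex ℝ (Fin s)) {β : ℝ}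
    (h0 : 0 ≤ β) (h1 : β < 1) {k : ℕ} (hD : SkipGain s w n (val w n π β k)) {K j : ℕ}
    (hK : K < (s + 1) ^ (n + 1)) (hj : j ≤ n) :
    (β * avg π fun x => hat s w (val w n π β k) (rd s K j x / (s + 1))) ≤
      hat s w (val w n π β (k + 1)) (K / (s + 1)) :=
  avg_hat_rd_div (w := w) (K := K) (c := n) (f := val w n π β k)
    (P := fun r => β * r ≤ hat s w (val w n π β (k + 1)) (K / (s + 1))) hπ hj
    (by
      have h2 := hat_mono (s := s) (w := w) (val_le_succ (w := w) (n := n) hπ h0 k) (K / (s + 1))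
      have h3 := hat_nonneg (s := s) (w := w) (val_nonneg (w := w) (n := n) hπ h0 k) (K / (s + 1))
      nlinarith)
    (mul_avg_hat_rd_le hs hπ h0 h1 hD _ (div_lt_window hK))

/-- By simulation: a player who was moved forward for free imitates the reading of the other one,
seen from the new position. The induction hypothesis compares the values after that reading; the
reading may fall on the dropped offset, and is then not needed. -/
theorem skipGain_val (hs : 0 < s) (hn : w.length ≤ n + 1) (hπ : π ∈ stdSimplex ℝ (Fin s)) {β : ℝ}
    (h0 : 0 ≤ β) (h1 : β < 1) : ∀ k, SkipGain s w n (val w n π β k)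
  | 0 => by
    intro K _
    by_cases hl : Live s w K
    · rw [hat_of_live hs _ hl]
      have := hat_nonneg (s := s) (w := w) (val_nonneg (w := w) (n := n) hπ h0 0) (K / (s + 1))
      have hv : val w n π β 0 K = 0 := rfl
      linarith
    · rw [hat_of_not_live hs _ hl]
  | k + 1 => by
    intro K hK
    have ih := skipGain_val hs hn hπ h0 h1 k
    by_cases hl : Live s w K
    · rw [hat_of_live hs _ hl, val, if_pos hK]
      have h2 := hat_nonneg (s := s) (w := w) (val_nonneg (w := w) (n := n) hπ h0 (k + 1))
        (K / (s + 1))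
      rcases h0.eq_or_lt with rfl | hpos
      · linarith
      rw [← le_div_iff₀' hpos, best_le_iff]
      intro i hi
      rw [le_div_iff₀' hpos]
      have h3 := avg_mono hπ fun x : Fin s => ih.after_le (K := K) x.2 hK (act_le (K := K) (s := s) hn hi)
      rw [avg_const_add hπ] at h3
      have h4 := mul_avg_hat_rd_div_le hs hπ h0 h1 ih hK (act_le (K := K) (s := s) hn hi)
      nlinarith
    · rw [hat_of_not_live hs _ hl]

theorem readGain_of_live (hs : 0 < s) (hπ : π ∈ stdSimplex ℝ (Fin s)) {f : ℕ → ℝ}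
    (h : ∀ K < (s + 1) ^ (n + 1), Live s w K → ∀ i ≤ n,
      f K ≤ avg π fun x => hat s w f (rd s K i x)) : ReadGain w n π f := by
  intro K
  induction K using Nat.strong_induction_on with
  | _ K ih =>
    intro hK i hi
    by_cases hl : Live s w K
    · rw [hat_of_live hs _ hl]
      exact h K hK hl i hi
    · rw [avg_hat_rd_of_not_live hs hπ _ hl, hat_of_not_live hs _ hl]
      have := avg_hat_rd_div (w := w) (K := K) (c := n) (f := f)
        (P := fun r => hat s w f (K / (s + 1)) ≤ r) hπ hi le_rfl
        (ih _ (div_lt_self_of_not_live hs hl) (div_lt_window hK))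
      linarith

theorem ReadGain.hat_div_le (hπ : π ∈ stdSimplex ℝ (Fin s)) {f : ℕ → ℝ} (h : ReadGain w n π f)
    {K i : ℕ} (hK : K < (s + 1) ^ (n + 1)) (hi : i ≤ n) :
    hat s w f (K / (s + 1)) ≤ avg π fun x => hat s w f (rd s K i x / (s + 1)) :=
  avg_hat_rd_div (w := w) (K := K) (c := n) (f := f)
    (P := fun r => hat s w f (K / (s + 1)) ≤ r) hπ hi le_rfl (h _ (div_lt_window hK))

/-- A free letter at `i` given before the reading at `j` can be exchanged with it, since the
readings at distinct offsets commute and the means may be interchanged. `ReadGain` then applies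
after the reading at `j`. If only the extra letter completes the occurrence, the additional printing
is harmless by `SkipGain`. -/
theorem avg_after_le_avg_avg_after (hπ : π ∈ stdSimplex ℝ (Fin s)) {f : ℕ → ℝ}
    (hD : SkipGain s w n f) (hC : ReadGain w n π f) {K i j : ℕ} (hK : K < (s + 1) ^ (n + 1))
    (hi : i ≤ n) (hj : j ≤ n) :
    (avg π fun y => after s w f K j y) ≤
      avg π fun x => avg π fun y => after s w f (rd s K i x) j y := by
  by_cases hij : i = j
  · subst hij
    refine avg_mono hπ fun x => const_le_avg hπ fun y => le_of_eq ?_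
    simp only [after, Prints, rd_rd_self x.2]
  · rw [avg_comm]
    refine avg_mono hπ fun y => ?_
    have hKj := rd_lt y.2 hK hj
    by_cases hp : Prints s w K j y
    · have hp' : ∀ x : Fin s, Prints s w (rd s K i x) j y := fun x =>
        ⟨hp.1, by rw [rd_comm x.2 y.2 hij]; exact hp.2.rd x.2⟩
      simp only [after, hp, hp', if_true]
      rw [avg_const_add hπ]
      simp only [rd_comm (Fin.is_lt _) y.2 hij]
      linarith [hC.hat_div_le hπ hKj hi]
    · rw [after, if_neg hp]
      refine (hC _ hKj i hi).trans (avg_mono hπ fun x => ?_)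
      rw [← rd_comm x.2 y.2 hij]
      exact hD.hat_rd_le_after y.2 (rd_lt x.2 hK hi) hj

/-- By simulation again: the informed player performs the reading that is best for the uninformed
one, even if it is useless to it. -/
theorem readGain_val (hs : 0 < s) (hn : w.length ≤ n + 1) (hπ : π ∈ stdSimplex ℝ (Fin s)) {β : ℝ}
    (h0 : 0 ≤ β) (h1 : β < 1) : ∀ k, ReadGain w n π (val w n π β k)
  | 0 => readGain_of_live hs hπ fun K _ _ i _ =>
    const_le_avg hπ fun x => hat_nonneg (val_nonneg (w := w) (n := n) hπ h0 0) _
  | k + 1 => by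
    refine readGain_of_live hs hπ fun K hK hl i hi => ?_
    have hC := readGain_val hs hn hπ h0 h1 k
    have hD := skipGain_val hs hn hπ h0 h1 k
    rcases h0.eq_or_lt with rfl | hpos
    · refine le_trans (le_of_eq ?_) (const_le_avg hπ fun x => hat_nonneg (val_nonneg hπ h0 _) _)
      rw [val, if_pos hK, zero_mul]
    rw [val, if_pos hK, ← le_div_iff₀' hpos, best_le_iff]
    intro l hl'
    rw [le_div_iff₀' hpos]
    have hj := act_le (K := K) (s := s) hn hl'
    refine (mul_le_mul_of_nonneg_left (avg_after_le_avg_avg_after hπ hD hC hK hi hj) h0).trans ?_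
    rw [← avg_mul_left]
    refine avg_mono hπ fun x => ?_
    have hKx := rd_lt x.2 hK hi
    by_cases hlx : Live s w (rd s K i x)
    · rw [hat_of_live hs _ hlx]
      exact mul_avg_after_le hs hπ h0 h1 k hKx hlx hj
    · simp only [after_of_not_live (Fin.is_lt _) hlx]
      exact mul_avg_hat_rd_le hs hπ h0 h1 hD _ hKx _ hj

/-! ### Passage to the limit in the number of readings. -/

theorem tendsto_hat {ι : Type*} {l : Filter ι} {f : ι → ℕ → ℝ} {g : ℕ → ℝ}
    (h : ∀ K, Tendsto (fun i => f i K) l (𝓝 (g K))) (K : ℕ) :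
    Tendsto (fun i => hat s w (f i) K) l (𝓝 (hat s w g K)) := (h _).const_add _

theorem tendsto_after {ι : Type*} {l : Filter ι} {f : ι → ℕ → ℝ} {g : ℕ → ℝ}
    (h : ∀ K, Tendsto (fun i => f i K) l (𝓝 (g K))) (K i x : ℕ) :
    Tendsto (fun a => after s w (f a) K i x) l (𝓝 (after s w g K i x)) := by
  unfold after
  split_ifs
  · exact (tendsto_hat h _).const_add _
  · exact tendsto_hat h _

theorem tendsto_best {ι : Type*} {l : Filter ι} {f : ι → ℕ → ℝ} {g : ℕ → ℝ}
    (h : ∀ K, Tendsto (fun i => f i K) l (𝓝 (g K))) (K : ℕ) :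
    Tendsto (fun a => best w n π (f a) K) l (𝓝 (best w n π g K)) :=
  Filter.Tendsto.finset_sup'_nhds_apply _ fun _ _ =>
    tendsto_avg fun x => tendsto_after h K _ x

theorem SkipGain.of_tendsto {ι : Type*} {l : Filter ι} [l.NeBot] {f : ι → ℕ → ℝ} {g : ℕ → ℝ}
    (h : ∀ K, Tendsto (fun i => f i K) l (𝓝 (g K))) (hf : ∀ i, SkipGain s w n (f i)) :
    SkipGain s w n g := fun K hK =>
  le_of_tendsto_of_tendsto' (tendsto_hat h K) ((tendsto_hat h _).const_add 1) fun i => hf i K hK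

theorem ReadGain.of_tendsto {ι : Type*} {l : Filter ι} [l.NeBot] {f : ι → ℕ → ℝ} {g : ℕ → ℝ}
    (h : ∀ K, Tendsto (fun i => f i K) l (𝓝 (g K))) (hf : ∀ i, ReadGain w n π (f i)) :
    ReadGain w n π g := fun K hK i hi =>
  le_of_tendsto_of_tendsto' (tendsto_hat h K) (tendsto_avg fun _ => tendsto_hat h _)
    fun a => hf a K hK i hi

/-- Existence and properties of the optimal discounted value. -/
theorem exists_discounted_value (hs : 0 < s) (hn : w.length ≤ n + 1)
    (hπ : π ∈ stdSimplex ℝ (Fin s)) {β : ℝ} (h0 : 0 ≤ β) (h1 : β < 1) :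
    ∃ V : ℕ → ℝ, (∀ K, 0 ≤ V K) ∧ (∀ K, (1 - β) * V K ≤ n + 1) ∧
      (∀ K < (s + 1) ^ (n + 1), V K = β * best w n π V K) ∧
      SkipGain s w n V ∧ ReadGain w n π V := by
  have hlim : ∀ K, Tendsto (fun k => val w n π β k K) atTop (𝓝 (⨆ k, val w n π β k K)) := fun K =>
    tendsto_atTop_ciSup (monotone_nat_of_le_succ fun k => val_le_succ hπ h0 k K)
      ⟨_, by rintro _ ⟨k, rfl⟩; exact val_le hs hn hπ h0 h1 k K⟩
  refine ⟨fun K => ⨆ k, val w n π β k K, fun K => ?_, fun K => ?_, fun K hK => ?_,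
    .of_tendsto hlim (skipGain_val hs hn hπ h0 h1), .of_tendsto hlim (readGain_val hs hn hπ h0 h1)⟩
  · exact ge_of_tendsto' (hlim K) fun k => val_nonneg hπ h0 k K
  · rw [mul_comm, ← le_div_iff₀ (by linarith)]
    exact le_of_tendsto' (hlim K) fun k => val_le hs hn hπ h0 h1 k K
  · refine tendsto_nhds_unique ((hlim K).comp (tendsto_add_atTop_nat 1)) ?_
    refine ((tendsto_best hlim K).const_mul β).congr fun k => ?_
    simp [val, hK]

end
end PatternMatching

namespace PatternMatching

/-! ### The average-reward optimality equation -/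

section
variable {s : ℕ} {w : List ℕ} {n : ℕ} {π : Fin s → ℝ}

theorem mul_hat_le (hs : 0 < s) {V : ℕ → ℝ} {β : ℝ} (h0 : 0 ≤ β)
    (hV : ∀ K, (1 - β) * V K ≤ n + 1) {d K : ℕ} (hK : K < (s + 1) ^ d) :
    (1 - β) * hat s w V K ≤ d + (n + 1) := by
  have hsk : (skip s w K : ℝ) ≤ d := by exact_mod_cast skip_le hs w hK
  have h2 := hV (norm s w K)
  have h3 : (1 - β) * (skip s w K : ℝ) ≤ d := by
    have : (0 : ℝ) ≤ skip s w K := Nat.cast_nonneg _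
    nlinarith
  unfold hat
  linarith

/-- A converse to `ReadGain`: the letter can be bought by reading it. The only loss is the factor
`β`, which costs `1 - β` times a value of order `1 / (1 - β)`, hence a constant independent of `β`.
-/
theorem avg_hat_rd_le (hs : 0 < s) (hπ : π ∈ stdSimplex ℝ (Fin s)) {V : ℕ → ℝ} {β : ℝ}
    (h0 : 0 ≤ β) (hV : ∀ K, (1 - β) * V K ≤ n + 1)
    (hV' : ∀ K < (s + 1) ^ (n + 1), V K = β * best w n π V K) (hD : SkipGain s w n V) :
    ∀ K < (s + 1) ^ (n + 1), ∀ i ≤ n,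
      (avg π fun x => hat s w V (rd s K i x)) ≤ hat s w V K + 2 * (n + 1) := by
  intro K
  induction K using Nat.strong_induction_on with
  | _ K ih =>
    intro hK i hi
    by_cases hl : Live s w K
    · by_cases hu : Useful s w K i
      · have h2 := le_best (w := w) (π := π) V K hi
        rw [act_of_useful hu] at h2
        have h3 := (avg_mono hπ fun x : Fin s => hD.hat_rd_le_after x.2 hK hi).trans h2
        have h4 : (1 - β) * (avg π fun x => hat s w V (rd s K i x)) ≤ 2 * (n + 1) := by
          rw [← avg_mul_left]
          refine avg_le_const hπ fun x => ?_
          have := mul_hat_le (w := w) hs h0 hV (rd_lt x.2 hK hi)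
          push_cast at this
          linarith
        rw [hat_of_live hs _ hl, hV' K hK]
        nlinarith
      · have : ∀ x, rd s K i x = K := fun x => rd_known (fun h => hu (Or.inl h)) x
        simp only [this]
        rw [avg_const hπ]
        have : (0 : ℝ) ≤ n := Nat.cast_nonneg n
        linarith
    · rw [avg_hat_rd_of_not_live hs hπ _ hl, hat_of_not_live hs _ hl]
      have := avg_hat_rd_div (w := w) (K := K) (c := n) (f := V)
        (P := fun r => r ≤ hat s w V (K / (s + 1)) + 2 * (n + 1)) hπ hi
        (by have : (0 : ℝ) ≤ n := Nat.cast_nonneg n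
            linarith)
        (ih _ (div_lt_self_of_not_live hs hl) (div_lt_window hK))
      linarith

/-- A converse to `SkipGain` when the window of `w` is known. Either the position is dead and the
skip is free, or the occurrence is certain and rereading the offset `0` prints it, at the cost of
one discount. -/
theorem one_add_hat_div_le (hs : 0 < s) (hw : w ≠ []) (hπ : π ∈ stdSimplex ℝ (Fin s)) {V : ℕ → ℝ}
    {β : ℝ} (h0 : 0 ≤ β) (hV : ∀ K, (1 - β) * V K ≤ n + 1)
    (hV' : ∀ K < (s + 1) ^ (n + 1), V K = β * best w n π V K)
    {K : ℕ} (hK : K < (s + 1) ^ (n + 1)) (hk : ∀ j < w.length, dig s K j ≠ 0) :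
    1 + hat s w V (K / (s + 1)) ≤ hat s w V K + 2 * (n + 1) := by
  have hn : (0 : ℝ) ≤ n := Nat.cast_nonneg n
  rcases full_or_not_live hk with hf | hl
  · have hm := List.length_pos_iff.mpr hw
    have h2 := le_best (w := w) (π := π) V K (Nat.zero_le n)
    rw [act_of_useful (Or.inr ⟨hm, hf⟩)] at h2
    have h3 : ∀ x, after s w V K 0 x = 1 + hat s w V (K / (s + 1)) := fun x => by
      have : rd s K 0 x = K := rd_known (by rw [hf 0 hm]; omega) x
      have hp : Prints s w K 0 x := ⟨hm, by rwa [this]⟩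
      rw [after, if_pos hp, this]
    simp only [h3] at h2
    rw [avg_const hπ] at h2
    have h4 : K / (s + 1) < (s + 1) ^ n := by
      rwa [pow_succ, ← Nat.div_lt_iff_lt_mul (by omega)] at hK
    have h5 := mul_hat_le (w := w) hs h0 hV h4
    rw [hat_of_live hs _ hf.live, hV' K hK]
    nlinarith
  · rw [hat_of_not_live hs _ hl]
    linarith

/-- A coupling: `K` and `K'` know the same `l` offsets and agree beyond the first `a`. Both receive
the same letter at the offset `l` and drop the offset `0`, which brings the disagreement down to `a
- 1` offsets. For `K` this is an upper bound by `ReadGain` and `SkipGain`; for `K'` it costs `c` for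
the letter and `c` for the skip. -/
theorem hat_le_of_div_pow_eq (hπ : π ∈ stdSimplex ℝ (Fin s)) {V : ℕ → ℝ} {c : ℝ}
    {l : ℕ} (hl : l ≤ n)
    (h1 : ∀ K < (s + 1) ^ (n + 1), ∀ i ≤ n,
      (avg π fun x => hat s w V (rd s K i x)) ≤ hat s w V K + c)
    (h2 : ∀ K < (s + 1) ^ (n + 1), (∀ j < l + 1, dig s K j ≠ 0) →
      1 + hat s w V (K / (s + 1)) ≤ hat s w V K + c)
    (hD : SkipGain s w n V) (hC : ReadGain w n π V) :
    ∀ a ≤ l, ∀ K < (s + 1) ^ l, ∀ K' < (s + 1) ^ l, (∀ j < l, dig s K j ≠ 0) →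
      (∀ j < l, dig s K' j ≠ 0) → K / (s + 1) ^ a = K' / (s + 1) ^ a →
      hat s w V K ≤ hat s w V K' + a * (2 * c) := by
  intro a
  induction a with
  | zero =>
    intro _ K _ K' _ _ _ h
    simp only [pow_zero, Nat.div_one] at h
    simp [h]
  | succ a ih =>
    intro ha K hK K' hK' hk hk' h
    have hpow : ∀ {M}, M < (s + 1) ^ l → M < (s + 1) ^ (n + 1) := fun {M} hM =>
      hM.trans_le (Nat.pow_le_pow_right (by omega) (by omega))
    have key : ∀ M < (s + 1) ^ l, (∀ j < l, dig s M j ≠ 0) → ∀ x : Fin s,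
        rd s M l x / (s + 1) < (s + 1) ^ l ∧ (∀ j < l + 1, dig s (rd s M l x) j ≠ 0) ∧
        rd s M l x / (s + 1) / (s + 1) ^ a = rd s (M / (s + 1) ^ (a + 1)) (l - (a + 1)) x := by
      intro M hM hMk x
      refine ⟨?_, fun j hj => ?_, ?_⟩
      · rw [Nat.div_lt_iff_lt_mul (by omega), ← pow_succ]
        exact rd_lt x.2 (hM.trans_le (Nat.pow_le_pow_right (by omega) (by omega))) le_rfl
      · rcases Nat.lt_succ_iff_lt_or_eq.mp hj with hj | rfl
        · rw [dig_rd_of_known x.2 (hMk j hj)]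
          exact hMk j hj
        · exact dig_rd_self_ne x.2 _ _
      · rw [Nat.div_div_eq_div_mul, ← pow_succ', rd_div_pow ha]
    have hu : hat s w V K ≤ 1 + avg π fun x => hat s w V (rd s K l x / (s + 1)) := by
      rw [← avg_const_add hπ]
      exact (hC K (hpow hK) l hl).trans (avg_mono hπ fun x => hD _ (rd_lt x.2 (hpow hK) hl))
    have hd : (1 + avg π fun x => hat s w V (rd s K' l x / (s + 1))) ≤ hat s w V K' + 2 * c := by
      have h3 := h1 K' (hpow hK') l hl
      have h4 := avg_mono hπ fun x : Fin s =>
        h2 _ (rd_lt x.2 (hpow hK') hl) (key K' hK' hk' x).2.1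
      rw [avg_const_add hπ, avg_add_const hπ] at h4
      linarith
    have hm : (avg π fun x => hat s w V (rd s K l x / (s + 1))) ≤
        (avg π fun x => hat s w V (rd s K' l x / (s + 1))) + a * (2 * c) := by
      rw [← avg_add_const hπ]
      refine avg_mono hπ fun x => ?_
      refine ih (by omega) _ (key K hK hk x).1 _ (key K' hK' hk' x).1 (fun j hj => ?_)
        (fun j hj => ?_) ?_
      · rw [dig_div]; exact (key K hK hk x).2.1 _ (by omega)
      · rw [dig_div]; exact (key K' hK' hk' x).2.1 _ (by omega)
      · rw [(key K hK hk x).2.2, (key K' hK' hk' x).2.2, h]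
    push_cast
    linarith

/-- Any two windows are compared by filling in all their unknown letters (`fill`, one `c` for each
offset), dropping offsets until only `l` known letters remain (`known`, one `c` for each of `d`
offsets), and coupling these `l` letters until the old ones have left (`2 * c` for each). -/
theorem hat_le_hat_add (hπ : π ∈ stdSimplex ℝ (Fin s)) {V : ℕ → ℝ} {c : ℝ}
    {l d : ℕ} (hl : l + d = n + 1) (hd : 0 < d)
    (h1 : ∀ K < (s + 1) ^ (n + 1), ∀ i ≤ n,
      (avg π fun x => hat s w V (rd s K i x)) ≤ hat s w V K + c)
    (h2 : ∀ K < (s + 1) ^ (n + 1), (∀ j < l + 1, dig s K j ≠ 0) →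
      1 + hat s w V (K / (s + 1)) ≤ hat s w V K + c)
    (hD : SkipGain s w n V) (hC : ReadGain w n π V) {K K' : ℕ} (hK : K < (s + 1) ^ (n + 1))
    (hK' : K' < (s + 1) ^ (n + 1)) :
    hat s w V K ≤ hat s w V K' + (2 * l + d + (n + 1)) * c := by
  have known : ∀ e ≤ d, ∀ K < (s + 1) ^ (l + e), ∀ K' < (s + 1) ^ (l + e),
      (∀ j < l + e, dig s K j ≠ 0) → (∀ j < l + e, dig s K' j ≠ 0) →
      hat s w V K ≤ hat s w V K' + (2 * l + e) * c := by
    intro e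
    induction e with
    | zero =>
      intro _ K hK K' hK' hk hk'
      have := hat_le_of_div_pow_eq hπ (by omega) h1 h2 hD hC l le_rfl K hK K' hK' hk hk'
        (by rw [Nat.div_eq_of_lt (by simpa using hK), Nat.div_eq_of_lt (by simpa using hK')])
      push_cast
      linarith
    | succ e ih =>
      intro he K hK K' hK' hk hk'
      have hpow : ∀ {M}, M < (s + 1) ^ (l + (e + 1)) → M < (s + 1) ^ (n + 1) := fun {M} hM =>
        hM.trans_le (Nat.pow_le_pow_right (by omega) (by omega))
      have h3 := hD K (hpow hK)
      have h4 := h2 K' (hpow hK') fun j hj => hk' j (by omega)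
      have h5 := ih (by omega) (K / (s + 1))
        (by rw [Nat.div_lt_iff_lt_mul (by omega), ← pow_succ]; exact hK) (K' / (s + 1))
        (by rw [Nat.div_lt_iff_lt_mul (by omega), ← pow_succ]; exact hK')
        (fun j hj => by rw [dig_div]; exact hk _ (by omega))
        (fun j hj => by rw [dig_div]; exact hk' _ (by omega))
      push_cast
      linarith
  have fill : ∀ e ≤ n + 1, ∀ K < (s + 1) ^ (n + 1), ∀ K' < (s + 1) ^ (n + 1),
      (∀ j < n + 1 - e, dig s K j ≠ 0) → (∀ j < n + 1 - e, dig s K' j ≠ 0) →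
      hat s w V K ≤ hat s w V K' + (2 * l + d + e) * c := by
    intro e
    induction e with
    | zero =>
      intro _ K hK K' hK' hk hk'
      have := known d le_rfl K (hl ▸ hK) K' (hl ▸ hK') (fun j hj => hk j (by omega))
        (fun j hj => hk' j (by omega))
      push_cast
      linarith
    | succ e ih =>
      intro he K hK K' hK' hk hk'
      have hi : n - e ≤ n := Nat.sub_le _ _
      have key : ∀ M < (s + 1) ^ (n + 1), (∀ j < n + 1 - (e + 1), dig s M j ≠ 0) → ∀ x : Fin s,
          ∀ j < n + 1 - e, dig s (rd s M (n - e) x) j ≠ 0 := by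
        intro M hM hMk x j hj
        by_cases hje : j = n - e
        · subst hje; exact dig_rd_self_ne x.2 _ _
        · rw [dig_rd_of_ne x.2 hje]
          exact hMk j (by omega)
      have h3 : ∀ y : Fin s, hat s w V K ≤
          hat s w V (rd s K' (n - e) y) + (2 * l + d + e) * c := fun y =>
        (hC K hK _ hi).trans <| avg_le_const hπ fun x =>
          ih (by omega) _ (rd_lt x.2 hK hi) _ (rd_lt y.2 hK' hi) (key K hK hk x) (key K' hK' hk' y)
      have h4 := const_le_avg hπ h3
      rw [avg_add_const hπ] at h4
      have h5 := h1 K' hK' _ hi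
      push_cast
      linarith
  have := fill (n + 1) le_rfl K hK K' hK' (by simp) (by simp)
  push_cast at this
  exact this

/-- The average-reward optimality equation for reading strategies: the optimal gain does not depend
on the initial knowledge. -/
theorem exists_gain (hs : 0 < s) (hw : w ≠ []) (hn : w.length ≤ n + 1)
    (hπ : π ∈ stdSimplex ℝ (Fin s)) :
    ∃ (g : ℝ) (h : ℕ → ℝ), 0 ≤ g ∧ SkipGain s w n h ∧ ∀ K < (s + 1) ^ (n + 1), Live s w K →
      (∃ i ≤ n, Useful s w K i ∧ (avg π fun x => after s w h K i x) = g + h K) ∧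
      ∀ i ≤ n, (avg π fun x => after s w h K i x) ≤ g + h K := by
  classical
  have hm := List.length_pos_iff.mpr hw
  set c : ℝ := 2 * (n + 1) with hc
  set C : ℝ := (2 * (w.length - 1 : ℕ) + (n + 1 - (w.length - 1) : ℕ) + (n + 1)) * c with hC
  have hC0 : 0 ≤ C := by positivity
  have hB : 0 < (s + 1) ^ (n + 1) := by positivity
  -- Discount factors tending to one. The constants `c` and `C` do not depend on them.
  set β : ℕ → ℝ := fun k => 1 - 1 / ((k : ℝ) + 1) with hβ
  have hβ0 : ∀ k, 0 ≤ β k := fun k => by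
    have : 1 / ((k : ℝ) + 1) ≤ 1 := by
      rw [div_le_one (by positivity)]
      have : (0 : ℝ) ≤ k := Nat.cast_nonneg k
      linarith
    simp only [hβ]; linarith
  have hβ1 : ∀ k, β k < 1 := fun k => by
    have : 0 < 1 / ((k : ℝ) + 1) := by positivity
    simp only [hβ]; linarith
  have hβlim : Tendsto β atTop (𝓝 1) := by
    simpa [hβ] using (tendsto_one_div_add_atTop_nhds_zero_nat (𝕜 := ℝ)).const_sub 1
  choose V hV0 hV1 hV2 hV3 hV4 using fun k =>
    exists_discounted_value hs hn hπ (hβ0 k) (hβ1 k)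
  have hspan : ∀ k, ∀ K < (s + 1) ^ (n + 1), ∀ K' < (s + 1) ^ (n + 1),
      hat s w (V k) K ≤ hat s w (V k) K' + C := fun k K hK K' hK' =>
    hat_le_hat_add hπ (by omega) (by omega)
      (avg_hat_rd_le hs hπ (hβ0 k) (hV1 k) (hV2 k) (hV3 k))
      (fun M hM hk => one_add_hat_div_le hs hw hπ (hβ0 k) (hV1 k) (hV2 k) hM
        fun j hj => hk j (by omega)) (hV3 k) (hV4 k) hK hK'
  -- The relative values. They are set to zero where the optimality equation says nothing, so that
  -- all coordinates stay in `[-C, C]`.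
  set H : ℕ → ℕ → ℝ := fun k K =>
    if K < (s + 1) ^ (n + 1) ∧ Live s w K then V k K - V k 0 else 0 with hH
  have hHV : ∀ k, ∀ K < (s + 1) ^ (n + 1), hat s w (H k) K = hat s w (V k) K - V k 0 :=
    fun k K hK => by
      have h1 : norm s w K < (s + 1) ^ (n + 1) ∧ Live s w (norm s w K) :=
        ⟨(norm_le s w K).trans_lt hK, (skip_spec hs w K).1⟩
      simp only [hat, hH, h1, and_self, if_true]
      ring
  have hAV : ∀ k, ∀ K < (s + 1) ^ (n + 1), ∀ i ≤ n, ∀ x : Fin s,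
      after s w (H k) K i x = after s w (V k) K i x - V k 0 := fun k K hK i hi x => by
    have hr := rd_lt x.2 hK hi
    unfold after
    split_ifs
    · rw [hHV k _ (div_lt_window hr)]; ring
    · rw [hHV k _ hr]
  have hbest : ∀ k, ∀ K < (s + 1) ^ (n + 1),
      best w n π (H k) K = best w n π (V k) K - V k 0 := fun k K hK => by
    refine eq_of_forall_ge_iff fun r => ?_
    rw [sub_le_iff_le_add, best_le_iff, best_le_iff]
    refine forall₂_congr fun i hi => ?_
    have : (fun x : Fin s => after s w (H k) K (act s w K i) x) =
        fun x : Fin s => after s w (V k) K (act s w K i) x - V k 0 :=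
      funext fun x => hAV k K hK _ (act_le hn hi) x
    rw [this, avg_sub, avg_const hπ, sub_le_iff_le_add]
  -- The normalised gains and the relative values lie in a compact product, from which a convergent
  -- subsequence is extracted.
  have hmem : ∀ k, ((1 - β k) * V k 0, H k) ∈
      Set.Icc (0 : ℝ) (n + 1) ×ˢ Set.pi Set.univ fun _ : ℕ => Set.Icc (-C) C := fun k => by
    refine ⟨⟨mul_nonneg (by linarith [hβ1 k]) (hV0 k 0), hV1 k 0⟩, fun K _ => ?_⟩
    simp only [hH]
    split_ifs with h
    · have h1 := hspan k K h.1 0 hB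
      have h2 := hspan k 0 hB K h.1
      rw [hat_of_live hs _ h.2, hat_of_live hs _ (live_zero s w)] at h1 h2
      constructor <;> linarith
    · constructor <;> linarith
  obtain ⟨⟨g, h⟩, hgh, φ, hφ, hlim⟩ :=
    (isCompact_Icc.prod (isCompact_univ_pi fun _ => isCompact_Icc)).tendsto_subseq hmem
  have hg : Tendsto (fun k => (1 - β (φ k)) * V (φ k) 0) atTop (𝓝 g) :=
    ((continuous_fst.tendsto _).comp hlim)
  have hh : ∀ K, Tendsto (fun k => H (φ k) K) atTop (𝓝 (h K)) :=
    tendsto_pi_nhds.mp ((continuous_snd.tendsto _).comp hlim)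
  -- In terms of `H`, the discounted equation reads `β * best H K = (1 - β) * V 0 + H K`; both sides
  -- are passed to the limit.
  have hgain : ∀ K < (s + 1) ^ (n + 1), Live s w K → best w n π h K = g + h K := fun K hK hl => by
    refine tendsto_nhds_unique (f := fun k => β (φ k) * best w n π (H (φ k)) K) (l := atTop) ?_ ?_
    · simpa using (hβlim.comp hφ.tendsto_atTop).mul (tendsto_best (w := w) (n := n) (π := π) hh K)
    · refine (hg.add (hh K)).congr fun k => ?_
      have h1 := hV2 (φ k) K hK
      rw [hbest _ K hK]
      simp only [hH, hK, hl, and_self, if_true]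
      linarith
  refine ⟨g, h, hgh.1.1, .of_tendsto hh fun k K hK => ?_, fun K hK hl => ⟨?_, fun i hi => ?_⟩⟩
  · rw [hHV _ K hK, hHV _ _ (div_lt_window hK)]
    linarith [hV3 (φ k) K hK]
  · obtain ⟨i, hi, he⟩ := Finset.exists_mem_eq_sup' (Finset.nonempty_range_add_one (n := n))
      fun i => avg π fun x : Fin s => after s w h K (act s w K i) x
    refine ⟨act s w K i, act_le hn (by simpa [Nat.lt_succ_iff] using hi), useful_act hw hl i, ?_⟩
    rw [← he, ← hgain K hK hl]
    rfl
  · by_cases hu : Useful s w K i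
    · rw [← hgain K hK hl]
      simpa [act_of_useful hu] using le_best (w := w) (π := π) h K hi
    · simp only [after_of_not_useful _ hu]
      rw [avg_const hπ, hat_of_live hs _ hl]
      linarith [hgh.1.1]

end
end PatternMatching

namespace PatternMatching

/-! ### Solutions of linear inequalities in a subfield -/

/-- A finite system of affine inequalities with coefficients in a subfield (that is, commuting with
the retractions on the subfield) has a solution in the subfield if it has a real one. -/
theorem exists_solution_in_subfield {ι C : Type*} [Finite C] (F : Subfield ℝ)
    (c : C → (ι → ℝ) → ℝ)
    (hc : ∀ (φ : ℝ →ₗ[F] F), φ 1 = 1 → ∀ i x, c i (fun j => (φ (x j) : ℝ)) = φ (c i x))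
    (hseg : ∀ i x y (t : ℝ), c i (fun j => (1 - t) * x j + t * y j) = (1 - t) * c i x + t * c i y)
    (x : ι → ℝ) (hx : ∀ i, 0 ≤ c i x) :
    ∃ y : ι → ℝ, (∀ j, y j ∈ F) ∧ ∀ i, 0 ≤ c i y := by
  classical
  have := Fintype.ofFinite C
  -- A linear retraction of the reals on `F`. Applied to a real solution it gives a point over `F`
  -- at which every tight constraint is still tight, though slack ones may become violated.
  obtain ⟨φ, hφ⟩ := LinearMap.exists_leftInverse_of_injective (Algebra.linearMap F ℝ)
    (LinearMap.ker_eq_bot.mpr (algebraMap F ℝ).injective)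
  have hφ1 : φ 1 = 1 := by simpa using LinearMap.congr_fun hφ 1
  -- Induction on the number of constraints which are not tight at `x`.
  induction hN : (Finset.univ.filter fun i => c i x ≠ 0).card using Nat.strong_induction_on
    generalizing x with
  | _ N ih =>
    set y : ι → ℝ := fun j => (φ (x j) : ℝ) with hy
    have hcy : ∀ i, c i y = φ (c i x) := fun i => hc φ hφ1 i x
    by_cases hall : ∀ i, 0 ≤ c i y
    · exact ⟨y, fun j => (φ (x j)).2, hall⟩
    push Not at hall
    set S := Finset.univ.filter fun i => c i y < 0 with hS
    have hSne : S.Nonempty := by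
      obtain ⟨i, hi⟩ := hall
      exact ⟨i, by simpa [hS] using hi⟩
    -- Moving from `x` towards its retraction `y`, the constraint `i₀` is the first to reach zero
    -- among those violated at `y`. Stopping at this time `t` keeps all constraints satisfied and
    -- makes one more of them tight.
    obtain ⟨i₀, hi₀, hmin⟩ := S.exists_min_image (fun i => c i x / (c i x - c i y)) hSne
    set t := c i₀ x / (c i₀ x - c i₀ y) with ht
    have hneg : c i₀ y < 0 := by simpa [hS] using hi₀
    have hden : 0 < c i₀ x - c i₀ y := by linarith [hx i₀]
    have ht0 : 0 ≤ t := div_nonneg (hx i₀) hden.le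
    have ht1 : t ≤ 1 := by rw [ht, div_le_one hden]; linarith
    have hz : ∀ i, 0 ≤ (1 - t) * c i x + t * c i y := fun i => by
      rcases le_or_gt 0 (c i y) with h | h
      · exact add_nonneg (mul_nonneg (by linarith) (hx i)) (mul_nonneg ht0 h)
      · have h1 := hmin i (by simpa [hS] using h)
        rw [le_div_iff₀ (by linarith [hx i])] at h1
        linarith
    refine ih _ ?_ (fun j => (1 - t) * x j + t * y j) (fun i => ?_) rfl
    · rw [← hN]
      refine Finset.card_lt_card ⟨fun i hi => ?_, fun h => ?_⟩
      · simp only [Finset.mem_filter, Finset.mem_univ, true_and] at hi ⊢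
        intro h0
        apply hi
        rw [hseg, hcy, h0, map_zero]
        simp
      · have h1 : i₀ ∈ Finset.univ.filter fun i => c i x ≠ 0 := by
          simp only [Finset.mem_filter, Finset.mem_univ, true_and]
          intro h0
          rw [hcy, h0, map_zero] at hneg
          simp at hneg
        have h2 := h h1
        simp only [Finset.mem_filter, Finset.mem_univ, true_and] at h2
        apply h2
        rw [hseg, ht]
        field_simp
        ring
    · rw [hseg]; exact hz i

/-! ### Integer polynomials -/

theorem IntPoly.value_append (P R : IntPoly) (x : ℕ → ℝ) :
    IntPoly.value (P ++ R) x = IntPoly.value P x + IntPoly.value R x := by simp [IntPoly.value]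

/-- The opposite polynomial. -/
def IntPoly.neg (P : IntPoly) : IntPoly := P.map fun c => (-c.1, c.2)

theorem IntPoly.value_neg (P : IntPoly) (x : ℕ → ℝ) :
    IntPoly.value P.neg x = -IntPoly.value P x := by
  induction P with
  | nil => simp [IntPoly.value, IntPoly.neg]
  | cons c P ih =>
    simp only [IntPoly.value, IntPoly.neg, List.map_cons, List.sum_cons] at ih ⊢
    rw [ih]
    push_cast
    ring

/-- The product of a polynomial by a variable. -/
def IntPoly.mulVar (i : ℕ) (P : IntPoly) : IntPoly := P.map fun c => (c.1, i :: c.2)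

theorem IntPoly.value_mulVar (i : ℕ) (P : IntPoly) (x : ℕ → ℝ) :
    IntPoly.value (P.mulVar i) x = x i * IntPoly.value P x := by
  induction P with
  | nil => simp [IntPoly.value, IntPoly.mulVar]
  | cons c P ih =>
    simp only [IntPoly.value, IntPoly.mulVar, List.map_cons, List.sum_cons, List.prod_cons] at ih ⊢
    rw [ih]
    ring

/-- The sum of the values of a list of polynomials indexed by `0, …, k - 1`. -/
theorem IntPoly.value_flatMap_range (k : ℕ) (f : ℕ → IntPoly) (x : ℕ → ℝ) :
    IntPoly.value ((List.range k).flatMap f) x = ∑ i ∈ Finset.range k, IntPoly.value (f i) x := by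
  induction k with
  | zero => simp [IntPoly.value]
  | succ k ih =>
    rw [List.range_succ, List.flatMap_append, IntPoly.value_append, ih, Finset.sum_range_succ]
    simp

theorem IntPoly.exists_value_mul (P R : IntPoly) (x : ℕ → ℝ) :
    ∃ S : IntPoly, IntPoly.value S x = IntPoly.value P x * IntPoly.value R x := by
  induction P with
  | nil => exact ⟨[], by simp [IntPoly.value]⟩
  | cons c P ih =>
    obtain ⟨S, hS⟩ := ih
    refine ⟨(R.map fun d => (c.1 * d.1, c.2 ++ d.2)) ++ S, ?_⟩
    have h : ∀ R : IntPoly, IntPoly.value (R.map fun d => (c.1 * d.1, c.2 ++ d.2)) x =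
        (c.1 : ℝ) * (c.2.map x).prod * IntPoly.value R x := by
      intro R
      induction R with
      | nil => simp [IntPoly.value]
      | cons d R ih =>
        simp only [IntPoly.value, List.map_cons, List.sum_cons, List.map_append,
          List.prod_append] at ih ⊢
        rw [ih]
        push_cast
        ring
    rw [IntPoly.value_append, h, hS]
    simp only [IntPoly.value, List.map_cons, List.sum_cons]
    ring

theorem exists_intPoly_of_mem_closure {x : ℕ → ℝ} {r : ℝ}
    (h : r ∈ Subring.closure (Set.range x)) : ∃ P : IntPoly, IntPoly.value P x = r := by
  induction h using Subring.closure_induction with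
  | mem r hr =>
    obtain ⟨i, rfl⟩ := hr
    exact ⟨[(1, [i])], by simp [IntPoly.value]⟩
  | zero => exact ⟨[], by simp [IntPoly.value]⟩
  | one => exact ⟨[(1, [])], by simp [IntPoly.value]⟩
  | add r t _ _ hr ht =>
    obtain ⟨P, rfl⟩ := hr
    obtain ⟨R, rfl⟩ := ht
    exact ⟨P ++ R, IntPoly.value_append P R x⟩
  | neg r _ hr =>
    obtain ⟨P, rfl⟩ := hr
    exact ⟨P.neg, IntPoly.value_neg P x⟩
  | mul r t _ _ hr ht =>
    obtain ⟨P, rfl⟩ := hr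
    obtain ⟨R, rfl⟩ := ht
    exact IntPoly.exists_value_mul P R x

/-- Finitely many elements of the field generated by `x` have a common positive denominator. -/
theorem exists_common_denominator (x : ℕ → ℝ) (N : ℕ) (f : ℕ → ℝ)
    (hf : ∀ i, f i ∈ Subfield.closure (Set.range x)) :
    ∃ (D : IntPoly) (P : ℕ → IntPoly), 0 < IntPoly.value D x ∧
      ∀ i < N, IntPoly.value (P i) x = IntPoly.value D x * f i := by
  have h : ∃ d ∈ Subring.closure (Set.range x), 0 < d ∧
      ∀ i < N, d * f i ∈ Subring.closure (Set.range x) := by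
    induction N with
    | zero => exact ⟨1, one_mem _, one_pos, by simp⟩
    | succ N ih =>
      obtain ⟨d, hd, hpos, hdf⟩ := ih
      obtain ⟨y, hy, z, hz, hyz⟩ := Subfield.mem_closure_iff.mp (hf N)
      by_cases hz0 : z = 0
      · refine ⟨d, hd, hpos, fun i hi => ?_⟩
        rcases Nat.lt_succ_iff_lt_or_eq.mp hi with hi | rfl
        · exact hdf i hi
        · rw [← hyz, hz0, div_zero, mul_zero]; exact zero_mem _
      -- The square keeps the common denominator positive, whatever the sign of `z`.
      · refine ⟨d * (z * z), mul_mem hd (mul_mem hz hz), mul_pos hpos (mul_self_pos.mpr hz0),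
          fun i hi => ?_⟩
        rcases Nat.lt_succ_iff_lt_or_eq.mp hi with hi | rfl
        · rw [show d * (z * z) * f i = z * z * (d * f i) by ring]
          exact mul_mem (mul_mem hz hz) (hdf i hi)
        · rw [← hyz, show d * (z * z) * (y / z) = d * (z * y) by field_simp]
          exact mul_mem hd (mul_mem hz hy)
  obtain ⟨d, hd, hpos, hdf⟩ := h
  obtain ⟨D, rfl⟩ := exists_intPoly_of_mem_closure hd
  have : ∀ i, ∃ P : IntPoly, i < N → IntPoly.value P x = IntPoly.value D x * f i := fun i => by
    by_cases hi : i < N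
    · obtain ⟨P, hP⟩ := exists_intPoly_of_mem_closure (hdf i hi)
      exact ⟨P, fun _ => hP⟩
    · exact ⟨[], fun h => absurd h hi⟩
  choose P hP using this
  exact ⟨D, P, hpos, fun i hi => hP i hi⟩

end PatternMatching

namespace PatternMatching

/-! ### The algorithm -/

/-- The knowledge, seen from the new position, after reading `x` at the offset `i`. -/
def target (s : ℕ) (w : List ℕ) (K i x : ℕ) : ℕ :=
  if Prints s w K i x then norm s w (rd s K i x / (s + 1)) else norm s w (rd s K i x)

/-- The shift after reading `x` at the offset `i`. -/
def advance (s : ℕ) (w : List ℕ) (K i x : ℕ) : ℕ :=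
  if Prints s w K i x then 1 + skip s w (rd s K i x / (s + 1)) else skip s w (rd s K i x)

/-- All the letters of the window of `w` are known, except perhaps the one at the offset `i`. -/
def AllButOne (s : ℕ) (w : List ℕ) (K i : ℕ) : Prop :=
  i < w.length ∧ ∀ j < w.length, j = i ∨ dig s K j ≠ 0

instance (s : ℕ) (w : List ℕ) (K i : ℕ) : Decidable (AllButOne s w K i) := by
  unfold AllButOne; infer_instance

/-- The polynomial `D * hat f K`, where `D * f K` is the entry `K` of `H`. -/
def hatPoly (s : ℕ) (w : List ℕ) (D : IntPoly) (H : List IntPoly) (K : ℕ) : IntPoly :=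
  ((List.range (skip s w K)).flatMap fun _ => D) ++ H.getD (norm s w K) []

/-- The polynomial `D * after f K i x`. -/
def afterPoly (s : ℕ) (w : List ℕ) (D : IntPoly) (H : List IntPoly) (K i x : ℕ) : IntPoly :=
  ((List.range (advance s w K i x)).flatMap fun _ => D) ++ H.getD (target s w K i x) []

/-- The slack of the optimality inequality for the reading at the offset `i` from `K`. -/
def slackPoly (s : ℕ) (w : List ℕ) (D G : IntPoly) (H : List IntPoly) (K i : ℕ) : IntPoly :=
  G ++ H.getD K [] ++
    IntPoly.neg ((List.range s).flatMap fun x => IntPoly.mulVar x (afterPoly s w D H K i x))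

/-- The gain of skipping an occurrence. -/
def skipPoly (s : ℕ) (w : List ℕ) (D : IntPoly) (H : List IntPoly) (K : ℕ) : IntPoly :=
  D ++ hatPoly s w D H (K / (s + 1)) ++ IntPoly.neg (H.getD K [])

/-- A candidate: the list of the states, the reading strategy, and the numerators `H`, `G` and the
denominator `D` of a solution of the optimality equation. -/
abbrev Candidate : Type := List ℕ × List ℕ × List IntPoly × IntPoly × IntPoly

/-- `L` lists the knowledge reachable with the strategy `σ`, in an order of discovery. -/
def Explores (s : ℕ) (w : List ℕ) (σ L : List ℕ) : Prop :=
  L.head? = some 0 ∧ (∀ q < L.length, L.idxOf (L.getD q 0) = q) ∧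
  (∀ q < L.length, ∀ x < s,
    L.idxOf (target s w (L.getD q 0) (σ.getD (L.getD q 0) 0) x) < L.length) ∧
  ∀ q < L.length, q = 0 ∨ ∃ q' < q, ∃ x < s,
    target s w (L.getD q' 0) (σ.getD (L.getD q' 0) 0) x = L.getD q 0

/-- `σ` is optimal, as certified by `D`, `G` and `H`, where `yes` and `no` are the available
answers to sign queries. -/
def Certifies (s : ℕ) (w : List ℕ) (n : ℕ) (yes no : IntPoly → Prop) (σ : List ℕ)
    (H : List IntPoly) (G D : IntPoly) : Prop :=
  no D.neg ∧ yes G ∧ ∀ K < (s + 1) ^ (n + 1), ¬ Live s w K ∨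
    (σ.getD K 0 < n + 1 ∧ Useful s w K (σ.getD K 0) ∧
      yes (slackPoly s w D G H K (σ.getD K 0)).neg) ∧
    (∀ i < n + 1, yes (slackPoly s w D G H K i)) ∧ (¬ Full s w K ∨ yes (skipPoly s w D H K))

/-- The query `P ≥ 0` was answered by `b`, when the queries are asked in the order of their codes. -/
def Answered (h : List Bool) (b : Bool) (P : IntPoly) : Prop :=
  h.reverse[Encodable.encode P]? = some b

/-- The description of the machine with strategy `σ` and states `L`, followed by a sink. -/
def strategyCode (s : ℕ) (w σ L : List ℕ) : MachineCode :=
  (0, L.length,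
    (L.map fun K => (decide (AllButOne s w K (σ.getD K 0)), σ.getD K 0, (List.range s).map fun x =>
      (L.idxOf (target s w K (σ.getD K 0) x), advance s w K (σ.getD K 0) x))) ++
    [(false, 0, (List.range s).map fun _ => (L.length, 0))])

/-- The candidate is accepted after the answers `h`. -/
def Accepts (a : ℕ × List ℕ × ℕ) (h : List Bool) (c : Candidate) : Prop :=
  Explores a.1 a.2.1 c.2.1 c.1 ∧
    Certifies a.1 a.2.1 a.2.2 (Answered h true) (Answered h false) c.2.1 c.2.2.1 c.2.2.2.1 c.2.2.2.2

open Classical in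
/-- The candidates with codes less than the number of answers are tried, and the outputs of the
accepted ones are listed. -/
noncomputable def outputs (p : (ℕ × List ℕ × ℕ) × List Bool) : List MachineCode :=
  (List.range p.2.length).filterMap fun k => (Encodable.decode (α := Candidate) k).bind fun c =>
    if Accepts p.1 p.2 c then some (strategyCode p.1.1 p.1.2.1 c.2.1 c.1) else none

/-- The algorithm asks the signs of all integer polynomials, until the answers certify the
optimality of some machine. -/
noncomputable def search : ExactAlgorithm (ℕ × List ℕ × ℕ) MachineCode := fun p =>
  (outputs p).head?.elim (Sum.inl ((Encodable.decode (α := IntPoly) p.2.length).getD [])) Sum.inr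

/-! ### Computability of the algorithm -/

section primrec
open Primrec

variable {α : Type} [Primcodable α]

/-- Nonnegative integers have even codes and negative ones odd codes, so negation exchanges `2 * k +
2` and `2 * k + 1` and fixes `0`. -/
theorem primrec_int_neg : Primrec (Neg.neg : ℤ → ℤ) := by
  have h : Primrec fun k : ℕ => if k = 0 then 0 else if k % 2 = 0 then k - 1 else k + 1 :=
    Primrec.ite (Primrec.eq.comp .id (.const 0)) (.const 0)
      (Primrec.ite (Primrec.eq.comp (nat_mod.comp .id (.const 2)) (.const 0))
        (nat_sub.comp .id (.const 1)) .succ)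
  refine Primrec.encode_iff.mp ((h.comp Primrec.encode).of_eq fun z => ?_)
  have h1 : ∀ k : ℕ, Encodable.encode (Int.ofNat k) = 2 * k := fun k => rfl
  have h2 : ∀ k : ℕ, Encodable.encode (Int.negSucc k) = 2 * k + 1 := fun k => rfl
  rcases z with (_ | k) | k
  · rw [h1]; rfl
  · rw [h1, show -Int.ofNat (k + 1) = Int.negSucc k from rfl, h2]
    simp
    omega
  · rw [h2, show -Int.negSucc k = Int.ofNat (k + 1) from rfl, h1]
    simp
    omega

theorem primrec_pow : Primrec₂ ((· ^ ·) : ℕ → ℕ → ℕ) := Primrec₂.unpaired'.1 Nat.Primrec.pow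

theorem primrecPred_forall_lt {f : α → ℕ} {R : α → ℕ → Prop} (hf : Primrec f)
    (hR : PrimrecPred fun p : α × ℕ => R p.1 p.2) : PrimrecPred fun a => ∀ i < f a, R a i := by
  have h : PrimrecRel fun (i : ℕ) (a : α) => R a i := hR.comp (Primrec.pair .snd .fst)
  exact ((PrimrecRel.forall_mem_list h).comp (list_range.comp hf) Primrec.id).of_eq fun a => by simp

theorem primrecPred_exists_lt {f : α → ℕ} {R : α → ℕ → Prop} (hf : Primrec f)
    (hR : PrimrecPred fun p : α × ℕ => R p.1 p.2) : PrimrecPred fun a => ∃ i < f a, R a i := by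
  have h : PrimrecRel fun (i : ℕ) (a : α) => R a i := hR.comp (Primrec.pair .snd .fst)
  exact ((PrimrecRel.exists_mem_list h).comp (list_range.comp hf) Primrec.id).of_eq fun a => by simp

variable {s K i x n : α → ℕ} {w σ L : α → List ℕ} {D G P : α → IntPoly} {H : α → List IntPoly}
  {h : α → List Bool}

theorem primrec_div_pow (hs : Primrec s) (hK : Primrec K) (hi : Primrec i) :
    Primrec fun a => K a / (s a + 1) ^ i a :=
  nat_div.comp hK (primrec_pow.comp (succ.comp hs) hi)

theorem primrec_dig (hs : Primrec s) (hK : Primrec K) (hi : Primrec i) :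
    Primrec fun a => dig (s a) (K a) (i a) :=
  nat_mod.comp (primrec_div_pow hs hK hi) (succ.comp hs)

theorem primrec_rd (hs : Primrec s) (hK : Primrec K) (hi : Primrec i) (hx : Primrec x) :
    Primrec fun a => rd (s a) (K a) (i a) (x a) :=
  Primrec.ite (Primrec.eq.comp (primrec_dig hs hK hi) (.const 0))
    (nat_add.comp hK (nat_mul.comp (succ.comp hx) (primrec_pow.comp (succ.comp hs) hi))) hK

theorem primrec_letter (hw : Primrec w) (hi : Primrec i) :
    Primrec fun a => (w a).getD (i a) 0 := (list_getD 0).comp hw hi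

theorem primrecPred_live (hs : Primrec s) (hw : Primrec w) (hK : Primrec K) :
    PrimrecPred fun a => Live (s a) (w a) (K a) := by
  unfold Live
  have hd := primrec_dig (hs.comp fst) (hK.comp fst) (snd (α := α) (β := ℕ))
  exact primrecPred_forall_lt (list_length.comp hw) (.or (Primrec.eq.comp hd (.const 0))
    (Primrec.eq.comp hd (succ.comp (primrec_letter (hw.comp fst) snd))))

theorem primrecPred_full (hs : Primrec s) (hw : Primrec w) (hK : Primrec K) :
    PrimrecPred fun a => Full (s a) (w a) (K a) := by
  unfold Full
  have hd := primrec_dig (hs.comp fst) (hK.comp fst) (snd (α := α) (β := ℕ))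
  exact primrecPred_forall_lt (list_length.comp hw)
    (Primrec.eq.comp hd (succ.comp (primrec_letter (hw.comp fst) snd)))

theorem primrec_skip (hs : Primrec s) (hw : Primrec w) (hK : Primrec K) :
    Primrec fun a => skip (s a) (w a) (K a) :=
  list_findIdx (list_range.comp (succ.comp hK)) (PrimrecPred.decide
    (primrecPred_live (hs.comp fst) (hw.comp fst) (primrec_div_pow (hs.comp fst) (hK.comp fst) snd)))

theorem primrec_norm (hs : Primrec s) (hw : Primrec w) (hK : Primrec K) :
    Primrec fun a => norm (s a) (w a) (K a) := primrec_div_pow hs hK (primrec_skip hs hw hK)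

theorem primrecPred_prints (hs : Primrec s) (hw : Primrec w) (hK : Primrec K) (hi : Primrec i)
    (hx : Primrec x) : PrimrecPred fun a => Prints (s a) (w a) (K a) (i a) (x a) :=
  (nat_lt.comp hi (list_length.comp hw)).and (primrecPred_full hs hw (primrec_rd hs hK hi hx))

theorem primrecPred_useful (hs : Primrec s) (hw : Primrec w) (hK : Primrec K) (hi : Primrec i) :
    PrimrecPred fun a => Useful (s a) (w a) (K a) (i a) :=
  (Primrec.eq.comp (primrec_dig hs hK hi) (.const 0)).or
    ((nat_lt.comp hi (list_length.comp hw)).and (primrecPred_full hs hw hK))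

theorem primrecPred_allButOne (hs : Primrec s) (hw : Primrec w) (hK : Primrec K)
    (hi : Primrec i) : PrimrecPred fun a => AllButOne (s a) (w a) (K a) (i a) :=
  (nat_lt.comp hi (list_length.comp hw)).and (primrecPred_forall_lt (list_length.comp hw)
    (.or (Primrec.eq.comp snd (hi.comp fst)) (PrimrecPred.not
      (Primrec.eq.comp (primrec_dig (hs.comp fst) (hK.comp fst) snd) (.const 0)))))

theorem primrec_target (hs : Primrec s) (hw : Primrec w) (hK : Primrec K) (hi : Primrec i)
    (hx : Primrec x) : Primrec fun a => target (s a) (w a) (K a) (i a) (x a) :=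
  have hr := primrec_rd hs hK hi hx
  Primrec.ite (primrecPred_prints hs hw hK hi hx)
    (primrec_norm hs hw (nat_div.comp hr (succ.comp hs))) (primrec_norm hs hw hr)

theorem primrec_advance (hs : Primrec s) (hw : Primrec w) (hK : Primrec K) (hi : Primrec i)
    (hx : Primrec x) : Primrec fun a => advance (s a) (w a) (K a) (i a) (x a) :=
  have hr := primrec_rd hs hK hi hx
  Primrec.ite (primrecPred_prints hs hw hK hi hx)
    (nat_add.comp (.const 1) (primrec_skip hs hw (nat_div.comp hr (succ.comp hs))))
    (primrec_skip hs hw hr)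

theorem primrec_neg (hP : Primrec P) : Primrec fun a => (P a).neg :=
  list_map hP (Primrec.pair (primrec_int_neg.comp (fst.comp snd)) (snd.comp snd))

theorem primrec_mulVar (hi : Primrec i) (hP : Primrec P) :
    Primrec fun a => (P a).mulVar (i a) :=
  list_map hP (Primrec.pair (fst.comp snd) (list_cons.comp (hi.comp fst) (snd.comp snd)))

theorem primrec_replicate_append (hi : Primrec i) (hK : Primrec K) (hD : Primrec D)
    (hH : Primrec H) :
    Primrec fun a => ((List.range (i a)).flatMap fun _ => D a) ++ (H a).getD (K a) [] :=
  list_append.comp (list_flatMap (list_range.comp hi) (hD.comp fst)) ((list_getD []).comp hH hK)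

theorem primrec_hatPoly (hs : Primrec s) (hw : Primrec w) (hD : Primrec D) (hH : Primrec H)
    (hK : Primrec K) : Primrec fun a => hatPoly (s a) (w a) (D a) (H a) (K a) :=
  primrec_replicate_append (primrec_skip hs hw hK) (primrec_norm hs hw hK) hD hH

theorem primrec_afterPoly (hs : Primrec s) (hw : Primrec w) (hD : Primrec D) (hH : Primrec H)
    (hK : Primrec K) (hi : Primrec i) (hx : Primrec x) :
    Primrec fun a => afterPoly (s a) (w a) (D a) (H a) (K a) (i a) (x a) :=
  primrec_replicate_append (primrec_advance hs hw hK hi hx) (primrec_target hs hw hK hi hx) hD hH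

theorem primrec_slackPoly (hs : Primrec s) (hw : Primrec w) (hD : Primrec D) (hG : Primrec G)
    (hH : Primrec H) (hK : Primrec K) (hi : Primrec i) :
    Primrec fun a => slackPoly (s a) (w a) (D a) (G a) (H a) (K a) (i a) :=
  list_append.comp (list_append.comp hG ((list_getD []).comp hH hK))
    (primrec_neg (list_flatMap (list_range.comp hs) (primrec_mulVar snd (primrec_afterPoly
      (hs.comp fst) (hw.comp fst) (hD.comp fst) (hH.comp fst) (hK.comp fst) (hi.comp fst) snd))))

theorem primrec_skipPoly (hs : Primrec s) (hw : Primrec w) (hD : Primrec D) (hH : Primrec H)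
    (hK : Primrec K) : Primrec fun a => skipPoly (s a) (w a) (D a) (H a) (K a) :=
  list_append.comp (list_append.comp hD
    (primrec_hatPoly hs hw hD hH (nat_div.comp hK (succ.comp hs))))
    (primrec_neg ((list_getD []).comp hH hK))

theorem primrecPred_explores (hs : Primrec s) (hw : Primrec w) (hσ : Primrec σ) (hL : Primrec L) :
    PrimrecPred fun a => Explores (s a) (w a) (σ a) (L a) := by
  have hlen := list_length.comp hL
  have hget : Primrec fun p : α × ℕ => (L p.1).getD p.2 0 := primrec_letter (hL.comp fst) snd
  have htgt : Primrec fun p : (α × ℕ) × ℕ =>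
      target (s p.1.1) (w p.1.1) ((L p.1.1).getD p.1.2 0)
        ((σ p.1.1).getD ((L p.1.1).getD p.1.2 0) 0) p.2 :=
    primrec_target (hs.comp (fst.comp fst)) (hw.comp (fst.comp fst)) (hget.comp fst)
      (primrec_letter (hσ.comp (fst.comp fst)) (hget.comp fst)) snd
  refine (Primrec.eq.comp (list_head?.comp hL) (.const (some 0))).and (.and ?_ (.and ?_ ?_))
  · exact primrecPred_forall_lt hlen (Primrec.eq.comp (list_idxOf.comp hget (hL.comp fst)) snd)
  · exact primrecPred_forall_lt hlen (primrecPred_forall_lt (hs.comp fst)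
      (nat_lt.comp (list_idxOf.comp htgt (hL.comp (fst.comp fst))) (hlen.comp (fst.comp fst))))
  · refine primrecPred_forall_lt hlen (.or (Primrec.eq.comp snd (.const 0)) (primrecPred_exists_lt snd
      (primrecPred_exists_lt (hs.comp (fst.comp fst)) (Primrec.eq.comp ?_ (hget.comp (fst.comp fst))))))
    exact htgt.comp (Primrec.pair (Primrec.pair (fst.comp (fst.comp fst)) (snd.comp fst)) snd)

theorem primrecPred_answered (hh : Primrec h) (b : Bool) (hP : Primrec P) :
    PrimrecPred fun a => Answered (h a) b (P a) :=
  Primrec.eq.comp (list_getElem?.comp (list_reverse.comp hh) (Primrec.encode.comp hP))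
    (.const (some b))

theorem primrecPred_certifies (hs : Primrec s) (hw : Primrec w) (hn : Primrec n) (hh : Primrec h)
    (hσ : Primrec σ) (hH : Primrec H) (hG : Primrec G) (hD : Primrec D) :
    PrimrecPred fun a => Certifies (s a) (w a) (n a) (Answered (h a) true) (Answered (h a) false)
      (σ a) (H a) (G a) (D a) := by
  have hact : Primrec fun p : α × ℕ => (σ p.1).getD p.2 0 := primrec_letter (hσ.comp fst) snd
  refine (primrecPred_answered hh _ (primrec_neg hD)).and
    ((primrecPred_answered hh _ hG).and (primrecPred_forall_lt
      (primrec_pow.comp (succ.comp hs) (succ.comp hn)) (.or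
        (primrecPred_live (hs.comp fst) (hw.comp fst) snd).not (.and (.and ?_ (.and ?_ ?_))
          (.and (primrecPred_forall_lt (succ.comp (hn.comp fst)) ?_) (.or ?_ ?_))))))
  · exact nat_lt.comp hact (succ.comp (hn.comp fst))
  · exact primrecPred_useful (hs.comp fst) (hw.comp fst) snd hact
  · exact primrecPred_answered (hh.comp fst) _ (primrec_neg (primrec_slackPoly (hs.comp fst)
      (hw.comp fst) (hD.comp fst) (hG.comp fst) (hH.comp fst) snd hact))
  · have h1 : Primrec fun p : (α × ℕ) × ℕ => p.1.1 := fst.comp fst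
    exact primrecPred_answered (hh.comp h1) _ (primrec_slackPoly (hs.comp h1)
      (hw.comp h1) (hD.comp h1) (hG.comp h1) (hH.comp h1) (snd.comp fst) snd)
  · exact (primrecPred_full (hs.comp fst) (hw.comp fst) snd).not
  · exact primrecPred_answered (hh.comp fst) _ (primrec_skipPoly (hs.comp fst) (hw.comp fst)
      (hD.comp fst) (hH.comp fst) snd)

theorem primrec_strategyCode (hs : Primrec s) (hw : Primrec w) (hσ : Primrec σ)
    (hL : Primrec L) : Primrec fun a => strategyCode (s a) (w a) (σ a) (L a) := by
  have hlen := list_length.comp hL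
  have hact : Primrec fun p : α × ℕ => (σ p.1).getD p.2 0 := primrec_letter (hσ.comp fst) snd
  refine Primrec.pair (.const 0) (Primrec.pair hlen (list_append.comp (list_map hL
    (Primrec.pair (PrimrecPred.decide ?_) (Primrec.pair hact (list_map (list_range.comp (hs.comp fst))
      (Primrec.pair ?_ ?_))))) (list_cons.comp (Primrec.pair (.const false) (Primrec.pair (.const 0)
        (list_map (list_range.comp hs) (Primrec.pair (hlen.comp fst) (.const 0)))))
          (.const []))))
  · exact primrecPred_allButOne (hs.comp fst) (hw.comp fst) snd hact
  · exact list_idxOf.comp (primrec_target (hs.comp (fst.comp fst)) (hw.comp (fst.comp fst))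
      (snd.comp fst) (hact.comp fst) snd) (hL.comp (fst.comp fst))
  · exact primrec_advance (hs.comp (fst.comp fst)) (hw.comp (fst.comp fst))
      (snd.comp fst) (hact.comp fst) snd

theorem computable_search : Computable search := by
  classical
  have hout : Primrec outputs := by
    have hp : Primrec fun p : ((((ℕ × List ℕ × ℕ) × List Bool) × ℕ) × Candidate) => p.1.1.1 :=
      fst.comp (fst.comp fst)
    have hc : Primrec fun p : ((((ℕ × List ℕ × ℕ) × List Bool) × ℕ) × Candidate) => p.2 := snd
    have hh : Primrec fun p : ((((ℕ × List ℕ × ℕ) × List Bool) × ℕ) × Candidate) => p.1.1.2 :=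
      snd.comp (fst.comp fst)
    refine listFilterMap (list_range.comp (list_length.comp snd)) (option_bind
      (Primrec.decode.comp snd) (Primrec.ite (.and ?_ ?_) (option_some.comp ?_) (.const none)))
    · exact primrecPred_explores (fst.comp hp) (fst.comp (snd.comp hp))
        (fst.comp (snd.comp hc)) (fst.comp hc)
    · exact primrecPred_certifies (fst.comp hp) (fst.comp (snd.comp hp)) (snd.comp (snd.comp hp))
        hh (fst.comp (snd.comp hc)) (fst.comp (snd.comp (snd.comp hc)))
        (fst.comp (snd.comp (snd.comp (snd.comp hc)))) (snd.comp (snd.comp (snd.comp (snd.comp hc))))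
    · exact primrec_strategyCode (fst.comp hp) (fst.comp (snd.comp hp))
        (fst.comp (snd.comp hc)) (fst.comp hc)
  refine Primrec.to_comp ((option_casesOn (list_head?.comp hout) (sumInl.comp (option_getD.comp
    (Primrec.decode.comp (list_length.comp snd)) (.const []))) (sumInr.comp₂ .right)).of_eq
    fun p => ?_)
  unfold search
  cases (outputs p).head? <;> rfl

end primrec
end PatternMatching

namespace PatternMatching

/-! ### Certificates -/

/-- Both branches take the form of a reward plus the potential at the next state, as in a decision
process; this also makes the dependence on `f` visibly affine. -/
theorem after_eq (s : ℕ) (w : List ℕ) (f : ℕ → ℝ) (K i x : ℕ) :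
    after s w f K i x = advance s w K i x + f (target s w K i x) := by
  unfold after advance target hat
  split_ifs
  · push_cast; ring
  · rfl

theorem live_target {s : ℕ} (hs : 0 < s) (w : List ℕ) (K i x : ℕ) :
    Live s w (target s w K i x) := by
  unfold target
  split_ifs <;> exact (skip_spec hs w _).1

theorem target_lt {s n : ℕ} (w : List ℕ) {K i x : ℕ} (hx : x < s) (hK : K < (s + 1) ^ (n + 1))
    (hi : i ≤ n) : target s w K i x < (s + 1) ^ (n + 1) := by
  have hr := rd_lt hx hK hi
  unfold target
  split_ifs
  · exact (norm_le s w _).trans_lt (div_lt_window hr)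
  · exact (norm_le s w _).trans_lt hr

/-- The strategy `σ` is optimal, with gain `g` and bias `h`. -/
structure OptimalStrategy {s : ℕ} (w : List ℕ) (n : ℕ) (π : Fin s → ℝ) (σ : ℕ → ℕ) (g : ℝ)
    (h : ℕ → ℝ) : Prop where
  gain_nonneg : 0 ≤ g
  le : ∀ K < (s + 1) ^ (n + 1), Live s w K → σ K ≤ n
  useful : ∀ K < (s + 1) ^ (n + 1), Live s w K → Useful s w K (σ K)
  le_avg : ∀ K < (s + 1) ^ (n + 1), Live s w K → g + h K ≤ avg π fun x => after s w h K (σ K) x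
  avg_le : ∀ K < (s + 1) ^ (n + 1), Live s w K → ∀ i ≤ n,
    (avg π fun x => after s w h K i x) ≤ g + h K
  le_skip : ∀ K < (s + 1) ^ (n + 1), Full s w K → h K ≤ 1 + hat s w h (K / (s + 1))

section
variable {s : ℕ} {w : List ℕ} {n : ℕ} {π : Fin s → ℝ}

theorem value_repeat (D : IntPoly) (k : ℕ) (x : ℕ → ℝ) :
    IntPoly.value ((List.range k).flatMap fun _ => D) x = IntPoly.value D x * k := by
  rw [IntPoly.value_flatMap_range]
  simp [mul_comm]

theorem letterProbs_val (π : Fin s → ℝ) (x : Fin s) : letterProbs π x = π x := by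
  simp [letterProbs]

theorem value_slackPoly {D G : IntPoly} {H : List IntPoly}
    (hD : IntPoly.value D (letterProbs π) ≠ 0) (K i : ℕ) :
    IntPoly.value (slackPoly s w D G H K i) (letterProbs π) =
      IntPoly.value D (letterProbs π) *
        (IntPoly.value G (letterProbs π) / IntPoly.value D (letterProbs π) +
          IntPoly.value (H.getD K []) (letterProbs π) / IntPoly.value D (letterProbs π) -
          avg π fun x => after s w (fun K => IntPoly.value (H.getD K []) (letterProbs π) /
            IntPoly.value D (letterProbs π)) K i x) := by
  rw [slackPoly, IntPoly.value_append, IntPoly.value_append, IntPoly.value_neg,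
    IntPoly.value_flatMap_range, Finset.sum_range, mul_sub, mul_add, mul_div_cancel₀ _ hD,
    mul_div_cancel₀ _ hD, ← avg_mul_left, ← sub_eq_add_neg]
  congr 1
  refine Finset.sum_congr rfl fun x _ => ?_
  dsimp only
  rw [IntPoly.value_mulVar, letterProbs_val, afterPoly, IntPoly.value_append, value_repeat,
    after_eq, mul_add (IntPoly.value D _), mul_div_cancel₀ _ hD]

theorem value_skipPoly {D : IntPoly} {H : List IntPoly}
    (hD : IntPoly.value D (letterProbs π) ≠ 0) (K : ℕ) :
    IntPoly.value (skipPoly s w D H K) (letterProbs π) =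
      IntPoly.value D (letterProbs π) *
        (1 + hat s w (fun K => IntPoly.value (H.getD K []) (letterProbs π) /
            IntPoly.value D (letterProbs π)) (K / (s + 1)) -
          IntPoly.value (H.getD K []) (letterProbs π) / IntPoly.value D (letterProbs π)) := by
  rw [skipPoly, IntPoly.value_append, IntPoly.value_append, IntPoly.value_neg, hatPoly,
    IntPoly.value_append, value_repeat, hat, mul_sub, mul_add, mul_add, mul_div_cancel₀ _ hD,
    mul_div_cancel₀ _ hD]
  ring

/-- A certificate whose answers are right certifies an optimal strategy. -/
theorem Certifies.exists_optimalStrategy {σ : List ℕ} {H : List IntPoly} {G D : IntPoly}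
    (h : Certifies s w n (fun P => 0 ≤ IntPoly.value P (letterProbs π))
      (fun P => IntPoly.value P (letterProbs π) < 0) σ H G D) :
    ∃ g f, OptimalStrategy w n π (fun K => σ.getD K 0) g f := by
  obtain ⟨hD, hG, hK⟩ := h
  rw [IntPoly.value_neg, neg_lt_zero] at hD
  have hlive : ∀ K < (s + 1) ^ (n + 1), Live s w K → _ := fun K hB hl =>
    (hK K hB).resolve_left (not_not.mpr hl)
  refine ⟨IntPoly.value G (letterProbs π) / IntPoly.value D (letterProbs π),
    fun K => IntPoly.value (H.getD K []) (letterProbs π) / IntPoly.value D (letterProbs π),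
    div_nonneg hG hD.le, fun K hB hl => Nat.lt_succ_iff.mp (hlive K hB hl).1.1,
    fun K hB hl => (hlive K hB hl).1.2.1, fun K hB hl => ?_, fun K hB hl i hi => ?_,
    fun K hB hf => ?_⟩
  · have h1 : 0 ≤ IntPoly.value _ _ := (hlive K hB hl).1.2.2
    rw [IntPoly.value_neg, value_slackPoly hD.ne', ← mul_neg] at h1
    have := nonneg_of_mul_nonneg_right h1 hD
    linarith
  · have h1 : 0 ≤ IntPoly.value _ _ := (hlive K hB hl).2.1 i (by omega)
    rw [value_slackPoly hD.ne'] at h1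
    have := nonneg_of_mul_nonneg_right h1 hD
    linarith
  · have h1 : 0 ≤ IntPoly.value _ _ := (hlive K hB hf.live).2.2.resolve_left (not_not.mpr hf)
    rw [value_skipPoly hD.ne'] at h1
    have := nonneg_of_mul_nonneg_right h1 hD
    linarith

/-! ### Descent of the optimality equation to the field of the letter probabilities. -/

/-- A function which is affine with coefficients in the subfield `F`. -/
structure IsAffineOver {ι : Type*} (F : Subfield ℝ) (c : (ι → ℝ) → ℝ) : Prop where
  map : ∀ φ : ℝ →ₗ[F] F, φ 1 = 1 → ∀ x, c (fun j => (φ (x j) : ℝ)) = φ (c x)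
  segment : ∀ x y (t : ℝ), c (fun j => (1 - t) * x j + t * y j) = (1 - t) * c x + t * c y

namespace IsAffineOver
variable {ι : Type*} {F : Subfield ℝ} {c d : (ι → ℝ) → ℝ}

theorem eval (F : Subfield ℝ) (j : ι) : IsAffineOver F fun x => x j := ⟨fun _ _ _ => rfl, fun _ _ _ => rfl⟩

theorem natCast (F : Subfield ℝ) (k : ℕ) : IsAffineOver F fun _ : ι → ℝ => (k : ℝ) := by
  refine ⟨fun φ hφ x => ?_, fun x y t => by ring⟩
  have h : φ (k : ℝ) = k := by
    have := φ.map_smul (k : F) (1 : ℝ)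
    rw [hφ, Algebra.smul_def, mul_one] at this
    simpa using this
  rw [h]
  simp

theorem add (hc : IsAffineOver F c) (hd : IsAffineOver F d) : IsAffineOver F fun x => c x + d x :=
  ⟨fun φ hφ x => by rw [hc.map φ hφ, hd.map φ hφ, map_add]; rfl,
    fun x y t => by rw [hc.segment, hd.segment]; ring⟩

theorem sub (hc : IsAffineOver F c) (hd : IsAffineOver F d) : IsAffineOver F fun x => c x - d x :=
  ⟨fun φ hφ x => by rw [hc.map φ hφ, hd.map φ hφ, map_sub]; rfl,
    fun x y t => by rw [hc.segment, hd.segment]; ring⟩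

theorem mul_left {a : ℝ} (ha : a ∈ F) (hc : IsAffineOver F c) : IsAffineOver F fun x => a * c x :=
  ⟨fun φ hφ x => by
    have := φ.map_smul (⟨a, ha⟩ : F) (c x)
    rw [Algebra.smul_def, smul_eq_mul] at this
    rw [hc.map φ hφ]
    exact congrArg Subtype.val this.symm,
    fun x y t => by rw [hc.segment]; ring⟩

theorem sum {α : Type*} (S : Finset α) {c : α → (ι → ℝ) → ℝ} (hc : ∀ a, IsAffineOver F (c a)) :
    IsAffineOver F fun x => ∑ a ∈ S, c a x := by
  classical
  induction S using Finset.induction_on with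
  | empty => simpa using natCast F 0
  | insert a S ha ih =>
    simp only [Finset.sum_insert ha]
    exact (hc a).add ih

end IsAffineOver

theorem mem_closure_letterProbs (π : Fin s → ℝ) (x : Fin s) :
    π x ∈ Subfield.closure (Set.range (letterProbs π)) :=
  Subfield.subset_closure ⟨x, letterProbs_val π x⟩

/-- There is an optimal strategy whose gain and bias are in the field generated by the letter
probabilities. -/
theorem exists_optimalStrategy (hs : 0 < s) (hw : w ≠ []) (hn : w.length ≤ n + 1)
    (hπ : π ∈ stdSimplex ℝ (Fin s)) :
    ∃ (σ : ℕ → ℕ) (y : ℕ → ℝ), (∀ j, y j ∈ Subfield.closure (Set.range (letterProbs π))) ∧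
      OptimalStrategy w n π σ (y 0) fun K => y (K + 1) := by
  obtain ⟨g, h, hg, hsk, hgain⟩ := exists_gain hs hw hn hπ
  set F := Subfield.closure (Set.range (letterProbs π)) with hF
  have hσ : ∀ K, ∃ i, K < (s + 1) ^ (n + 1) → Live s w K → i ≤ n ∧ Useful s w K i ∧
      (avg π fun x => after s w h K i x) = g + h K := fun K => by
    by_cases hK : K < (s + 1) ^ (n + 1) ∧ Live s w K
    · obtain ⟨i, hi⟩ := (hgain K hK.1 hK.2).1
      exact ⟨i, fun _ _ => hi⟩
    · exact ⟨0, fun h1 h2 => absurd ⟨h1, h2⟩ hK⟩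
  choose σ hσ using hσ
  -- The unknown vector `y` holds the gain in its coordinate `0` and the bias at `K` in its
  -- coordinate `K + 1`.
  let slack : ℕ → ℕ → (ℕ → ℝ) → ℝ := fun K i y =>
    y 0 + y (K + 1) - avg π fun x => after s w (fun K => y (K + 1)) K i x
  have hslack : ∀ K i, IsAffineOver F (slack K i) := fun K i =>
    ((IsAffineOver.eval F 0).add (.eval F (K + 1))).sub <|
      .sum _ fun x => .mul_left (mem_closure_letterProbs π x) <| by
        simp only [after_eq]
        exact (IsAffineOver.natCast F _).add (.eval F _)
  -- With the actions `σ` fixed, these finitely many constraints say that the gain is nonnegative,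
  -- that every action satisfies the optimality inequality, that `σ` attains it, and that printing a
  -- certain occurrence is no loss. Irrelevant indices repeat the first constraint.
  let c : Option (Fin ((s + 1) ^ (n + 1)) × Option (Option (Fin (n + 1)))) → (ℕ → ℝ) → ℝ := fun p y =>
    match p with
    | none => y 0
    | some (K, some (some i)) => if Live s w K then slack K i y else y 0
    | some (K, some none) => if Live s w K then ((0 : ℕ) : ℝ) - slack K (σ K) y else y 0
    | some (K, none) => if Full s w K then
        ((1 : ℕ) : ℝ) + hat s w (fun K => y (K + 1)) ((K : ℕ) / (s + 1)) - y (K + 1) else y 0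
  have hc : ∀ p, IsAffineOver F (c p) := by
    rintro (_ | ⟨K, _ | _ | i⟩)
    · exact .eval F 0
    · by_cases hf : Full s w K
      · simp only [c, hf, if_true, hat]
        exact ((IsAffineOver.natCast F _).add ((IsAffineOver.natCast F _).add (.eval F _))).sub
          (.eval F _)
      · simpa only [c, hf, if_false] using .eval F 0
    · by_cases hl : Live s w K
      · simpa only [c, hl, if_true] using (IsAffineOver.natCast F _).sub (hslack _ _)
      · simpa only [c, hl, if_false] using .eval F 0
    · by_cases hl : Live s w K
      · simpa only [c, hl, if_true] using hslack _ _
      · simpa only [c, hl, if_false] using .eval F 0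
  obtain ⟨y, hyF, hy⟩ := exists_solution_in_subfield F c (fun φ hφ p => (hc p).map φ hφ)
    (fun p => (hc p).segment) (fun j => Nat.casesOn j g h) (by
      rintro (_ | ⟨K, _ | _ | i⟩)
      · exact hg
      · simp only [c]
        split_ifs with hf
        · have := hsk K K.2
          rw [hat_of_live hs _ hf.live] at this
          push_cast
          linarith
        · exact hg
      · simp only [c, slack, Nat.rec_zero]
        split_ifs with hl
        · have := (hσ K K.2 hl).2.2
          push_cast
          linarith
        · exact hg
      · simp only [c, slack, Nat.rec_zero]
        split_ifs with hl
        · have := (hgain K K.2 hl).2 i (Nat.lt_succ_iff.mp i.2)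
          linarith
        · exact hg)
  refine ⟨σ, y, hyF, hy none, fun K hK hl => (hσ K hK hl).1, fun K hK hl => (hσ K hK hl).2.1,
    fun K hK hl => ?_, fun K hK hl i hi => ?_, fun K hK hf => ?_⟩
  · have := hy (some (⟨K, hK⟩, some none))
    simp only [c, hl, if_true, slack] at this
    push_cast at this
    linarith
  · have := hy (some (⟨K, hK⟩, some (some ⟨i, by omega⟩)))
    simp only [c, hl, if_true, slack] at this
    linarith
  · have := hy (some (⟨K, hK⟩, none))
    simp only [c, hf, if_true] at this
    push_cast at this
    linarith

end
end PatternMatching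

namespace PatternMatching

/-! ### Existence of certificates and of orders of discovery. -/

section
variable {s : ℕ} {w : List ℕ} {n : ℕ} {π : Fin s → ℝ}

/-- Some strategy has a certificate. -/
theorem exists_certifies (hs : 0 < s) (hw : w ≠ []) (hn : w.length ≤ n + 1)
    (hπ : π ∈ stdSimplex ℝ (Fin s)) :
    ∃ σ H G D, Certifies s w n (fun P => 0 ≤ IntPoly.value P (letterProbs π))
      (fun P => IntPoly.value P (letterProbs π) < 0) σ H G D := by
  obtain ⟨σ, y, hyF, hopt⟩ := exists_optimalStrategy hs hw hn hπ
  set B := (s + 1) ^ (n + 1) with hB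
  obtain ⟨D, P, hD, hP⟩ := exists_common_denominator (letterProbs π) (B + 1) y hyF
  have hget : ∀ K < B, ((List.range B).map fun K => P (K + 1)).getD K [] = P (K + 1) :=
    fun K hK => by simp [List.getD, hK]
  have hσ : ∀ K < B, ((List.range B).map σ).getD K 0 = σ K := fun K hK => by simp [List.getD, hK]
  have hy : ∀ K < B, IntPoly.value (((List.range B).map fun K => P (K + 1)).getD K [])
      (letterProbs π) / IntPoly.value D (letterProbs π) = y (K + 1) := fun K hK => by
    rw [hget K hK, hP (K + 1) (by omega), mul_div_cancel_left₀ _ hD.ne']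
  have hy0 : IntPoly.value (P 0) (letterProbs π) / IntPoly.value D (letterProbs π) = y 0 := by
    rw [hP 0 (by omega), mul_div_cancel_left₀ _ hD.ne']
  have hafter : ∀ K < B, ∀ i ≤ n,
      (avg π fun x => after s w (fun K => IntPoly.value (((List.range B).map
        fun K => P (K + 1)).getD K []) (letterProbs π) / IntPoly.value D (letterProbs π)) K i x) =
      avg π fun x => after s w (fun K => y (K + 1)) K i x := fun K hK i hi => by
    congr 1
    funext x
    rw [after_eq, after_eq, hy _ (target_lt w x.2 hK hi)]
  refine ⟨(List.range B).map σ, (List.range B).map fun K => P (K + 1), P 0, D, ?_, ?_,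
    fun K hK => ?_⟩
  · dsimp only
    rw [IntPoly.value_neg]
    linarith
  · dsimp only
    rw [hP 0 (by omega)]
    exact mul_nonneg hD.le hopt.gain_nonneg
  · by_cases hl : Live s w K
    swap
    · exact Or.inl hl
    refine Or.inr ⟨⟨?_, ?_, ?_⟩, fun i hi => ?_, ?_⟩
    · rw [hσ K hK]
      exact Nat.lt_succ_of_le (hopt.le K hK hl)
    · rw [hσ K hK]
      exact hopt.useful K hK hl
    · dsimp only
      rw [hσ K hK, IntPoly.value_neg, value_slackPoly hD.ne', hy K hK, hy0,
        hafter K hK _ (hopt.le K hK hl), ← mul_neg]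
      exact mul_nonneg hD.le (by linarith [hopt.le_avg K hK hl])
    · dsimp only
      rw [value_slackPoly hD.ne', hy K hK, hy0, hafter K hK i (by omega)]
      exact mul_nonneg hD.le (by linarith [hopt.avg_le K hK hl i (by omega)])
    · by_cases hf : Full s w K
      · right
        dsimp only
        rw [value_skipPoly hD.ne', hy K hK]
        have h1 := hopt.le_skip K hK hf
        unfold hat at h1 ⊢
        dsimp only at h1 ⊢
        rw [hy _ ((norm_le s w _).trans_lt (div_lt_window hK))]
        exact mul_nonneg hD.le (by linarith)
      · exact Or.inl hf

/-- The states reachable with a strategy can be listed in an order of discovery. -/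
theorem exists_explores (hs : 0 < s) {σ : List ℕ}
    (hσ : ∀ K < (s + 1) ^ (n + 1), Live s w K → σ.getD K 0 ≤ n) : ∃ L, Explores s w σ L := by
  set B := (s + 1) ^ (n + 1) with hB
  -- The list grows by one undiscovered target until it is closed. Being duplicate-free and below
  -- `B`, it has at most `B` entries, so `d` bounds the remaining growth.
  have main : ∀ d : ℕ, ∀ L : List ℕ, L.Nodup → (∀ K ∈ L, K < B ∧ Live s w K) →
      L.head? = some 0 → (∀ q < L.length, q = 0 ∨ ∃ q' < q, ∃ x < s,
        target s w (L.getD q' 0) (σ.getD (L.getD q' 0) 0) x = L.getD q 0) →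
      B < L.length + d → ∃ L, Explores s w σ L := by
    intro d
    induction d with
    | zero =>
      intro L hnd hL _ _ hlen
      exfalso
      have h1 := (List.subperm_of_subset hnd (l₂ := List.range B) fun K hK =>
        List.mem_range.mpr (hL K hK).1).length_le
      simp at h1
      omega
    | succ d ih =>
      intro L hnd hL hh hp hlen
      have hmem : ∀ q < L.length, L.getD q 0 ∈ L := fun q hq => by
        rw [List.getD_eq_getElem _ _ hq]
        exact List.getElem_mem hq
      by_cases hcl : ∀ q < L.length, ∀ x < s,
          target s w (L.getD q 0) (σ.getD (L.getD q 0) 0) x ∈ L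
      · refine ⟨L, hh, fun q hq => ?_, fun q hq x hx => List.idxOf_lt_length_of_mem (hcl q hq x hx),
          hp⟩
        rw [List.getD_eq_getElem _ _ hq]
        exact hnd.idxOf_getElem q hq
      · push Not at hcl
        obtain ⟨q, hq, x, hx, hnot⟩ := hcl
        set K := target s w (L.getD q 0) (σ.getD (L.getD q 0) 0) x with hK
        have hq' := hL _ (hmem q hq)
        refine ih (L ++ [K]) ?_ ?_ ?_ ?_ (by simp; omega)
        · exact List.nodup_append.mpr ⟨hnd, by simp, fun a ha b hb => by
            rw [List.mem_singleton.mp hb]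
            rintro rfl
            exact hnot ha⟩
        · intro M hM
          rcases List.mem_append.mp hM with hM | hM
          · exact hL M hM
          · rw [List.mem_singleton.mp hM]
            exact ⟨target_lt w hx hq'.1 (hσ _ hq'.1 hq'.2), live_target hs w _ _ _⟩
        · simp [List.head?_append, hh]
        · intro r hr
          have hget : ∀ {r}, r < L.length → (L ++ [K]).getD r 0 = L.getD r 0 := fun {r} hr =>
            List.getD_append _ _ _ _ hr
          rcases lt_or_ge r L.length with hr' | hr'
          · rcases hp r hr' with h0 | ⟨q', hq', y, hy, h⟩
            · exact Or.inl h0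
            · refine Or.inr ⟨q', hq', y, hy, ?_⟩
              rw [hget (hq'.trans hr'), hget hr', h]
          · have : r = L.length := by
              simp at hr
              omega
            subst this
            refine Or.inr ⟨q, hq, x, hx, ?_⟩
            rw [hget hq, List.getD_append_right _ _ _ _ le_rfl]
            simp [hK]
  refine main B [0] (by simp) ?_ rfl ?_ ?_
  · intro K hK
    rw [List.mem_singleton.mp hK]
    exact ⟨by positivity, live_zero s w⟩
  · intro q hq
    left
    simpa using hq
  · simp

/-! ### Termination of the algorithm -/

/-- The right answers to the first `T` queries. -/
noncomputable def answers (x : ℕ → ℝ) (T : ℕ) : List Bool :=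
  ((List.range T).map fun k =>
    decide (0 ≤ IntPoly.value ((Encodable.decode (α := IntPoly) k).getD []) x)).reverse

theorem answered_answers {x : ℕ → ℝ} {T : ℕ} {b : Bool} {P : IntPoly} :
    Answered (answers x T) b P ↔ Encodable.encode P < T ∧ decide (0 ≤ IntPoly.value P x) = b := by
  unfold Answered answers
  rw [List.reverse_reverse, List.getElem?_map]
  by_cases h : Encodable.encode P < T
  · simp [h]
  · simp [h]

theorem Certifies.mono {yes no yes' no' : IntPoly → Prop} (hy : ∀ P, yes P → yes' P)
    (hno : ∀ P, no P → no' P) {σ : List ℕ} {H : List IntPoly} {G D : IntPoly}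
    (h : Certifies s w n yes no σ H G D) : Certifies s w n yes' no' σ H G D :=
  ⟨hno _ h.1, hy _ h.2.1, fun K hK => (h.2.2 K hK).imp id fun h' =>
    ⟨⟨h'.1.1, h'.1.2.1, hy _ h'.1.2.2⟩, fun i hi => hy _ (h'.2.1 i hi), h'.2.2.imp id (hy _)⟩⟩

/-- Checking one certificate uses finitely many queries, and each polynomial is queried at the time
given by its code. -/
theorem Certifies.eventually {x : ℕ → ℝ} {σ : List ℕ} {H : List IntPoly} {G D : IntPoly}
    (h : Certifies s w n (fun P => 0 ≤ IntPoly.value P x) (fun P => IntPoly.value P x < 0)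
      σ H G D) :
    ∀ᶠ T in atTop, Certifies s w n (Answered (answers x T) true) (Answered (answers x T) false)
      σ H G D := by
  have hy : ∀ P, 0 ≤ IntPoly.value P x → ∀ᶠ T in atTop, Answered (answers x T) true P :=
    fun P hP => (eventually_gt_atTop (Encodable.encode P)).mono fun T hT =>
      answered_answers.mpr ⟨hT, by simpa using hP⟩
  have hno : ∀ P, IntPoly.value P x < 0 → ∀ᶠ T in atTop, Answered (answers x T) false P :=
    fun P hP => (eventually_gt_atTop (Encodable.encode P)).mono fun T hT =>
      answered_answers.mpr ⟨hT, by simpa using hP⟩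
  refine (hno _ h.1).and ((hy _ h.2.1).and ?_)
  refine (eventually_all_finite (Set.finite_lt_nat ((s + 1) ^ (n + 1)))).mpr fun K hK => ?_
  rcases h.2.2 K hK with hl | ⟨⟨h1, h2, h3⟩, h4, h5⟩
  · exact Eventually.of_forall fun _ => Or.inl hl
  · have h4' := (eventually_all_finite (Set.finite_lt_nat (n + 1))).mpr fun i hi => hy _ (h4 i hi)
    rcases h5 with h5 | h5
    · filter_upwards [hy _ h3, h4'] with T h3 h4
      exact Or.inr ⟨⟨h1, h2, h3⟩, h4, Or.inl h5⟩
    · filter_upwards [hy _ h3, h4', hy _ h5] with T h3 h4 h5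
      exact Or.inr ⟨⟨h1, h2, h3⟩, h4, Or.inr h5⟩

theorem accepts_of_mem_outputs {p : (ℕ × List ℕ × ℕ) × List Bool} {b : MachineCode}
    (h : b ∈ outputs p) : ∃ c, Accepts p.1 p.2 c ∧ strategyCode p.1.1 p.1.2.1 c.2.1 c.1 = b := by
  obtain ⟨k, -, h⟩ := List.mem_filterMap.mp h
  obtain ⟨c, -, h⟩ := Option.bind_eq_some_iff.mp h
  split_ifs at h with ha
  exact ⟨c, ha, Option.some.inj h⟩

theorem mem_outputs_of_accepts {p : (ℕ × List ℕ × ℕ) × List Bool} {c : Candidate}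
    (hc : Encodable.encode c < p.2.length) (ha : Accepts p.1 p.2 c) :
    strategyCode p.1.1 p.1.2.1 c.2.1 c.1 ∈ outputs p := by
  refine List.mem_filterMap.mpr ⟨Encodable.encode c, List.mem_range.mpr hc, ?_⟩
  rw [Encodable.encodek, Option.bind_some, if_pos ha]

theorem length_answers (x : ℕ → ℝ) (T : ℕ) : (answers x T).length = T := by simp [answers]

theorem answers_succ (x : ℕ → ℝ) (T : ℕ) : answers x (T + 1) =
    decide (0 ≤ IntPoly.value ((Encodable.decode (α := IntPoly) T).getD []) x) :: answers x T := by
  simp [answers, List.range_succ]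

/-- As long as no candidate is accepted, the algorithm asks the query numbered by the count of its
answers, so its history is `answers x T`. It halts at the first `T` with a nonempty list of outputs.
-/
theorem search_outputs {a : ℕ × List ℕ × ℕ} {x : ℕ → ℝ}
    (h : ∃ T, outputs (a, answers x T) ≠ []) :
    ∃ T, ∃ b ∈ outputs (a, answers x T), ExactAlgorithm.Outputs search a x b := by
  classical
  have hne := Nat.find_spec h
  refine ⟨Nat.find h, (outputs (a, answers x (Nat.find h))).head hne, List.head_mem hne,
    Nat.find h + 1, ?_⟩
  have key : ∀ d T, T + d = Nat.find h →
      ExactAlgorithm.run search a x (d + 1) (answers x T) =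
        some ((outputs (a, answers x (Nat.find h))).head hne) := by
    intro d
    induction d with
    | zero =>
      intro T hT
      rw [add_zero] at hT
      subst hT
      rw [ExactAlgorithm.run, search, List.head?_eq_some_head hne]
      rfl
    | succ d ih =>
      intro T hT
      have h0 : outputs (a, answers x T) = [] := by
        by_contra hne'
        exact Nat.find_min h (by omega) hne'
      rw [ExactAlgorithm.run, search, h0]
      simp only [List.head?_nil, Option.elim_none, length_answers]
      rw [← answers_succ]
      exact ih (T + 1) (by omega)
  exact key _ 0 (zero_add _)

/-- The algorithm halts and outputs the machine of an optimal strategy. -/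
theorem search_spec (hs : 0 < s) (hw : w ≠ []) (hn : w.length ≤ n + 1)
    (hπ : π ∈ stdSimplex ℝ (Fin s)) :
    ∃ (σ L : List ℕ) (g : ℝ) (h : ℕ → ℝ), OptimalStrategy w n π (fun K => σ.getD K 0) g h ∧
      Explores s w σ L ∧
      ExactAlgorithm.Outputs search (s, w, n) (letterProbs π) (strategyCode s w σ L) := by
  obtain ⟨σ, H, G, D, hcert⟩ := exists_certifies hs hw hn hπ
  obtain ⟨g, f, hopt⟩ := hcert.exists_optimalStrategy
  obtain ⟨L, hL⟩ := exists_explores hs (n := n) hopt.le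
  obtain ⟨T, hT, hTc⟩ := (hcert.eventually.and
    (eventually_gt_atTop (Encodable.encode ((L, σ, H, G, D) : Candidate)))).exists
  obtain ⟨T, b, hb, hout⟩ := search_outputs (a := (s, w, n)) (x := letterProbs π) ⟨T, by
    have := mem_outputs_of_accepts (p := ((s, w, n), answers (letterProbs π) T))
      (c := (L, σ, H, G, D)) (by rwa [length_answers]) ⟨hL, hT⟩
    exact List.ne_nil_of_mem this⟩
  -- The accepted candidate may differ from the one which ensured termination. It is nevertheless
  -- sound, because all the answers it relies on are true.
  obtain ⟨⟨L', σ', H', G', D'⟩, ⟨hL', hc'⟩, rfl⟩ := accepts_of_mem_outputs hb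
  obtain ⟨g', f', hopt'⟩ := (hc'.mono (fun P hP => by
    simpa using (answered_answers.mp hP).2) (fun P hP => by
    simpa using (answered_answers.mp hP).2)).exists_optimalStrategy (π := π)
  exact ⟨σ', L', g', f', hopt', hL', hout⟩

end
end PatternMatching

namespace PatternMatching

/-! ### Machines with memory -/

theorem occursAt_iff {A : Type*} {w t : List A} {p : ℕ} (pad : A) :
    OccursAt w t p ↔ p + w.length ≤ t.length ∧ ∀ j, (hj : j < w.length) → t.getD (p + j) pad = w[j] := by
  unfold OccursAt
  refine and_congr_right fun hp => ⟨fun h j hj => ?_, fun h => ?_⟩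
  · rw [List.getD_eq_getElem _ _ (by omega)]
    have h1 : ((t.drop p).take w.length)[j]? = w[j]? := by rw [h]
    rw [List.getElem?_take_of_lt hj, List.getElem?_drop, List.getElem?_eq_getElem (by omega),
      List.getElem?_eq_getElem hj] at h1
    exact Option.some.inj h1
  · refine List.ext_getElem (by simp; omega) fun j h1 h2 => ?_
    rw [List.getElem_take, List.getElem_drop, ← h j h2, List.getD_eq_getElem _ _ (by omega)]

/-- The prefix of length `N` of an infinite text. -/
def prefixOf {A : Type*} (T : ℕ → A) (N : ℕ) : List A := (List.range N).map T

theorem length_prefixOf {A : Type*} (T : ℕ → A) (N : ℕ) : (prefixOf T N).length = N := by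
  simp [prefixOf]

theorem getD_prefixOf {A : Type*} (T : ℕ → A) {N j : ℕ} (h : j < N) (pad : A) :
    (prefixOf T N).getD j pad = T j := by
  rw [List.getD_eq_getElem _ _ (by simpa [prefixOf] using h)]
  simp [prefixOf]

/-- A state of a machine, with the letters it knows in the window starting at its position, and
whether it has printed its position. -/
abbrev AugState (s n : ℕ) (Q : Type*) : Type _ := Q × Fin ((s + 1) ^ (n + 1)) × Bool

namespace MatchingMachine

variable {s : ℕ} {Q : Type*} {w : List (Fin s)} (M : MatchingMachine (Fin s) Q w) (n : ℕ)

/-- Reading `x` in the state `q` is a match transition. -/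
def IsMatch (q : Q) (x : Fin s) : Prop := q ∈ M.prematch ∧ w[M.next q]? = some x

/-- The knowledge relative to the current position, after reading `x` and before the shift. -/
def learn (X : AugState s n Q) (x : Fin s) : ℕ := rd s X.2.1 (M.next X.1) x

open Classical in
/-- The current position is printed, at the latest when reading `x`. -/
noncomputable def printed (X : AugState s n Q) (x : Fin s) : Bool :=
  X.2.2 || decide (M.IsMatch X.1 x)

/-- The transition of a machine with memory. -/
noncomputable def augStep (X : AugState s n Q) (x : Fin s) : AugState s n Q :=
  (M.trans X.1 x,
    ⟨M.learn n X x / (s + 1) ^ M.shift X.1 x % (s + 1) ^ (n + 1), Nat.mod_lt _ (by positivity)⟩,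
    if M.shift X.1 x = 0 then M.printed n X x else false)

/-- The initial state of the machine with memory. -/
def augInit : AugState s n Q := (M.init, ⟨0, by positivity⟩, false)

/-- The run of a machine with memory on an infinite text. -/
noncomputable def augTrace (T : ℕ → Fin s) : ℕ → AugState s n Q × ℕ
  | 0 => (M.augInit n, 0)
  | i + 1 =>
    let c := augTrace T i
    let x := T (c.2 + M.next c.1.1)
    (M.augStep n c.1 x, c.2 + M.shift c.1.1 x)

/-- The letter read by the machine with memory at the `i`-th iteration. -/
noncomputable def augLetter (T : ℕ → Fin s) (i : ℕ) : Fin s :=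
  T ((M.augTrace n T i).2 + M.next (M.augTrace n T i).1.1)

theorem augTrace_succ (T : ℕ → Fin s) (i : ℕ) : M.augTrace n T (i + 1) =
    (M.augStep n (M.augTrace n T i).1 (M.augLetter n T i),
      (M.augTrace n T i).2 + M.shift (M.augTrace n T i).1.1 (M.augLetter n T i)) := rfl

variable {M n}

/-- Memory does not influence the run. Padding turns the finite text into an infinite one, on which
all later arguments take place. -/
theorem config_eq (pad : Fin s) (t : List (Fin s)) (i : ℕ) : M.config pad t i =
    ((M.augTrace n (fun j => t.getD j pad) i).1.1, (M.augTrace n (fun j => t.getD j pad) i).2) := by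
  induction i with
  | zero => rfl
  | succ i ih =>
    rw [config, augTrace_succ, ih]
    rfl

theorem running_iff {pad : Fin s} {t : List (Fin s)} {i : ℕ} : M.Running pad t i ↔
    (M.augTrace n (fun j => t.getD j pad) i).2 + w.length ≤ t.length := by
  rw [Running, posAt, config_eq (n := n)]

theorem matchAt_iff {pad : Fin s} {t : List (Fin s)} {i : ℕ} : M.MatchAt pad t i ↔
    (M.augTrace n (fun j => t.getD j pad) i).2 + w.length ≤ t.length ∧
      M.IsMatch (M.augTrace n (fun j => t.getD j pad) i).1.1
        (M.augLetter n (fun j => t.getD j pad) i) := by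
  rw [MatchAt, running_iff (n := n), letterAt, stateAt, posAt, config_eq (n := n)]
  rfl

theorem posAt_eq {pad : Fin s} {t : List (Fin s)} {i : ℕ} :
    M.posAt pad t i = (M.augTrace n (fun j => t.getD j pad) i).2 := by
  rw [posAt, config_eq (n := n)]

theorem monotone_pos (T : ℕ → Fin s) : Monotone fun i => (M.augTrace n T i).2 :=
  monotone_nat_of_le_succ fun i => by rw [augTrace_succ]; exact Nat.le_add_right _ _

/-- The order of `M` is at most `n`. -/
def OrderLE (M : MatchingMachine (Fin s) Q w) (n : ℕ) : Prop := ∀ q, M.next q ≤ n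

theorem learn_lt (hM : M.OrderLE n) (X : AugState s n Q) (x : Fin s) :
    M.learn n X x < (s + 1) ^ (n + 1) := rd_lt x.2 X.2.1.2 (hM _)

theorem augStep_knowledge (hM : M.OrderLE n) (X : AugState s n Q) (x : Fin s) :
    ((M.augStep n X x).2.1 : ℕ) = M.learn n X x / (s + 1) ^ M.shift X.1 x :=
  Nat.mod_eq_of_lt ((Nat.div_le_self _ _).trans_lt (learn_lt hM X x))

/-- What the machine with memory knows about the text is right. -/
theorem dig_augTrace (hM : M.OrderLE n) (T : ℕ → Fin s) (i : ℕ) : ∀ j,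
    dig s (M.augTrace n T i).1.2.1 j ≠ 0 →
      dig s (M.augTrace n T i).1.2.1 j = T ((M.augTrace n T i).2 + j) + 1 := by
  induction i with
  | zero => exact fun j h => absurd (dig_zero_left s j) h
  | succ i ih =>
    intro j
    rw [augTrace_succ]
    dsimp only
    rw [augStep_knowledge hM, dig_div_pow, learn, dig_rd (Fin.is_lt _)]
    split_ifs with h
    · intro _
      rw [add_assoc, add_comm _ j, h.1, augLetter]
    · intro h'
      rw [ih _ h', add_assoc, add_comm j]

theorem dig_learn (hM : M.OrderLE n) (T : ℕ → Fin s) (i j : ℕ)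
    (h : dig s (M.learn n (M.augTrace n T i).1 (M.augLetter n T i)) j ≠ 0) :
    dig s (M.learn n (M.augTrace n T i).1 (M.augLetter n T i)) j =
      T ((M.augTrace n T i).2 + j) + 1 := by
  rw [learn, dig_rd (Fin.is_lt _)] at h ⊢
  split_ifs at h ⊢ with h'
  · rw [augLetter, h'.1]
  · exact dig_augTrace hM T i j h

/-- The run only depends on the letters which were skipped or are known. -/
theorem augTrace_congr (hM : M.OrderLE n) {T T' : ℕ → Fin s} (i : ℕ)
    (h : ∀ u, u < (M.augTrace n T i).2 → T' u = T u)
    (h' : ∀ j, dig s (M.augTrace n T i).1.2.1 j ≠ 0 →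
      T' ((M.augTrace n T i).2 + j) = T ((M.augTrace n T i).2 + j)) :
    ∀ j ≤ i, M.augTrace n T' j = M.augTrace n T j ∧
      (j < i → M.augLetter n T' j = M.augLetter n T j) := by
  induction i with
  | zero =>
    intro j hj
    obtain rfl : j = 0 := by omega
    exact ⟨rfl, fun h => absurd h (lt_irrefl _)⟩
  | succ i ih =>
    set k := M.shift (M.augTrace n T i).1.1 (M.augLetter n T i) with hk
    have key : ∀ j, dig s (M.learn n (M.augTrace n T i).1 (M.augLetter n T i)) j ≠ 0 →
        T' ((M.augTrace n T i).2 + j) = T ((M.augTrace n T i).2 + j) := fun j hj => by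
      rcases lt_or_ge j k with hjk | hjk
      · refine h _ ?_
        rw [augTrace_succ]
        dsimp only
        omega
      · have := h' (j - k)
        rw [augTrace_succ] at this
        dsimp only at this
        rw [augStep_knowledge hM, dig_div_pow, ← hk, Nat.sub_add_cancel hjk,
          show (M.augTrace n T i).2 + k + (j - k) = (M.augTrace n T i).2 + j by omega] at this
        exact this hj
    have ih' := ih (fun u hu => h u (hu.trans_le (monotone_pos T (Nat.le_succ i))))
      fun j hj => key j (by rwa [learn, dig_rd_of_known (Fin.is_lt _) hj])
    have hl : M.augLetter n T' i = M.augLetter n T i := by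
      rw [augLetter, (ih' i le_rfl).1]
      exact key _ (dig_rd_self_ne (Fin.is_lt _) _ _)
    intro j hj
    rcases Nat.le_succ_iff.mp hj with hj | rfl
    · refine ⟨(ih' j hj).1, fun _ => ?_⟩
      rcases hj.eq_or_lt with rfl | hj
      · exact hl
      · exact (ih' j hj.le).2 hj
    · refine ⟨?_, fun h => absurd h (lt_irrefl _)⟩
      rw [augTrace_succ, augTrace_succ, hl, (ih' i le_rfl).1]

/-- The run is the same up to the `i`-th reading if the letters which were skipped or are known
after this reading are the same. -/
theorem augTrace_congr_of_learn (hM : M.OrderLE n) {T T' : ℕ → Fin s} (i : ℕ)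
    (h : ∀ u, u < (M.augTrace n T i).2 → T' u = T u)
    (h' : ∀ j, dig s (M.learn n (M.augTrace n T i).1 (M.augLetter n T i)) j ≠ 0 →
      T' ((M.augTrace n T i).2 + j) = T ((M.augTrace n T i).2 + j)) :
    (∀ j ≤ i, M.augTrace n T' j = M.augTrace n T j ∧ M.augLetter n T' j = M.augLetter n T j) ∧
      M.augTrace n T' (i + 1) = M.augTrace n T (i + 1) := by
  have h1 := augTrace_congr hM i h fun j hj => h' j (by
    rwa [learn, dig_rd_of_known (Fin.is_lt _) hj])
  have hl : M.augLetter n T' i = M.augLetter n T i := by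
    rw [augLetter, (h1 i le_rfl).1]
    exact h' _ (dig_rd_self_ne (Fin.is_lt _) _ _)
  refine ⟨fun j hj => ⟨(h1 j hj).1, ?_⟩, ?_⟩
  · rcases hj.eq_or_lt with rfl | hj
    · exact hl
    · exact (h1 j hj.le).2 hj
  · rw [augTrace_succ, augTrace_succ, hl, (h1 i le_rfl).1]

theorem le_of_dig_ne_zero {K j : ℕ} (hK : K < (s + 1) ^ (n + 1)) (h : dig s K j ≠ 0) : j ≤ n := by
  by_contra hj
  exact h (dig_of_lt (hK.trans_le (Nat.pow_le_pow_right (by omega) (by omega))))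

/-- The run is the same up to the `i`-th iteration on texts with a long common prefix. -/
theorem augTrace_congr_of_le (hM : M.OrderLE n) {T T' : ℕ → Fin s} (i : ℕ)
    (h : ∀ u ≤ (M.augTrace n T i).2 + n, T' u = T u) :
    ∀ j ≤ i, M.augTrace n T' j = M.augTrace n T j ∧ M.augLetter n T' j = M.augLetter n T j :=
  (augTrace_congr_of_learn hM i (fun u hu => h u (by omega)) fun j hj => h _ (by
    have := le_of_dig_ne_zero (learn_lt hM _ _) hj
    omega)).1

theorem augTrace_prefixOf (hM : M.OrderLE n) (T : ℕ → Fin s) (pad : Fin s) {i N : ℕ}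
    (h : (M.augTrace n T i).2 + n < N) : ∀ j ≤ i,
    M.augTrace n (fun u => (prefixOf T N).getD u pad) j = M.augTrace n T j ∧
      M.augLetter n (fun u => (prefixOf T N).getD u pad) j = M.augLetter n T j :=
  augTrace_congr_of_le hM i fun _ hu => getD_prefixOf T (by omega) pad

/-! ### What validity forces on the run. -/

/-- A valid machine prints exactly the occurrences, on infinite texts. -/
theorem Valid.exists_match {pad : Fin s} (hV : M.Valid pad) (hM : M.OrderLE n) {T : ℕ → Fin s}
    {p i : ℕ} (hi : p < (M.augTrace n T i).2) (hw : ∀ j, (hj : j < w.length) → T (p + j) = w[j]) :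
    ∃ j < i, (M.augTrace n T j).2 = p ∧ M.IsMatch (M.augTrace n T j).1.1 (M.augLetter n T j) := by
  set N := (M.augTrace n T i).2 + n + w.length + 1 with hN
  have hpre := augTrace_prefixOf hM T pad (i := i) (N := N) (by omega)
  obtain ⟨j, hj, hjp⟩ := (hV (prefixOf T N) p).mpr <| (occursAt_iff pad).mpr
    ⟨by rw [length_prefixOf]; omega, fun j hj => by rw [getD_prefixOf T (by omega), hw j hj]⟩
  rw [posAt_eq (n := n)] at hjp
  have hji : j < i := by
    by_contra hji
    have := monotone_pos (M := M) (n := n) (fun u => (prefixOf T N).getD u pad) (not_lt.mp hji)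
    dsimp only at this
    rw [(hpre i le_rfl).1] at this
    omega
  have h2 := (matchAt_iff (n := n)).mp hj
  rw [(hpre j hji.le).1] at hjp h2
  rw [(hpre j hji.le).2] at h2
  exact ⟨j, hji, hjp, h2.2⟩

theorem Valid.eq_of_match {pad : Fin s} (hV : M.Valid pad) (hM : M.OrderLE n) {T : ℕ → Fin s}
    {i : ℕ} (h : M.IsMatch (M.augTrace n T i).1.1 (M.augLetter n T i)) (j : ℕ)
    (hj : j < w.length) : T ((M.augTrace n T i).2 + j) = w[j] := by
  set N := (M.augTrace n T i).2 + n + w.length + 1 with hN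
  have hpre := augTrace_prefixOf hM T pad (i := i) (N := N) (by omega) i le_rfl
  have h1 := (hV (prefixOf T N) _).mp ⟨i, (matchAt_iff (n := n)).mpr ⟨by
    rw [hpre.1, length_prefixOf]; omega, by rwa [hpre.1, hpre.2]⟩, rfl⟩
  rw [posAt_eq (n := n), hpre.1] at h1
  have := ((occursAt_iff pad).mp h1).2 j hj
  rwa [getD_prefixOf T (by omega)] at this

/-- A valid machine does not stay at the same position for long. -/
theorem Valid.lt_pos [Fintype Q] {pad : Fin s} (hV : M.Valid pad) (hM : M.OrderLE n) (hw : w ≠ [])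
    (T : ℕ → Fin s) (i : ℕ) : (M.augTrace n T i).2 <
      (M.augTrace n T (i + Fintype.card (AugState s n Q))).2 := by
  by_contra hlt
  have hmono := monotone_pos (M := M) (n := n) T
  have heq : ∀ a ≤ Fintype.card (AugState s n Q),
      (M.augTrace n T (i + a)).2 = (M.augTrace n T i).2 := fun a ha => by
    have h1 := hmono (show i ≤ i + a by omega)
    have h2 := hmono (show i + a ≤ i + Fintype.card (AugState s n Q) by omega)
    dsimp only at h1 h2
    omega
  -- Pigeonhole: at a fixed position two equal states with memory make the run periodic, so the
  -- position never grows again.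
  obtain ⟨a, b, hab, he⟩ : ∃ a b : Fin (Fintype.card (AugState s n Q) + 1), a < b ∧
      (M.augTrace n T (i + a)).1 = (M.augTrace n T (i + b)).1 := by
    obtain ⟨a, b, hne, he⟩ := Fintype.exists_ne_map_eq_of_card_lt
      (fun a : Fin (Fintype.card (AugState s n Q) + 1) => (M.augTrace n T (i + a)).1) (by simp)
    rcases lt_or_gt_of_ne hne with h | h
    · exact ⟨a, b, h, he⟩
    · exact ⟨b, a, h, he.symm⟩
  have hper : ∀ d, M.augTrace n T (i + a + d) = M.augTrace n T (i + b + d) := by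
    intro d
    induction d with
    | zero =>
      refine Prod.ext he ?_
      simp only [add_zero]
      rw [heq _ (Nat.lt_succ_iff.mp a.2), heq _ (Nat.lt_succ_iff.mp b.2)]
    | succ d ih =>
      rw [← add_assoc, ← add_assoc, augTrace_succ, augTrace_succ, augLetter, augLetter, ih]
  have hmul : ∀ k, M.augTrace n T (i + a + k * (b - a)) = M.augTrace n T (i + a) := by
    intro k
    induction k with
    | zero => simp
    | succ k ih =>
      have : (a : ℕ) < b := hab
      rw [show i + a + (k + 1) * (b - a) = i + b + k * (b - a) by rw [Nat.succ_mul]; omega,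
        ← hper, ih]
  have hle : ∀ j, (M.augTrace n T j).2 ≤ (M.augTrace n T i).2 := fun j => by
    have h1 : j ≤ i + a + j * (b - a) := by
      have : (a : ℕ) < b := hab
      have := Nat.le_mul_of_pos_right j (show 0 < (b : ℕ) - a by omega)
      omega
    have h2 := hmono h1
    dsimp only at h2
    rwa [hmul, heq _ (Nat.lt_succ_iff.mp a.2)] at h2
  set p := (M.augTrace n T i).2 with hp
  have hm := List.length_pos_iff.mpr hw
  -- A blocked run reads nothing beyond `p + n`, so an occurrence of `w` placed from `p + n + 1` on
  -- would be missed.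
  set T' : ℕ → Fin s := fun u => if u ≤ p + n then T u else w.getD (u - (p + n + 1)) pad with hT'
  set N := p + n + 1 + w.length with hN
  have hcongr : ∀ j, M.augTrace n (fun u => (prefixOf T' N).getD u pad) j = M.augTrace n T j :=
    fun j => (augTrace_congr_of_le hM j (fun u hu => by
      have hu' : u ≤ p + n := hu.trans (Nat.add_le_add_right (hle j) n)
      rw [getD_prefixOf T' (by omega)]
      simp [hT', hu']) j le_rfl).1
  obtain ⟨j, -, hj⟩ := (hV (prefixOf T' N) (p + n + 1)).mpr <| (occursAt_iff pad).mpr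
    ⟨by rw [length_prefixOf], fun j hj => by
      rw [getD_prefixOf T' (by omega)]
      simp [hT', hj, show ¬ p + n + 1 + j ≤ p + n by omega]⟩
  rw [posAt_eq (n := n), hcongr] at hj
  have := hle j
  omega

theorem printed_eq_true {X : AugState s n Q} {x : Fin s} :
    M.printed n X x = true ↔ X.2.2 = true ∨ M.IsMatch X.1 x := by
  simp [printed]

theorem augStep_flag {X : AugState s n Q} {x : Fin s} : (M.augStep n X x).2.2 = true ↔
    M.shift X.1 x = 0 ∧ M.printed n X x = true := by
  simp [augStep]

/-- The flag of the machine with memory tells whether the current position was printed. -/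
theorem flag_iff (T : ℕ → Fin s) (i : ℕ) : (M.augTrace n T i).1.2.2 = true ↔
    ∃ j < i, (M.augTrace n T j).2 = (M.augTrace n T i).2 ∧
      M.IsMatch (M.augTrace n T j).1.1 (M.augLetter n T j) := by
  induction i with
  | zero => simp [augTrace, augInit]
  | succ i ih =>
    rw [augTrace_succ]
    dsimp only
    rw [augStep_flag, printed_eq_true, ih]
    constructor
    · rintro ⟨h0, ⟨j, hj, hp, hm⟩ | hm⟩
      · exact ⟨j, by omega, by omega, hm⟩
      · exact ⟨i, by omega, by omega, hm⟩
    · rintro ⟨j, hj, hp, hm⟩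
      have h1 := monotone_pos (M := M) (n := n) T (Nat.lt_succ_iff.mp hj)
      dsimp only at h1
      refine ⟨by omega, ?_⟩
      rcases (Nat.lt_succ_iff.mp hj).eq_or_lt with rfl | hj
      · exact Or.inr hm
      · exact Or.inl ⟨j, hj, by omega, hm⟩

theorem printed_iff (T : ℕ → Fin s) (i : ℕ) :
    M.printed n (M.augTrace n T i).1 (M.augLetter n T i) = true ↔
    ∃ j ≤ i, (M.augTrace n T j).2 = (M.augTrace n T i).2 ∧
      M.IsMatch (M.augTrace n T j).1.1 (M.augLetter n T j) := by
  rw [printed_eq_true, flag_iff]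
  constructor
  · rintro (⟨j, hj, h⟩ | h)
    · exact ⟨j, hj.le, h⟩
    · exact ⟨i, le_rfl, rfl, h⟩
  · rintro ⟨j, hj, h⟩
    rcases hj.eq_or_lt with rfl | hj
    · exact Or.inr h.2
    · exact Or.inl ⟨j, hj, h⟩

theorem getD_map_val (w : List (Fin s)) {j : ℕ} (hj : j < w.length) :
    (w.map Fin.val).getD j 0 = w[j] := by
  rw [List.getD_eq_getElem _ _ (by simpa using hj)]
  simp

/-- A valid machine only skips positions at which there is no occurrence, or which are printed. -/
theorem Valid.not_live_of_lt_shift {pad : Fin s} (hV : M.Valid pad) (hM : M.OrderLE n)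
    (T : ℕ → Fin s) (i : ℕ) {k : ℕ}
    (hk : k < M.shift (M.augTrace n T i).1.1 (M.augLetter n T i))
    (h0 : k = 0 → M.printed n (M.augTrace n T i).1 (M.augLetter n T i) = false) :
    ¬ Live s (w.map Fin.val)
      (M.learn n (M.augTrace n T i).1 (M.augLetter n T i) / (s + 1) ^ k) := by
  intro hl
  set p := (M.augTrace n T i).2 with hp
  -- Liveness allows an occurrence of `w` to be written at `p + k` without contradicting any letter
  -- known or skipped. The run is unchanged up to this shift, hence it must already have printed `p
  -- + k`, which is impossible unless `k = 0`.
  set T' : ℕ → Fin s := fun u => if p + k ≤ u then w.getD (u - (p + k)) (T u) else T u with hT'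
  have hw : ∀ j, (hj : j < w.length) → T' (p + k + j) = w[j] := fun j hj => by simp [hT', hj]
  obtain ⟨hc, hc'⟩ := augTrace_congr_of_learn (T := T) (T' := T') hM i
    (fun u hu => by
      have : ¬ p + k ≤ u := by omega
      simp [hT', this]) fun j hj => by
      by_cases hjw : k ≤ j ∧ j - k < w.length
      · obtain ⟨h1, h2⟩ := hjw
        have h3 := hl (j - k) (by simpa using h2)
        rw [dig_div_pow, Nat.sub_add_cancel h1, getD_map_val w h2, dig_learn hM T i j hj] at h3
        have h4 := hw (j - k) h2
        rw [show p + k + (j - k) = p + j by omega] at h4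
        rw [h4]
        exact (Fin.ext (by omega)).symm
      · simp only [hT']
        split_ifs with h1
        · rw [List.getD_eq_default _ _ (by omega)]
        · rfl
  obtain ⟨j, hj, hjp, hjm⟩ := hV.exists_match hM (T := T') (p := p + k) (i := i + 1)
    (by rw [hc', augTrace_succ]; dsimp only; omega) hw
  have hj' := Nat.lt_succ_iff.mp hj
  rw [(hc j hj').1] at hjp hjm
  rw [(hc j hj').2] at hjm
  have h1 := monotone_pos (M := M) (n := n) T hj'
  dsimp only at h1
  have h2 := h0 (by omega)
  rw [(printed_iff T i).mpr ⟨j, hj', by omega, hjm⟩] at h2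
  exact absurd h2 (by simp)

/-- On an alphabet with two letters at least, a valid machine knows the occurrences it prints. -/
theorem Valid.full_of_printed (hs : 1 < s) {pad : Fin s} (hV : M.Valid pad) (hM : M.OrderLE n)
    (T : ℕ → Fin s) (i : ℕ)
    (h : M.printed n (M.augTrace n T i).1 (M.augLetter n T i) = true) :
    Full s (w.map Fin.val) (M.learn n (M.augTrace n T i).1 (M.augLetter n T i)) := by
  obtain ⟨i', hi', hp', hm⟩ := (printed_iff T i).mp h
  intro j hj
  rw [List.length_map] at hj
  rw [getD_map_val w hj]
  have hTj := hV.eq_of_match hM hm j hj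
  by_cases h0 : dig s (M.learn n (M.augTrace n T i).1 (M.augLetter n T i)) j = 0
  · exfalso
    have : Nontrivial (Fin s) := Fin.nontrivial_iff_two_le.mpr hs
    -- A second letter is available: changing the unread letter destroys the occurrence without
    -- altering the run, which would still print it.
    obtain ⟨x, hx⟩ := exists_ne (w[j])
    set T' := Function.update T ((M.augTrace n T i).2 + j) x with hT'
    obtain ⟨hc, -⟩ := augTrace_congr_of_learn (T := T) (T' := T') hM i
      (fun u hu => Function.update_of_ne (by omega) _ _) fun j' hj' =>
        Function.update_of_ne (by rintro h; obtain rfl : j' = j := by omega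
                                  exact hj' h0) _ _
    have h1 := hc i' hi'
    rw [← h1.1, ← h1.2] at hm
    have h2 := hV.eq_of_match hM hm j hj
    rw [h1.1, hp', hT', Function.update_self] at h2
    exact hx h2
  · rw [dig_learn hM T i j h0, ← hp', hTj]

end MatchingMachine
end PatternMatching

namespace PatternMatching

/-! ### The Poisson equation of a finite chain -/

/-- The transition operator of the chain on `S` whose steps are driven by independent letters. -/
def stepMean {s : ℕ} {S : Type*} (π : Fin s → ℝ) (nx : S → Fin s → S) : (S → ℝ) →ₗ[ℝ] (S → ℝ) where
  toFun f X := avg π fun x => f (nx X x)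
  map_add' f g := funext fun X => avg_add (fun x => f (nx X x)) fun x => g (nx X x)
  map_smul' c f := funext fun X => avg_mul_left c fun x => f (nx X x)

section
variable {s : ℕ} {S : Type*} {π : Fin s → ℝ} {nx : S → Fin s → S}

theorem stepMean_apply (f : S → ℝ) (X : S) : stepMean π nx f X = avg π fun x => f (nx X x) := rfl

theorem stepMean_le (hπ : π ∈ stdSimplex ℝ (Fin s)) {f : S → ℝ} {c : ℝ} (h : ∀ X, f X ≤ c) (X : S) :
    stepMean π nx f X ≤ c := avg_le_const hπ fun _ => h _

theorem le_stepMean (hπ : π ∈ stdSimplex ℝ (Fin s)) {f : S → ℝ} {c : ℝ} (h : ∀ X, c ≤ f X) (X : S) :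
    c ≤ stepMean π nx f X := const_le_avg hπ fun _ => h _

theorem stepMean_pow_le (hπ : π ∈ stdSimplex ℝ (Fin s)) {f : S → ℝ} {c : ℝ} (h : ∀ X, f X ≤ c)
    (k : ℕ) (X : S) : (stepMean π nx ^ k) f X ≤ c := by
  induction k generalizing X with
  | zero => exact h X
  | succ k ih => rw [pow_succ']; exact stepMean_le hπ ih X

theorem le_stepMean_pow (hπ : π ∈ stdSimplex ℝ (Fin s)) {f : S → ℝ} {c : ℝ} (h : ∀ X, c ≤ f X)
    (k : ℕ) (X : S) : c ≤ (stepMean π nx ^ k) f X := by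
  induction k generalizing X with
  | zero => exact h X
  | succ k ih => rw [pow_succ']; exact le_stepMean hπ ih X

theorem eq_zero_of_forall_mul_le {a c : ℝ} (h : ∀ k : ℕ, |k * a| ≤ c) : a = 0 := by
  by_contra ha
  obtain ⟨k, hk⟩ := exists_nat_gt (c / |a|)
  rw [div_lt_iff₀ (abs_pos.mpr ha)] at hk
  have := h k
  rw [abs_mul, Nat.abs_cast] at this
  linarith

theorem exists_bound [Finite S] (f : S → ℝ) : ∃ c, 0 ≤ c ∧ ∀ X, |f X| ≤ c := by
  obtain ⟨c, hc⟩ := (Set.finite_range fun X => |f X|).bddAbove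
  exact ⟨max c 0, le_max_right _ _, fun X => (hc ⟨X, rfl⟩).trans (le_max_left _ _)⟩

/-- If `y = f - P f` is fixed by `P`, then `P ^ k f = f - k y`. Averages do not increase the bounds
of `f`, so `k y` stays bounded and `y` vanishes. -/
theorem eq_zero_of_sub_stepMean [Finite S] (hπ : π ∈ stdSimplex ℝ (Fin s)) {f y : S → ℝ}
    (hy : y = f - stepMean π nx f) (h : stepMean π nx y = y) : y = 0 := by
  have hk : ∀ k : ℕ, (stepMean π nx ^ k) f = f - (k : ℝ) • y := by
    intro k
    induction k with
    | zero => simp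
    | succ k ih =>
      rw [pow_succ', Module.End.mul_apply, ih, map_sub, map_smul, h, Nat.cast_succ, add_smul,
        one_smul, eq_sub_iff_add_eq.mpr (eq_sub_iff_add_eq'.mp hy)]
      abel
  obtain ⟨c, -, hc⟩ := exists_bound f
  funext X
  refine eq_zero_of_forall_mul_le (c := 2 * c) fun k => ?_
  have h1 := congrFun (hk k) X
  simp only [Pi.sub_apply, Pi.smul_apply, smul_eq_mul] at h1
  have h2 := stepMean_pow_le (nx := nx) hπ (fun X => (abs_le.mp (hc X)).2) k X
  have h3 := le_stepMean_pow (nx := nx) hπ (fun X => (abs_le.mp (hc X)).1) k X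
  have h4 := abs_le.mp (hc X)
  rw [abs_le]
  constructor <;> linarith

/-- The Poisson equation of a finite chain has a solution. -/
theorem exists_poisson [Finite S] (hπ : π ∈ stdSimplex ℝ (Fin s)) (nx : S → Fin s → S) (r : S → ℝ) :
    ∃ g h : S → ℝ, (∀ X, (avg π fun x => g (nx X x)) = g X) ∧
      ∀ X, r X + (avg π fun x => h (nx X x)) = g X + h X := by
  set P := stepMean π nx with hP
  set D : (S → ℝ) →ₗ[ℝ] (S → ℝ) := LinearMap.id - P with hD
  have hdisj : Disjoint (LinearMap.ker D) (LinearMap.range D) := by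
    rw [Submodule.disjoint_def]
    rintro y hy ⟨f, hf⟩
    have h1 : y - P y = 0 := by simpa [hD] using hy
    exact eq_zero_of_sub_stepMean hπ (f := f) (by rw [← hf]; simp [hD, hP]) (sub_eq_zero.mp h1).symm
  -- In finite dimension a trivial intersection suffices, by rank-nullity. Decomposing the reward
  -- `r` along the kernel and the range of `D` gives the harmonic gain `g` and the bias `h`.
  have hcompl : IsCompl (LinearMap.ker D) (LinearMap.range D) :=
    (Submodule.isCompl_iff_disjoint _ _ (by rw [add_comm, LinearMap.finrank_range_add_finrank_ker])).mpr
      hdisj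
  obtain ⟨g, hg, y, ⟨h, rfl⟩, hr⟩ := Submodule.mem_sup.mp (hcompl.sup_eq_top ▸ Submodule.mem_top (x := r))
  refine ⟨g, h, fun X => ?_, fun X => ?_⟩
  · have h1 : g - P g = 0 := by simpa [hD] using hg
    exact (congrFun (sub_eq_zero.mp h1) X).symm
  · rw [← hr]
    simp only [hD, hP, stepMean_apply, Pi.add_apply, LinearMap.sub_apply, LinearMap.id_apply,
      Pi.sub_apply]
    ring

theorem le_of_mul_le_add {a b c : ℝ} (h : ∀ k : ℕ, k * a ≤ k * b + c) : a ≤ b := by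
  by_contra! hab
  obtain ⟨k, hk⟩ := exists_nat_gt (c / (a - b))
  rw [div_lt_iff₀ (by linarith)] at hk
  linarith [h k]

/-- A gain dominates the mean gain in the Poisson equation. -/
theorem gain_le_of_superharmonic [Finite S] (hπ : π ∈ stdSimplex ℝ (Fin s)) {r g h φ : S → ℝ} {γ : ℝ}
    (hg : ∀ X, (avg π fun x => g (nx X x)) = g X)
    (hr : ∀ X, r X + (avg π fun x => h (nx X x)) = g X + h X) {R : Set S}
    (hR : ∀ X ∈ R, ∀ x, nx X x ∈ R)
    (hφ : ∀ X ∈ R, r X + (avg π fun x => φ (nx X x)) ≤ φ X + γ) : ∀ X ∈ R, g X ≤ γ := by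
  set ψ : S → ℝ := fun X => φ X - h X with hψ
  -- Iterating the difference of the two equations produces a drift `k * (γ - g X)`, the same at
  -- every iterate because `g` is harmonic. Since `ψ` is bounded, the drift cannot be unboundedly
  -- negative.
  have key : ∀ k : ℕ, ∀ X ∈ R, (stepMean π nx ^ k) ψ X ≤ ψ X + k * γ - k * g X := by
    intro k
    induction k with
    | zero => simp
    | succ k ih =>
      intro X hX
      rw [pow_succ', Module.End.mul_apply, stepMean_apply]
      have h1 : (avg π fun x => (stepMean π nx ^ k) ψ (nx X x)) ≤
          avg π fun x => φ (nx X x) - h (nx X x) + k * γ - k * g (nx X x) :=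
        avg_mono hπ fun x => ih _ (hR X hX x)
      rw [avg_sub, avg_add_const hπ, avg_sub, avg_mul_left, hg] at h1
      have h2 := hφ X hX
      have h3 := hr X
      push_cast
      simp only [hψ]
      linarith
  obtain ⟨c, -, hc⟩ := exists_bound ψ
  intro X hX
  refine le_of_mul_le_add (c := 2 * c) fun k => ?_
  have h1 := key k X hX
  have h2 := le_stepMean_pow (nx := nx) hπ (fun X => (abs_le.mp (hc X)).1) k X
  have h3 := (abs_le.mp (hc X)).2
  linarith

theorem le_gain_of_subharmonic [Finite S] (hπ : π ∈ stdSimplex ℝ (Fin s)) {r g h φ : S → ℝ} {γ : ℝ}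
    (hg : ∀ X, (avg π fun x => g (nx X x)) = g X)
    (hr : ∀ X, r X + (avg π fun x => h (nx X x)) = g X + h X) {R : Set S}
    (hR : ∀ X ∈ R, ∀ x, nx X x ∈ R)
    (hφ : ∀ X ∈ R, φ X + γ ≤ r X + (avg π fun x => φ (nx X x))) : ∀ X ∈ R, γ ≤ g X := by
  have hneg : ∀ f : S → ℝ, ∀ X, (avg π fun x => -f (nx X x)) = -avg π fun x => f (nx X x) :=
    fun f X => by simpa using avg_mul_left (π := π) (-1) fun x => f (nx X x)
  have := gain_le_of_superharmonic (r := fun X => -r X) (g := fun X => -g X) (h := fun X => -h X)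
    (φ := fun X => -φ X) (γ := -γ) hπ (fun X => by rw [hneg, hg]) (fun X => by
      rw [hneg]; linarith [hr X]) hR fun X hX => by
      rw [hneg]; linarith [hφ X hX]
  exact fun X hX => neg_le_neg_iff.mp (this X hX)

/-- The quadratic increments of a bounded martingale are summable. -/
theorem summable_variance [Finite S] (hπ : π ∈ stdSimplex ℝ (Fin s)) {g c : S → ℝ}
    (hc : ∀ X, c X = (avg π fun x => g (nx X x) ^ 2) - g X ^ 2) (hc0 : ∀ X, 0 ≤ c X) (X : S) :
    Summable fun j : ℕ => (stepMean π nx ^ j) c X := by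
  set G : S → ℝ := fun X => g X ^ 2 with hG
  have h1 : c = stepMean π nx G - G := funext fun X => hc X
  obtain ⟨C, -, hC⟩ := exists_bound G
  refine summable_of_sum_range_le (c := 2 * C) (fun j => le_stepMean_pow hπ hc0 j X) fun k => ?_
  -- The conditional variances telescope, because each is the increase of the mean of `g ^ 2`.
  have h2 : ∑ j ∈ Finset.range k, (stepMean π nx ^ j) c X = (stepMean π nx ^ k) G X - G X := by
    induction k with
    | zero => simp
    | succ k ih =>
      rw [Finset.sum_range_succ, ih, h1, map_sub, pow_succ, Module.End.mul_apply, Pi.sub_apply]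
      ring
  rw [h2]
  have h3 := stepMean_pow_le (nx := nx) hπ (fun X => (abs_le.mp (hC X)).2) k X
  have h4 := (abs_le.mp (hC X)).1
  linarith

/-- A form of Kronecker's lemma, by dominated convergence: the weights `(j + 1) ^ 2 / K ^ 2` are at
most one for `j < K`, and each of them tends to zero. -/
theorem tendsto_sum_sq_mul_div_sq {a : ℕ → ℝ} (ha : Summable a) (h0 : ∀ j, 0 ≤ a j) :
    Tendsto (fun K : ℕ => (∑ j ∈ Finset.range K, ((j : ℝ) + 1) ^ 2 * a j) / (K : ℝ) ^ 2) atTop (𝓝 0) := by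
  have h1 := tendsto_tsum_of_dominated_convergence (𝓕 := atTop)
    (f := fun (K : ℕ) (j : ℕ) => if j < K then ((j : ℝ) + 1) ^ 2 / (K : ℝ) ^ 2 * a j else 0)
    (g := fun _ => (0 : ℝ)) (bound := a) ha (fun j => ?_) (.of_forall fun K j => ?_)
  · rw [tsum_zero] at h1
    refine h1.congr fun K => ?_
    rw [tsum_eq_sum (s := Finset.range K) fun j hj => if_neg (by simpa using hj), Finset.sum_div]
    exact Finset.sum_congr rfl fun j hj => by
      rw [if_pos (Finset.mem_range.mp hj)]
      ring
  · have h2 : Tendsto (fun K : ℕ => ((j : ℝ) + 1) ^ 2 / (K : ℝ) ^ 2 * a j) atTop (𝓝 0) := by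
      have h3 : Tendsto (fun K : ℕ => ((j : ℝ) + 1) ^ 2 / (K : ℝ) ^ 2) atTop (𝓝 0) :=
        ((tendsto_pow_atTop (by norm_num)).comp tendsto_natCast_atTop_atTop).const_div_atTop _
      simpa using h3.mul_const (a j)
    refine h2.congr' ?_
    filter_upwards [eventually_gt_atTop j] with K hK
    rw [if_pos hK]
  · split_ifs with hj
    · rw [Real.norm_of_nonneg (mul_nonneg (by positivity) (h0 j))]
      refine mul_le_of_le_one_left (h0 j) ((div_le_one (by have : 0 < K := by omega
                                                           positivity)).mpr ?_)
      have : (j : ℝ) + 1 ≤ K := by exact_mod_cast hj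
      gcongr
    · simpa using h0 j

end
end PatternMatching

namespace PatternMatching

/-! ### Means over the random texts -/

/-- The mean over the random texts of length `N` with independent letters of law `π`. -/
noncomputable def textMean {s N : ℕ} (π : Fin s → ℝ) (f : (Fin N → Fin s) → ℝ) : ℝ :=
  ∑ t, f t * ∏ i, π (t i)

/-- A finite text followed by padding letters. -/
def padText {s N : ℕ} (pad : Fin s) (t : Fin N → Fin s) (j : ℕ) : Fin s := (List.ofFn t).getD j pad

/-- The text `t` with the letter at the position `k` replaced with `x`. -/
def setLetter {s N : ℕ} (t : Fin N → Fin s) (k : ℕ) (x : Fin s) (j : Fin N) : Fin s :=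
  if (j : ℕ) = k then x else t j

section
variable {s N : ℕ} {π : Fin s → ℝ}

theorem padText_of_lt (pad : Fin s) (t : Fin N → Fin s) {j : ℕ} (hj : j < N) :
    padText pad t j = t ⟨j, hj⟩ := by
  rw [padText, List.getD_eq_getElem _ _ (by simpa using hj), List.getElem_ofFn]

theorem padText_setLetter_of_ne (pad : Fin s) (t : Fin N → Fin s) {k j : ℕ} (x : Fin s) (h : j ≠ k) :
    padText pad (setLetter t k x) j = padText pad t j := by
  rcases lt_or_ge j N with hj | hj
  · rw [padText_of_lt _ _ hj, padText_of_lt _ _ hj, setLetter, if_neg h]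
  · rw [padText, padText, List.getD_eq_default _ _ (by simpa using hj),
      List.getD_eq_default _ _ (by simpa using hj)]

theorem padText_setLetter_self (pad : Fin s) (t : Fin N → Fin s) {k : ℕ} (x : Fin s) (hk : k < N) :
    padText pad (setLetter t k x) k = x := by
  rw [padText_of_lt _ _ hk, setLetter, if_pos rfl]

theorem setLetter_setLetter (pad : Fin s) (t : Fin N → Fin s) (k : ℕ) (x : Fin s) :
    setLetter (setLetter t k x) k (padText pad t k) = t := by
  funext j
  unfold setLetter
  split_ifs with h
  · subst h
    rw [padText_of_lt _ _ j.2]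
  · rfl

theorem prod_setLetter (pad : Fin s) (π : Fin s → ℝ) (t : Fin N → Fin s) {k : ℕ} (hk : k < N)
    (x : Fin s) : (∏ i, π (setLetter t k x i)) * π (padText pad t k) = (∏ i, π (t i)) * π x := by
  rw [← Finset.mul_prod_erase Finset.univ _ (Finset.mem_univ (⟨k, hk⟩ : Fin N)),
    ← Finset.mul_prod_erase Finset.univ (fun i => π (t i)) (Finset.mem_univ (⟨k, hk⟩ : Fin N)),
    Finset.prod_congr rfl (g := fun i => π (t i)) fun i hi => by
      rw [setLetter, if_neg fun h => (Finset.mem_erase.mp hi).1 (Fin.ext h)],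
    padText_of_lt _ _ hk, setLetter, if_pos rfl]
  ring

theorem textMean_mono (hπ : π ∈ stdSimplex ℝ (Fin s)) {f g : (Fin N → Fin s) → ℝ}
    (h : ∀ t, f t ≤ g t) : textMean π f ≤ textMean π g :=
  Finset.sum_le_sum fun t _ => mul_le_mul_of_nonneg_right (h t) (Finset.prod_nonneg fun _ _ => hπ.1 _)

theorem textMean_const (hπ : π ∈ stdSimplex ℝ (Fin s)) (c : ℝ) :
    textMean (N := N) π (fun _ => c) = c := by
  rw [textMean, ← Finset.mul_sum, ← Fintype.piFinset_univ,
    ← Finset.prod_univ_sum (fun _ : Fin N => Finset.univ) fun _ x => π x]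
  simp [hπ.2]

theorem textMean_add (f g : (Fin N → Fin s) → ℝ) :
    textMean π (fun t => f t + g t) = textMean π f + textMean π g := by
  simp [textMean, add_mul, Finset.sum_add_distrib]

theorem textMean_sub (f g : (Fin N → Fin s) → ℝ) :
    textMean π (fun t => f t - g t) = textMean π f - textMean π g := by
  simp [textMean, sub_mul, Finset.sum_sub_distrib]

theorem textMean_mul_left (c : ℝ) (f : (Fin N → Fin s) → ℝ) :
    textMean π (fun t => c * f t) = c * textMean π f := by
  simp [textMean, mul_assoc, Finset.mul_sum]

theorem sq_textMean_le (hπ : π ∈ stdSimplex ℝ (Fin s)) (f : (Fin N → Fin s) → ℝ) :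
    textMean π f ^ 2 ≤ textMean π fun t => f t ^ 2 := by
  set c := textMean π f with hc
  have h1 : 0 ≤ textMean π fun t => (f t - c) ^ 2 :=
    (textMean_const hπ 0).symm.trans_le (textMean_mono hπ fun t => sq_nonneg _)
  have h2 : (fun t => (f t - c) ^ 2) = fun t => f t ^ 2 - 2 * c * f t + c ^ 2 := by
    funext t; ring
  rw [h2, textMean_add, textMean_sub, textMean_const hπ, textMean_mul_left, ← hc] at h1
  linarith

/-- A letter which is read for the first time is independent of the past. -/
theorem textMean_fresh {Z : Type*} (hπ : π ∈ stdSimplex ℝ (Fin s)) (pad : Fin s)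
    (z : (Fin N → Fin s) → Z) (D : Z → Prop) (k : Z → ℕ) (hk : ∀ t, D (z t) → k (z t) < N)
    (hinv : ∀ t x, D (z t) → z (setLetter t (k (z t)) x) = z t) (f : Z → Fin s → ℝ)
    (hf : ∀ t, ¬ D (z t) → ∀ x y, f (z t) x = f (z t) y) :
    (textMean π fun t => f (z t) (padText pad t (k (z t)))) = textMean π fun t => avg π (f (z t)) := by
  classical
  -- With an extra independent letter adjoined to the text, exchanging it with the letter about to
  -- be read is an involution. It preserves the weights and, as the past has not looked at that
  -- letter, also the value of `z`.
  set e : (Fin N → Fin s) × Fin s → (Fin N → Fin s) × Fin s := fun c =>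
    if D (z c.1) then (setLetter c.1 (k (z c.1)) c.2, padText pad c.1 (k (z c.1))) else c with he
  have hinvol : Function.Involutive e := fun c => by
    by_cases hD : D (z c.1)
    · have h1 : e c = (setLetter c.1 (k (z c.1)) c.2, padText pad c.1 (k (z c.1))) := if_pos hD
      have h2 := hinv c.1 c.2 hD
      rw [h1, he]
      dsimp only
      rw [h2, if_pos hD, setLetter_setLetter, padText_setLetter_self _ _ _ (hk _ hD)]
    · have h1 : e c = c := if_neg hD
      rw [h1, h1]
  have h1 : (textMean π fun t => f (z t) (padText pad t (k (z t)))) =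
      ∑ c : (Fin N → Fin s) × Fin s,
        f (z c.1) (padText pad c.1 (k (z c.1))) * ((∏ i, π (c.1 i)) * π c.2) := by
    rw [Fintype.sum_prod_type]
    refine Finset.sum_congr rfl fun t _ => ?_
    dsimp only
    rw [← Finset.mul_sum, ← Finset.mul_sum, hπ.2, mul_one]
  have h2 : (textMean π fun t => avg π (f (z t))) =
      ∑ c : (Fin N → Fin s) × Fin s, f (z c.1) c.2 * ((∏ i, π (c.1 i)) * π c.2) := by
    rw [Fintype.sum_prod_type]
    refine Finset.sum_congr rfl fun t _ => ?_
    simp only [avg, Finset.sum_mul]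
    exact Finset.sum_congr rfl fun x _ => by ring
  rw [h1, h2, ← Equiv.sum_comp hinvol.toPerm fun c : (Fin N → Fin s) × Fin s =>
    f (z c.1) c.2 * ((∏ i, π (c.1 i)) * π c.2)]
  refine Finset.sum_congr rfl fun c _ => ?_
  rw [Function.Involutive.coe_toPerm]
  by_cases hD : D (z c.1)
  · have h3 : e c = (setLetter c.1 (k (z c.1)) c.2, padText pad c.1 (k (z c.1))) := if_pos hD
    rw [h3]
    dsimp only
    rw [hinv _ _ hD, prod_setLetter pad π _ (hk _ hD)]
  · have h3 : e c = c := if_neg hD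
    rw [h3, hf _ hD _ c.2]

end

/-! ### The speed of a machine -/

/-- The state and the position of a run, its number of iterations, and the sum of the values of
some function at its earlier states. -/
structure Tally (S : Type*) where
  /-- the current state -/
  state : S
  /-- the current position -/
  pos : ℕ
  /-- the number of iterations -/
  count : ℕ
  /-- the sum over the earlier states -/
  sum : ℝ

namespace MatchingMachine

variable {s : ℕ} {Q : Type*} {w : List (Fin s)} (M : MatchingMachine (Fin s) Q w) (n : ℕ)

/-- The letter which is read in the state `X` if the next unknown letter is `x`. -/
def known (X : AugState s n Q) (x : Fin s) : Fin s :=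
  if h : dig s X.2.1 (M.next X.1) = 0 then x
  else ⟨dig s X.2.1 (M.next X.1) - 1, by
    have := dig_le s X.2.1 (M.next X.1)
    omega⟩

/-- The next state if the next unknown letter is `x`. -/
noncomputable def nx (X : AugState s n Q) (x : Fin s) : AugState s n Q := M.augStep n X (M.known n X x)

/-- The next shift if the next unknown letter is `x`. -/
def sh (X : AugState s n Q) (x : Fin s) : ℕ := M.shift X.1 (M.known n X x)

/-- The tally of the run on the text `T`, stopped once the position is at least `L`. -/
noncomputable def tally (L : ℕ) (g : AugState s n Q → ℝ) (T : ℕ → Fin s) : ℕ → Tally (AugState s n Q)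
  | 0 => ⟨M.augInit n, 0, 0, 0⟩
  | i + 1 => if L ≤ (M.augTrace n T i).2 then tally L g T i else
      ⟨(M.augTrace n T (i + 1)).1, (M.augTrace n T (i + 1)).2, i + 1,
        (tally L g T i).sum + g (M.augTrace n T i).1⟩

/-- The tally after one more iteration, if the next unknown letter is `x`. -/
noncomputable def tallyStep (g : AugState s n Q → ℝ) (c : Tally (AugState s n Q)) (x : Fin s) :
    Tally (AugState s n Q) :=
  ⟨M.nx n c.state x, c.pos + M.sh n c.state x, c.count + 1, c.sum + g c.state⟩

variable {M n} {L : ℕ} {g : AugState s n Q → ℝ} {T T' : ℕ → Fin s}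

theorem tally_of_lt {i : ℕ} (h : ∀ j < i, (M.augTrace n T j).2 < L) :
    M.tally n L g T i = ⟨(M.augTrace n T i).1, (M.augTrace n T i).2, i,
      ∑ j ∈ Finset.range i, g (M.augTrace n T j).1⟩ := by
  induction i with
  | zero => rfl
  | succ i ih =>
    rw [tally, if_neg (not_le.mpr (h i (Nat.lt_succ_self i))), ih fun j hj => h j (by omega),
      Finset.sum_range_succ]

theorem tally_of_le {i j : ℕ} (h : L ≤ (M.augTrace n T i).2) (hij : i ≤ j) :
    M.tally n L g T j = M.tally n L g T i := by
  induction j, hij using Nat.le_induction with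
  | base => rfl
  | succ j hij ih =>
    rw [tally, if_pos (h.trans (monotone_pos T hij)), ih]

theorem tally_of_pos_lt {i : ℕ} (h : (M.augTrace n T i).2 < L) :
    M.tally n L g T i = ⟨(M.augTrace n T i).1, (M.augTrace n T i).2, i,
      ∑ j ∈ Finset.range i, g (M.augTrace n T j).1⟩ :=
  tally_of_lt fun _ hj => (monotone_pos T hj.le).trans_lt h

theorem exists_tally_of_le {i : ℕ} (h : L ≤ (M.augTrace n T i).2) : ∃ k ≤ i,
    L ≤ (M.augTrace n T k).2 ∧ (∀ j < k, (M.augTrace n T j).2 < L) ∧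
    M.tally n L g T i = ⟨(M.augTrace n T k).1, (M.augTrace n T k).2, k,
      ∑ j ∈ Finset.range k, g (M.augTrace n T j).1⟩ := by
  classical
  have hex : ∃ j, L ≤ (M.augTrace n T j).2 := ⟨i, h⟩
  have hlt : ∀ j < Nat.find hex, (M.augTrace n T j).2 < L := fun j hj => not_le.mp (Nat.find_min hex hj)
  exact ⟨Nat.find hex, Nat.find_min' hex h, Nat.find_spec hex, hlt, by
    rw [tally_of_le (Nat.find_spec hex) (Nat.find_min' hex h), tally_of_lt hlt]⟩

theorem le_pos_tally_iff {i : ℕ} : L ≤ (M.tally n L g T i).pos ↔ L ≤ (M.augTrace n T i).2 := by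
  by_cases h : L ≤ (M.augTrace n T i).2
  · obtain ⟨k, -, hk, -, h1⟩ := exists_tally_of_le (g := g) h
    rw [h1]
    exact iff_of_true hk h
  · rw [tally_of_pos_lt (not_le.mp h)]

theorem tally_congr {i : ℕ} (h : ∀ j ≤ i, M.augTrace n T' j = M.augTrace n T j) :
    M.tally n L g T' i = M.tally n L g T i := by
  induction i with
  | zero => rfl
  | succ i ih =>
    rw [tally, tally, ih fun j hj => h j (by omega), h i (by omega), h (i + 1) le_rfl]

theorem known_augTrace (hM : M.OrderLE n) (T : ℕ → Fin s) (i : ℕ) :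
    M.known n (M.augTrace n T i).1 (M.augLetter n T i) = M.augLetter n T i := by
  unfold known
  split_ifs with h
  · rfl
  · refine Fin.ext ?_
    dsimp only
    rw [dig_augTrace hM T i _ h, augLetter, Nat.add_sub_cancel]

/-- The evolution of the mean of a function of the tally. -/
theorem textMean_tally_succ {N : ℕ} {π : Fin s → ℝ} (hπ : π ∈ stdSimplex ℝ (Fin s))
    (hM : M.OrderLE n) (hL : L + n ≤ N) (pad : Fin s) (F : Tally (AugState s n Q) → ℝ) (i : ℕ) :
    (textMean π fun t : Fin N → Fin s => F (M.tally n L g (padText pad t) (i + 1))) =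
      textMean π fun t : Fin N → Fin s =>
        if L ≤ (M.tally n L g (padText pad t) i).pos then F (M.tally n L g (padText pad t) i)
        else avg π fun x => F (M.tallyStep n g (M.tally n L g (padText pad t) i) x) := by
  set z : (Fin N → Fin s) → (AugState s n Q × ℕ) × Tally (AugState s n Q) := fun t =>
    (M.augTrace n (padText pad t) i, M.tally n L g (padText pad t) i) with hz
  set f : (AugState s n Q × ℕ) × Tally (AugState s n Q) → Fin s → ℝ := fun z x =>
    if L ≤ z.1.2 then F z.2 else
      F ⟨M.nx n z.1.1 x, z.1.2 + M.sh n z.1.1 x, i + 1, z.2.sum + g z.1.1⟩ with hf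
  -- The fresh case is a run not yet stopped whose next letter is unknown. Since the position is
  -- below `L` and `L + n ≤ N`, this letter belongs to the text and not to the padding. When the
  -- letter is known, the step does not depend on `x`.
  have key := textMean_fresh hπ pad z
    (fun z => z.1.2 < L ∧ dig s z.1.1.2.1 (M.next z.1.1.1) = 0)
    (fun z => z.1.2 + M.next z.1.1.1) (fun t ht => by have := hM (z t).1.1.1; omega)
    (fun t x ht => by
      have h1 := augTrace_congr hM (T := padText pad t)
        (T' := padText pad (setLetter t ((z t).1.2 + M.next (z t).1.1.1) x)) i
        (fun u hu => padText_setLetter_of_ne _ _ _ (by simp only [hz]; omega))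
        fun j hj => padText_setLetter_of_ne _ _ _ (by
          simp only [hz]
          intro h
          obtain rfl : j = _ := Nat.add_left_cancel h
          exact hj ht.2)
      exact Prod.ext (h1 i le_rfl).1 (tally_congr fun j hj => (h1 j hj).1)) f
    (fun t ht x y => by
      simp only [hf]
      split_ifs with h
      · rfl
      · have h1 : ¬ dig s (z t).1.1.2.1 (M.next (z t).1.1.1) = 0 := fun h' => ht ⟨not_le.mp h, h'⟩
        rw [nx, nx, sh, sh, known, known, dif_neg h1, dif_neg h1])
  have hlt : ∀ t : Fin N → Fin s, ¬ L ≤ (M.augTrace n (padText pad t) i).2 → _ := fun t h =>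
    tally_of_pos_lt (g := g) (not_le.mp h)
  convert key using 2
  · funext t
    simp only [hf, hz]
    rw [tally]
    split_ifs with h
    · rfl
    · have h1 := known_augTrace hM (padText pad t) i
      rw [augLetter] at h1
      rw [augTrace_succ, augLetter, nx, sh, h1]
  · funext t
    simp only [hf, hz]
    by_cases h : L ≤ (M.augTrace n (padText pad t) i).2
    · simp only [le_pos_tally_iff, h, if_true]
      rw [avg_const hπ]
    · simp only [le_pos_tally_iff, h, if_false]
      rw [hlt t h]
      rfl

end MatchingMachine
end PatternMatching

/-! ### Mean-square estimates and existence of the speed. -/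

namespace PatternMatching
namespace MatchingMachine

variable {s : ℕ} {Q : Type*} {w : List (Fin s)} {M : MatchingMachine (Fin s) Q w} {n : ℕ}

section
variable {L N : ℕ} {π : Fin s → ℝ} {g : AugState s n Q → ℝ}

/-- The increase of the mean of a function of the tally. -/
theorem textMean_tally_succ_le (hπ : π ∈ stdSimplex ℝ (Fin s)) (hM : M.OrderLE n) (hL : L + n ≤ N)
    (pad : Fin s) {F e : Tally (AugState s n Q) → ℝ}
    (h : ∀ c, (avg π fun x => F (M.tallyStep n g c x)) ≤ F c + e c) (i : ℕ) :
    (textMean π fun t : Fin N → Fin s => F (M.tally n L g (padText pad t) (i + 1))) ≤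
      (textMean π fun t : Fin N → Fin s => F (M.tally n L g (padText pad t) i)) +
      textMean π fun t : Fin N → Fin s =>
        if L ≤ (M.tally n L g (padText pad t) i).pos then 0 else e (M.tally n L g (padText pad t) i) := by
  rw [textMean_tally_succ hπ hM hL, ← textMean_add]
  refine textMean_mono hπ fun t => ?_
  split_ifs
  · rw [add_zero]
  · exact h _

theorem textMean_tally_zero (hπ : π ∈ stdSimplex ℝ (Fin s)) (pad : Fin s)
    (F : Tally (AugState s n Q) → ℝ) :
    (textMean π fun t : Fin N → Fin s => F (M.tally n L g (padText pad t) 0)) =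
      F ⟨M.augInit n, 0, 0, 0⟩ :=
  textMean_const hπ (F ⟨M.augInit n, 0, 0, 0⟩)

theorem textMean_tally_le_linear (hπ : π ∈ stdSimplex ℝ (Fin s)) (hM : M.OrderLE n)
    (hL : L + n ≤ N) (pad : Fin s) {F : Tally (AugState s n Q) → ℝ} {C : ℝ} (hC : 0 ≤ C)
    (h : ∀ c, (avg π fun x => F (M.tallyStep n g c x)) ≤ F c + C) (i : ℕ) :
    (textMean π fun t : Fin N → Fin s => F (M.tally n L g (padText pad t) i)) ≤
      F ⟨M.augInit n, 0, 0, 0⟩ + i * C := by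
  induction i with
  | zero => rw [textMean_tally_zero hπ]; simp
  | succ i ih =>
    refine (textMean_tally_succ_le hπ hM hL pad h i).trans ?_
    have h1 : (textMean π fun t : Fin N → Fin s =>
        if L ≤ (M.tally n L g (padText pad t) i).pos then 0 else C) ≤ C :=
      (textMean_mono hπ fun t => by split_ifs <;> simp [hC]).trans_eq (textMean_const hπ C)
    push_cast
    linarith

/-- The mean over the running texts is dominated by the mean of the chain. -/
theorem textMean_running_le (hπ : π ∈ stdSimplex ℝ (Fin s)) (hM : M.OrderLE n) (hL : L + n ≤ N)
    (pad : Fin s) (i : ℕ) {f : AugState s n Q → ℝ} (hf : ∀ X, 0 ≤ f X) :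
    (textMean π fun t : Fin N → Fin s => if L ≤ (M.tally n L g (padText pad t) i).pos then 0
      else f (M.tally n L g (padText pad t) i).state) ≤
      (stepMean π (M.nx n) ^ i) f (M.augInit n) := by
  induction i generalizing f with
  | zero =>
    rw [textMean_tally_zero hπ pad fun c => if L ≤ c.pos then 0 else f c.state]
    split_ifs
    · exact hf _
    · exact le_rfl
  | succ i ih =>
    rw [textMean_tally_succ hπ hM hL pad fun c => if L ≤ c.pos then 0 else f c.state,
      pow_succ, Module.End.mul_apply]
    refine le_trans (textMean_mono hπ fun t => ?_) (ih (f := stepMean π (M.nx n) f)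
      fun X => le_stepMean hπ hf X)
    split_ifs with h
    · exact le_rfl
    · rw [stepMean_apply]
      refine avg_mono hπ fun x => ?_
      split_ifs
      · exact hf _
      · exact le_rfl

theorem avg_add_sq (hπ : π ∈ stdSimplex ℝ (Fin s)) (D : ℝ) {Y : Fin s → ℝ} (hY : avg π Y = 0) :
    (avg π fun x => (D + Y x) ^ 2) = D ^ 2 + avg π fun x => Y x ^ 2 := by
  have h : (fun x => (D + Y x) ^ 2) = fun x => D ^ 2 + (2 * D * Y x + Y x ^ 2) := by
    funext x; ring
  rw [h, avg_const_add hπ, avg_add, avg_mul_left, hY]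
  ring

theorem avg_sub_sq (hπ : π ∈ stdSimplex ℝ (Fin s)) {a : ℝ} {Y : Fin s → ℝ} (hY : avg π Y = a) :
    (avg π fun x => (a - Y x) ^ 2) = (avg π fun x => Y x ^ 2) - a ^ 2 := by
  have h : (fun x => (a - Y x) ^ 2) = fun x => a ^ 2 + (Y x ^ 2 - 2 * a * Y x) := by
    funext x; ring
  rw [h, avg_const_add hπ, avg_sub, avg_mul_left, hY]
  ring

variable {h : AugState s n Q → ℝ}

/-- The position is close to the sum of the mean gains. -/
theorem textMean_sq_pos_sub_sum_le [Finite Q] (hπ : π ∈ stdSimplex ℝ (Fin s)) (hM : M.OrderLE n)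
    (hr : ∀ X, (avg π fun x => (M.sh n X x : ℝ)) + (avg π fun x => h (M.nx n X x)) = g X + h X) :
    ∃ C D : ℝ, 0 ≤ C ∧ ∀ {L N : ℕ}, L + n ≤ N → ∀ (pad : Fin s) (i : ℕ),
      (textMean π fun t : Fin N → Fin s => ((M.tally n L g (padText pad t) i).pos +
        h (M.tally n L g (padText pad t) i).state - (M.tally n L g (padText pad t) i).sum) ^ 2) ≤
        D + i * C := by
  obtain ⟨C, hC, hCb⟩ := exists_bound fun c : AugState s n Q × Fin s =>
    ((M.sh n c.1 c.2 : ℝ) + h (M.nx n c.1 c.2) - (g c.1 + h c.1)) ^ 2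
  refine ⟨C, h (M.augInit n) ^ 2, hC, fun {L N} hL pad i => ?_⟩
  refine (textMean_tally_le_linear (F := fun c => ((c.pos : ℝ) + h c.state - c.sum) ^ 2)
    hπ hM hL pad hC (fun c => ?_) i).trans_eq (by simp)
  -- By the Poisson equation the increments of `pos + h - sum` have mean zero, so their cross terms
  -- vanish and the second moment grows at most linearly.
  have h1 : (avg π fun x => (M.sh n c.state x : ℝ) + h (M.nx n c.state x) -
      (g c.state + h c.state)) = 0 := by
    rw [avg_sub, avg_add, hr, avg_const hπ, sub_self]
  have h2 := avg_add_sq hπ ((c.pos : ℝ) + h c.state - c.sum) h1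
  have h3 : (avg π fun x => ((M.sh n c.state x : ℝ) + h (M.nx n c.state x) -
      (g c.state + h c.state)) ^ 2) ≤ C := avg_le_const hπ fun x =>
    (le_abs_self _).trans (hCb (c.state, x))
  have h4 : (fun x => (((M.tallyStep n g c x).pos : ℝ) + h (M.tallyStep n g c x).state -
      (M.tallyStep n g c x).sum) ^ 2) = fun x => ((c.pos : ℝ) + h c.state - c.sum +
        ((M.sh n c.state x : ℝ) + h (M.nx n c.state x) - (g c.state + h c.state))) ^ 2 := by
    funext x
    simp only [tallyStep]
    push_cast
    ring
  rw [h4, h2]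
  linarith

/-- The sum of the mean gains is close to a multiple of the last of them. -/
theorem textMean_sq_sum_sub_mul_le (hπ : π ∈ stdSimplex ℝ (Fin s)) (hM : M.OrderLE n)
    (hg : ∀ X, (avg π fun x => g (M.nx n X x)) = g X) {c : AugState s n Q → ℝ}
    (hc : ∀ X, c X = (avg π fun x => g (M.nx n X x) ^ 2) - g X ^ 2) (hc0 : ∀ X, 0 ≤ c X)
    (hL : L + n ≤ N) (pad : Fin s) (i : ℕ) :
    (textMean π fun t : Fin N → Fin s => ((M.tally n L g (padText pad t) i).sum -
      (M.tally n L g (padText pad t) i).count * g (M.tally n L g (padText pad t) i).state) ^ 2) ≤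
      ∑ j ∈ Finset.range i, ((j : ℝ) + 1) ^ 2 * (stepMean π (M.nx n) ^ j) c (M.augInit n) := by
  induction i with
  | zero =>
    rw [textMean_tally_zero hπ pad fun c => (c.sum - c.count * g c.state) ^ 2]
    simp
  | succ i ih =>
    have h1 := textMean_tally_succ_le (L := L) (g := g) (F := fun c => (c.sum - c.count * g c.state) ^ 2)
      (e := fun z => ((z.count : ℝ) + 1) ^ 2 * c z.state) hπ hM hL pad (fun z => by
        -- The increment of `sum - count * g` is `(count + 1)` times that of `-g`, hence of mean
        -- zero. Its variance carries the factor `(count + 1) ^ 2`.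
        have h2 : (avg π fun x => ((z.count : ℝ) + 1) * (g z.state - g (M.nx n z.state x))) = 0 := by
          rw [avg_mul_left, avg_sub, avg_const hπ, hg, sub_self, mul_zero]
        have h3 := avg_add_sq hπ (z.sum - z.count * g z.state) h2
        have h4 : (fun x => ((M.tallyStep n g z x).sum - (M.tallyStep n g z x).count *
            g (M.tallyStep n g z x).state) ^ 2) = fun x => (z.sum - z.count * g z.state +
              ((z.count : ℝ) + 1) * (g z.state - g (M.nx n z.state x))) ^ 2 := by
          funext x
          simp only [tallyStep]
          push_cast
          ring
        rw [h4, h3, add_le_add_iff_left]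
        simp only [mul_pow]
        rw [avg_mul_left, avg_sub_sq hπ (hg _), hc]) i
    rw [Finset.sum_range_succ]
    refine h1.trans (add_le_add ih ?_)
    refine le_trans (le_of_eq ?_) (mul_le_mul_of_nonneg_left
      (textMean_running_le (L := L) (N := N) (g := g) hπ hM hL pad i hc0) (sq_nonneg ((i : ℝ) + 1)))
    rw [← textMean_mul_left]
    congr 1
    funext t
    split_ifs with hs
    · rw [mul_zero]
    · rw [le_pos_tally_iff] at hs
      rw [tally_of_pos_lt (not_le.mp hs)]

theorem textMean_gain (hπ : π ∈ stdSimplex ℝ (Fin s)) (hM : M.OrderLE n)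
    (hg : ∀ X, (avg π fun x => g (M.nx n X x)) = g X) (hL : L + n ≤ N) (pad : Fin s) (i : ℕ) :
    (textMean π fun t : Fin N → Fin s => g (M.tally n L g (padText pad t) i).state) =
      g (M.augInit n) := by
  induction i with
  | zero => exact textMean_tally_zero hπ pad fun c => g c.state
  | succ i ih =>
    rw [textMean_tally_succ hπ hM hL pad fun c => g c.state, ← ih]
    congr 1
    funext t
    split_ifs
    · rfl
    · exact hg _

end

/-- Positions grow at least linearly. This bounds both the time needed to reach `L` and the number
of accesses made after it. -/
theorem Valid.add_le_pos [Fintype Q] {pad : Fin s} (hV : M.Valid pad) (hM : M.OrderLE n) (hw : w ≠ [])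
    (T : ℕ → Fin s) (i k : ℕ) : (M.augTrace n T i).2 + k ≤
      (M.augTrace n T (i + Fintype.card (AugState s n Q) * k)).2 := by
  induction k with
  | zero => rfl
  | succ k ih =>
    have := hV.lt_pos hM hw T (i + Fintype.card (AugState s n Q) * k)
    rw [Nat.mul_succ, ← add_assoc, ← add_assoc]
    omega

/-- The number of accesses is close to the number of iterations needed to get near to the end. -/
theorem Valid.accesses_mem [Fintype Q] {pad : Fin s} (hV : M.Valid pad) (hM : M.OrderLE n)
    (hw : w ≠ []) (hn : w.length ≤ n + 1) {L k : ℕ} (t : Fin (L + n) → Fin s)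
    (hk : L ≤ (M.augTrace n (padText pad t) k).2)
    (hlt : ∀ j < k, (M.augTrace n (padText pad t) j).2 < L) :
    k ≤ M.accesses pad (List.ofFn t) ∧
      M.accesses pad (List.ofFn t) ≤ k + Fintype.card (AugState s n Q) * n := by
  have hm := List.length_pos_iff.mpr hw
  have hrun : ∀ i, M.Running pad (List.ofFn t) i ↔
      (M.augTrace n (padText pad t) i).2 + w.length ≤ L + n := fun i => by
    rw [running_iff (n := n), List.length_ofFn]
    rfl
  have h1 : (Finset.range k : Set ℕ) ⊆ {i | M.Running pad (List.ofFn t) i} := fun i hi => by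
    have := hlt i (by simpa using hi)
    rw [Set.mem_ofPred_eq, hrun]
    omega
  have h2 : {i | M.Running pad (List.ofFn t) i} ⊆
      (Finset.range (k + Fintype.card (AugState s n Q) * n) : Set ℕ) := fun i hi => by
    rw [Set.mem_ofPred_eq, hrun] at hi
    by_contra hik
    have h3 : k + Fintype.card (AugState s n Q) * n ≤ i := by simpa using hik
    have h4 := monotone_pos (M := M) (n := n) (padText pad t) h3
    have h5 := hV.add_le_pos hM hw (padText pad t) k n
    dsimp only at h4
    omega
  have hfin : {i | M.Running pad (List.ofFn t) i}.Finite := (Finset.finite_toSet _).subset h2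
  constructor
  · have := Set.ncard_le_ncard h1 hfin
    rwa [Set.ncard_coe_finset, Finset.card_range] at this
  · have := Set.ncard_le_ncard h2 (Finset.finite_toSet _)
    rwa [Set.ncard_coe_finset, Finset.card_range] at this

theorem augTrace_pos_succ_le {C : ℕ} (hC : ∀ q x, M.shift q x ≤ C) (T : ℕ → Fin s) (i : ℕ) :
    (M.augTrace n T (i + 1)).2 ≤ (M.augTrace n T i).2 + C :=
  Nat.add_le_add_left (hC _ _) _

theorem augTrace_pos_le {C : ℕ} (hC : ∀ q x, M.shift q x ≤ C) (T : ℕ → Fin s) (i : ℕ) :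
    (M.augTrace n T i).2 ≤ C * i := by
  induction i with
  | zero => exact le_rfl
  | succ i ih =>
    have := augTrace_pos_succ_le (n := n) hC T i
    rw [Nat.mul_succ]
    omega

theorem sq_add_add_le (a b c : ℝ) : (a + b + c) ^ 2 ≤ 3 * (a ^ 2 + b ^ 2 + c ^ 2) := by
  nlinarith [sq_nonneg (a - b), sq_nonneg (b - c), sq_nonneg (a - c)]

/-- A text length over a number of accesses is close to the gain at the end of the run. -/
theorem sq_div_sub_gain_le {L n k a C B p : ℕ} {G g h H : ℝ} (hL : 0 < L) (hLk : L ≤ C * k) (hka : k ≤ a)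
    (hak : a ≤ k + B) (hp : L ≤ p) (hp' : p ≤ L + C) (hH : |h| ≤ H) :
    (((L + n : ℕ) : ℝ) / a - g) ^ 2 ≤
      (3 * C ^ 2 * ((C + H) ^ 2 + (p + h - G) ^ 2 + (G - k * g) ^ 2) * 2 +
        2 * (C * n + C ^ 2 * B) ^ 2) / (L : ℝ) ^ 2 := by
  have hk0 : 0 < k := by
    rcases Nat.eq_zero_or_pos k with rfl | h
    · omega
    · exact h
  have hL' : (0 : ℝ) < L := by exact_mod_cast hL
  have hk' : (0 : ℝ) < k := by exact_mod_cast hk0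
  have hka' : (k : ℝ) ≤ a := by exact_mod_cast hka
  have ha' : (0 : ℝ) < a := hk'.trans_le hka'
  have hak' : (a : ℝ) ≤ k + B := by exact_mod_cast hak
  have hLk' : (L : ℝ) ≤ C * k := by exact_mod_cast hLk
  have hp1 : (L : ℝ) ≤ p := by exact_mod_cast hp
  have hp2 : (p : ℝ) ≤ L + C := by exact_mod_cast hp'
  have hC0 : (0 : ℝ) ≤ C := Nat.cast_nonneg C
  have hn0 : (0 : ℝ) ≤ n := Nat.cast_nonneg n
  have hB0 : (0 : ℝ) ≤ B := Nat.cast_nonneg B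
  have hinv : 1 / (k : ℝ) ≤ C / L := by
    rw [div_le_div_iff₀ hk' hL']
    linarith
  have hinv' : 1 / (a : ℝ) ≤ C / L := (one_div_le_one_div_of_le hk' hka').trans hinv
  have h1 : |((L + n : ℕ) : ℝ) / a - L / k| ≤ (C * n + C ^ 2 * B) / L := by
    have e1 : ((L + n : ℕ) : ℝ) / a - L / k = n * (1 / a) - L * (1 / a) * (1 / k) * (a - k) := by
      push_cast
      field_simp
      ring
    have e2 : (n : ℝ) * (1 / a) ≤ n * (C / L) := by gcongr
    have e3 : (L : ℝ) * (1 / a) * (1 / k) * (a - k) ≤ L * (C / L) * (C / L) * B := by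
      have : (a : ℝ) - k ≤ B := by linarith
      have : 0 ≤ (a : ℝ) - k := by linarith
      gcongr
    have e4 : (L : ℝ) * (C / L) * (C / L) * B = C ^ 2 * B / L := by field_simp
    have e5 : 0 ≤ (n : ℝ) * (1 / a) := by positivity
    have e6 : 0 ≤ (L : ℝ) * (1 / a) * (1 / k) * (a - k) :=
      mul_nonneg (by positivity) (by linarith)
    have e7 : 0 ≤ (C : ℝ) ^ 2 * B / L := by positivity
    have e8 : 0 ≤ (n : ℝ) * (C / L) := by positivity
    have e9 : (C * n + C ^ 2 * B) / (L : ℝ) = n * (C / L) + C ^ 2 * B / L := by ring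
    rw [e1, e9, abs_le]
    constructor <;> linarith
  have h2 : (L / k - g) ^ 2 ≤
      3 * C ^ 2 * ((C + H) ^ 2 + (p + h - G) ^ 2 + (G - k * g) ^ 2) / (L : ℝ) ^ 2 := by
    -- The error splits into the overshoot of the position with the bias, and the two martingales
    -- estimated above.
    have e1 : (L / k - g) = (1 / k) * (-(p + h - L) + (p + h - G) + (G - k * g)) := by
      field_simp
      ring
    have e2 : (-(p + h - L)) ^ 2 ≤ (C + H) ^ 2 := by
      have := abs_le.mp hH
      rw [neg_sq]
      exact sq_le_sq' (by linarith) (by linarith)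
    have e3 := sq_add_add_le (-(p + h - L)) (p + h - G) (G - k * g)
    have e4 : (1 / (k : ℝ)) ^ 2 ≤ (C / L) ^ 2 := by gcongr
    calc (L / k - g) ^ 2 = (1 / (k : ℝ)) ^ 2 * (-(p + h - L) + (p + h - G) + (G - k * g)) ^ 2 := by
          rw [e1, mul_pow]
      _ ≤ (C / L) ^ 2 * (3 * ((C + H) ^ 2 + (p + h - G) ^ 2 + (G - k * g) ^ 2)) := by
          refine mul_le_mul e4 (e3.trans ?_) (sq_nonneg _) (sq_nonneg _)
          linarith
      _ = _ := by ring
  have h3 : (((L + n : ℕ) : ℝ) / a - L / k) ^ 2 ≤ (C * n + C ^ 2 * B) ^ 2 / (L : ℝ) ^ 2 := by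
    rw [← div_pow, ← sq_abs]
    exact pow_le_pow_left₀ (abs_nonneg _) h1 2
  have h4 : (((L + n : ℕ) : ℝ) / a - g) ^ 2 ≤
      2 * (((L + n : ℕ) : ℝ) / a - L / k) ^ 2 + 2 * (L / k - g) ^ 2 := by
    nlinarith [sq_nonneg ((((L + n : ℕ) : ℝ) / a - L / k) - (L / k - g))]
  rw [add_div, mul_div_right_comm _ (2 : ℝ), mul_div_assoc (2 : ℝ)]
  linarith

/-- The asymptotic speed of a valid machine is its mean gain. -/
theorem Valid.hasSpeed [Fintype Q] {pad : Fin s} (hV : M.Valid pad) (hM : M.OrderLE n) (hw : w ≠ [])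
    (hn : w.length ≤ n + 1) {π : Fin s → ℝ} (hπ : π ∈ stdSimplex ℝ (Fin s))
    {g h : AugState s n Q → ℝ} (hg : ∀ X, (avg π fun x => g (M.nx n X x)) = g X)
    (hr : ∀ X, (avg π fun x => (M.sh n X x : ℝ)) + (avg π fun x => h (M.nx n X x)) = g X + h X) :
    M.HasSpeed pad π (g (M.augInit n)) := by
  obtain ⟨C, hC⟩ : ∃ C : ℕ, ∀ q x, M.shift q x ≤ C := by
    obtain ⟨C, hC⟩ := (Set.finite_range fun c : Q × Fin s => M.shift c.1 c.2).bddAbove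
    exact ⟨C, fun q x => hC ⟨(q, x), rfl⟩⟩
  obtain ⟨H, -, hH⟩ := exists_bound h
  obtain ⟨C₁, D₁, -, h1⟩ := textMean_sq_pos_sub_sum_le hπ hM hr
  set c : AugState s n Q → ℝ := fun X => (avg π fun x => g (M.nx n X x) ^ 2) - g X ^ 2 with hc
  have hc0 : ∀ X, 0 ≤ c X := fun X => by
    have := avg_sub_sq hπ (hg X)
    rw [hc]
    dsimp only
    rw [← this]
    exact const_le_avg hπ fun x => sq_nonneg _
  set S := Fintype.card (AugState s n Q) with hS
  have hS0 : 0 < S := Fintype.card_pos_iff.mpr ⟨M.augInit n⟩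
  -- The bound on the second martingale. It is of smaller order than the square of the number of
  -- iterations, since the variances of `g` are summable along the chain.
  set V : ℕ → ℝ := fun k =>
    ∑ j ∈ Finset.range k, ((j : ℝ) + 1) ^ 2 * (stepMean π (M.nx n) ^ j) c (M.augInit n) with hVdef
  have hlim : Tendsto (fun L : ℕ => V (S * L) / (L : ℝ) ^ 2) atTop (𝓝 0) := by
    have e1 := (tendsto_sum_sq_mul_div_sq (summable_variance (c := c) hπ (fun _ => rfl) hc0 (M.augInit n))
      (fun j => le_stepMean_pow hπ hc0 j _)).comp (tendsto_id.const_mul_atTop' hS0)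
    have e2 := e1.const_mul ((S : ℝ) ^ 2)
    rw [mul_zero] at e2
    refine e2.congr fun L => ?_
    have : (S : ℝ) ≠ 0 := by exact_mod_cast hS0.ne'
    simp only [Function.comp, hVdef, id]
    push_cast
    rw [mul_pow]
    field_simp
  set A : ℝ := 3 * C ^ 2 * ((C + H) ^ 2 + D₁) * 2 + 2 * (C * n + C ^ 2 * (S * n : ℕ)) ^ 2 with hA
  have hmain : ∀ L : ℕ, 0 < L → (textMean π (fun t : Fin (L + n) → Fin s =>
      ((L + n : ℕ) : ℝ) / (M.accesses pad (List.ofFn t) : ℝ)) - g (M.augInit n)) ^ 2 ≤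
      A / (L : ℝ) ^ 2 + 6 * C ^ 2 * S * C₁ / L + 6 * C ^ 2 * (V (S * L) / (L : ℝ) ^ 2) := by
    intro L hL
    -- After `S * L` iterations every run has stopped, and `g` still has its initial mean. By
    -- `sq_textMean_le` it suffices to compare the ratio with the gain at the stopped state, in mean
    -- square.
    rw [← textMean_gain hπ hM hg (le_refl (L + n)) pad (S * L), ← textMean_sub]
    refine (sq_textMean_le hπ _).trans ?_
    have e1 := h1 (le_refl (L + n)) pad (S * L)
    have e2 := textMean_sq_sum_sub_mul_le hπ hM hg (fun _ => rfl) hc0 (le_refl (L + n)) pad (S * L)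
    refine (textMean_mono (g := fun t : Fin (L + n) → Fin s => (6 * C ^ 2 / (L : ℝ) ^ 2) *
      (((M.tally n L g (padText pad t) (S * L)).pos +
        h (M.tally n L g (padText pad t) (S * L)).state - (M.tally n L g (padText pad t) (S * L)).sum) ^ 2
      + ((M.tally n L g (padText pad t) (S * L)).sum - (M.tally n L g (padText pad t) (S * L)).count *
        g (M.tally n L g (padText pad t) (S * L)).state) ^ 2) +
      (6 * C ^ 2 * (C + H) ^ 2 + 2 * (C * n + C ^ 2 * (S * n : ℕ)) ^ 2) / (L : ℝ) ^ 2) hπ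
      fun t => ?_).trans ?_
    · have e3 : L ≤ (M.augTrace n (padText pad t) (S * L)).2 := by
        have := hV.add_le_pos hM hw (padText pad t) 0 L
        rw [zero_add] at this
        exact (Nat.le_add_left _ _).trans this
      obtain ⟨k, -, hk, hlt, hta⟩ := exists_tally_of_le (g := g) e3
      rw [hta]
      dsimp only
      obtain ⟨ha1, ha2⟩ := hV.accesses_mem hM hw hn t hk hlt
      have e4 := augTrace_pos_le (n := n) hC (padText pad t) k
      have e5 : (M.augTrace n (padText pad t) k).2 ≤ L + C := by
        rcases k with _ | k
        · exact Nat.zero_le _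
        · have := augTrace_pos_succ_le (n := n) hC (padText pad t) k
          have := hlt k (Nat.lt_succ_self k)
          omega
      refine (sq_div_sub_gain_le (G := ∑ j ∈ Finset.range k, g (M.augTrace n (padText pad t) j).1)
        hL (hk.trans e4) ha1 ha2 hk e5 (hH (M.augTrace n (padText pad t) k).1)).trans_eq ?_
      ring
    · rw [textMean_add, textMean_mul_left, textMean_add, textMean_const hπ]
      have e3 : 0 ≤ 6 * (C : ℝ) ^ 2 / (L : ℝ) ^ 2 := by positivity
      refine (add_le_add_left (mul_le_mul_of_nonneg_left (add_le_add e1 e2) e3) _).trans_eq ?_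
      have hL' : (L : ℝ) ≠ 0 := by exact_mod_cast hL.ne'
      rw [hA]
      push_cast
      field_simp
      ring
  have hzero : Tendsto (fun L : ℕ => A / (L : ℝ) ^ 2 + 6 * C ^ 2 * S * C₁ / L +
      6 * C ^ 2 * (V (S * L) / (L : ℝ) ^ 2)) atTop (𝓝 0) := by
    have e1 : Tendsto (fun L : ℕ => A / (L : ℝ) ^ 2) atTop (𝓝 0) :=
      ((tendsto_pow_atTop (by norm_num)).comp tendsto_natCast_atTop_atTop).const_div_atTop A
    have e2 : Tendsto (fun L : ℕ => 6 * (C : ℝ) ^ 2 * S * C₁ / L) atTop (𝓝 0) :=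
      tendsto_natCast_atTop_atTop.const_div_atTop _
    simpa using (e1.add e2).add (hlim.const_mul (6 * (C : ℝ) ^ 2))
  have hsq : Tendsto (fun L : ℕ => (textMean π (fun t : Fin (L + n) → Fin s =>
      ((L + n : ℕ) : ℝ) / (M.accesses pad (List.ofFn t) : ℝ)) - g (M.augInit n)) ^ 2) atTop (𝓝 0) := by
    refine squeeze_zero' (.of_forall fun _ => sq_nonneg _) ?_ hzero
    filter_upwards [eventually_gt_atTop 0] with L hL using hmain L hL
  have habs := (Real.continuous_sqrt.tendsto 0).comp hsq
  rw [Real.sqrt_zero] at habs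
  unfold HasSpeed
  -- Texts of length `L + n` leave room for every letter read while the position is below `L`.
  rw [← tendsto_add_atTop_iff_nat n, tendsto_iff_norm_sub_tendsto_zero]
  refine habs.congr fun L => ?_
  rw [Function.comp, Real.sqrt_sq_eq_abs]
  rfl

end MatchingMachine
end PatternMatching

namespace PatternMatching

/-! ### The gain of a valid machine is at most the optimal gain -/

theorem hat_of_forall_not_live {s : ℕ} (hs : 0 < s) {w : List ℕ} (f : ℕ → ℝ) (k : ℕ) {K : ℕ}
    (h : ∀ j < k, ¬ Live s w (K / (s + 1) ^ j)) : hat s w f K = k + hat s w f (K / (s + 1) ^ k) := by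
  induction k with
  | zero => simp
  | succ k ih =>
    rw [ih fun j hj => h j (by omega), hat_of_not_live hs f (h k (Nat.lt_succ_self k)), Nat.div_div_eq_div_mul,
      ← pow_succ]
    push_cast
    ring

namespace OptimalStrategy

variable {s : ℕ} {w : List ℕ} {n : ℕ} {π : Fin s → ℝ} {σ : ℕ → ℕ} {g : ℝ} {h : ℕ → ℝ}

theorem hat_le_of_full (hs : 0 < s) (H : OptimalStrategy w n π σ g h) {K : ℕ}
    (hK : K < (s + 1) ^ (n + 1)) (hf : Full s w K) : hat s w h K ≤ 1 + hat s w h (K / (s + 1)) := by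
  rw [hat_of_live hs h hf.live]
  exact H.le_skip K hK hf

theorem hat_rd_le_after (hs : 0 < s) (H : OptimalStrategy w n π σ g h) {K i : ℕ}
    (hK : K < (s + 1) ^ (n + 1)) (hi : i ≤ n) (x : Fin s) :
    hat s w h (rd s K i x) ≤ after s w h K i x := by
  unfold after
  split_ifs with hp
  · exact H.hat_le_of_full hs (rd_lt x.2 hK hi) hp.2
  · exact le_rfl

/-- A free letter is worth the gain of one reading at most. -/
theorem avg_hat_rd_le (hs : 0 < s) (hπ : π ∈ stdSimplex ℝ (Fin s)) (H : OptimalStrategy w n π σ g h)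
    {K : ℕ} (hK : K < (s + 1) ^ (n + 1)) : ∀ i ≤ n,
    (avg π fun x => hat s w h (rd s K i x)) ≤ hat s w h K + g := by
  induction K using Nat.strong_induction_on with
  | _ K ih =>
    intro i hi
    by_cases hl : Live s w K
    · rw [hat_of_live hs _ hl]
      have := avg_mono hπ fun x => H.hat_rd_le_after hs hK hi x
      linarith [H.avg_le K hK hl i hi]
    · rw [avg_hat_rd_of_not_live hs hπ _ hl, hat_of_not_live hs _ hl]
      have := avg_hat_rd_div (w := w) (K := K) (c := n) (f := h)
        (P := fun r => r ≤ hat s w h (K / (s + 1)) + g) hπ hi (by linarith [H.gain_nonneg])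
        (ih _ (div_lt_self_of_not_live hs hl) (div_lt_window hK))
      linarith

theorem avg_hat_rd_div_le (hs : 0 < s) (hπ : π ∈ stdSimplex ℝ (Fin s))
    (H : OptimalStrategy w n π σ g h) {K i : ℕ} (hK : K < (s + 1) ^ (n + 1)) (hi : i ≤ n) :
    (avg π fun x => hat s w h (rd s K i x / (s + 1))) ≤ hat s w h (K / (s + 1)) + g :=
  avg_hat_rd_div (w := w) (K := K) (c := n) (f := h)
    (P := fun r => r ≤ hat s w h (K / (s + 1)) + g) hπ hi (by linarith [H.gain_nonneg])
    (H.avg_hat_rd_le hs hπ (div_lt_window hK))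

/-- With one letter, the knowledge `2 ^ m - 1` has `m = |w| - 1` known letters. Reading at the
offset `m` prints, advances by one and restores the same knowledge, so the optimality inequality
there gives the bound. -/
theorem one_le_gain {w : List ℕ} {π : Fin 1 → ℝ} (hπ : π ∈ stdSimplex ℝ (Fin 1))
    (H : OptimalStrategy w n π σ g h) (hw : w ≠ []) (hw0 : ∀ j < w.length, w.getD j 0 = 0)
    (hn : w.length ≤ n + 1) : 1 ≤ g := by
  obtain ⟨m, hm⟩ : ∃ m, w.length = m + 1 := ⟨_, (Nat.succ_pred_eq_of_pos (List.length_pos_iff.mpr hw)).symm⟩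
  have hdig : ∀ j < m, dig 1 (2 ^ m - 1) j = 1 := fun j hj => by
    have h1 := Nat.testBit_two_pow_sub_one m j
    rw [Nat.testBit_eq_decide_div_mod_eq] at h1
    simpa [hj, dig] using h1
  have hpow : 0 < 2 ^ m := by positivity
  have hdig0 : dig 1 (2 ^ m - 1) m = 0 := dig_of_lt (by norm_num)
  have hrd : rd 1 (2 ^ m - 1) m 0 = 2 ^ m - 1 + 2 ^ m := by simp [rd, hdig0]
  have hlive : Live 1 w (2 ^ m - 1) := fun j hj => by
    rcases (show j < m ∨ j = m by omega) with hj' | rfl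
    · exact Or.inr (by rw [hdig j hj', hw0 j hj])
    · exact Or.inl hdig0
  have hfull : Full 1 w (rd 1 (2 ^ m - 1) m 0) := fun j hj => by
    rcases (show j < m ∨ j = m by omega) with hj' | rfl
    · rw [dig_rd_of_ne (by omega) (by omega), hdig j hj', hw0 j hj]
    · rw [dig_rd_self (by omega) hdig0, hw0 j hj]
  have hK : 2 ^ m - 1 < (1 + 1) ^ (n + 1) := by
    have : 2 ^ m ≤ 2 ^ (n + 1) := Nat.pow_le_pow_right (by omega) (by omega)
    norm_num
    omega
  have h1 := H.avg_le _ hK hlive m (by omega)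
  have h2 : (fun x : Fin 1 => after 1 w h (2 ^ m - 1) m x) = fun _ => 1 + h (2 ^ m - 1) := by
    funext x
    obtain rfl : x = 0 := Subsingleton.elim _ _
    rw [after, if_pos ⟨by omega, hfull⟩, Fin.val_zero, hrd,
      show (2 ^ m - 1 + 2 ^ m) / (1 + 1) = 2 ^ m - 1 by omega, hat_of_live one_pos h hlive]
  rw [h2, avg_const hπ] at h1
  linarith

end OptimalStrategy

namespace MatchingMachine

variable {s : ℕ} {Q : Type*} {w : List (Fin s)} {M : MatchingMachine (Fin s) Q w} {n : ℕ}

/-- The states of the machine with memory which are reached on some text. -/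
def reached (M : MatchingMachine (Fin s) Q w) (n : ℕ) : Set (AugState s n Q) :=
  {X | ∃ T i, (M.augTrace n T i).1 = X}

theorem augInit_mem_reached (x : Fin s) : M.augInit n ∈ M.reached n := ⟨fun _ => x, 0, rfl⟩

/-- In a reached state, any letter may come next if it is unknown. -/
theorem exists_augLetter (hM : M.OrderLE n) {X : AugState s n Q} (hX : X ∈ M.reached n) (x : Fin s) :
    ∃ T i, (M.augTrace n T i).1 = X ∧ M.augLetter n T i = M.known n X x := by
  obtain ⟨T, i, rfl⟩ := hX
  by_cases h : dig s (M.augTrace n T i).1.2.1 (M.next (M.augTrace n T i).1.1) = 0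
  · set u := (M.augTrace n T i).2 + M.next (M.augTrace n T i).1.1 with hu
    have h1 := (augTrace_congr hM (T := T) (T' := Function.update T u x) i
      (fun v hv => Function.update_of_ne (by omega) _ _) (fun j hj => Function.update_of_ne (by
        intro h'
        obtain rfl : j = _ := Nat.add_left_cancel h'
        exact hj h) _ _) i le_rfl).1
    refine ⟨Function.update T u x, i, by rw [h1], ?_⟩
    rw [augLetter, h1, known, dif_pos h, ← hu, Function.update_self]
  · refine ⟨T, i, rfl, ?_⟩
    rw [← known_augTrace hM T i, known, known, dif_neg h, dif_neg h]

theorem nx_mem_reached (hM : M.OrderLE n) {X : AugState s n Q} (hX : X ∈ M.reached n) (x : Fin s) :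
    M.nx n X x ∈ M.reached n := by
  obtain ⟨T, i, rfl, hx⟩ := exists_augLetter hM hX x
  exact ⟨T, i + 1, by rw [augTrace_succ, nx, hx]⟩

theorem learn_known (X : AugState s n Q) (x : Fin s) :
    M.learn n X (M.known n X x) = rd s X.2.1 (M.next X.1) x := by
  by_cases h : dig s X.2.1 (M.next X.1) = 0
  · rw [learn, known, dif_pos h]
  · rw [learn, rd_known h, rd_known h]

theorem Valid.not_live_of_reached {pad : Fin s} (hV : M.Valid pad) (hM : M.OrderLE n)
    {X : AugState s n Q} (hX : X ∈ M.reached n) (x : Fin s) {k : ℕ} (hk : k < M.sh n X x)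
    (h0 : k = 0 → M.printed n X (M.known n X x) = false) :
    ¬ Live s (w.map Fin.val) (rd s X.2.1 (M.next X.1) x / (s + 1) ^ k) := by
  obtain ⟨T, i, rfl, hx⟩ := exists_augLetter hM hX x
  have := hV.not_live_of_lt_shift hM T i (k := k)
  rw [hx, learn_known] at this
  exact this hk h0

theorem Valid.full_of_reached (hs : 1 < s) {pad : Fin s} (hV : M.Valid pad) (hM : M.OrderLE n)
    {X : AugState s n Q} (hX : X ∈ M.reached n) (x : Fin s)
    (h : M.printed n X (M.known n X x) = true) :
    Full s (w.map Fin.val) (rd s X.2.1 (M.next X.1) x) := by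
  obtain ⟨T, i, rfl, hx⟩ := exists_augLetter hM hX x
  have := hV.full_of_printed hs hM T i
  rw [hx, learn_known] at this
  exact this h

/-- The reward and the potential at the new state add up to a quantity which ignores how far the
machine shifted: the positions it skips are dead, except a printed first one, and `hat` counts each
of them as one anyway. Machines that shift late are thus covered. -/
theorem sh_add_hat (hs : 1 < s) {pad : Fin s} (hV : M.Valid pad) (hM : M.OrderLE n)
    {X : AugState s n Q} (hX : X ∈ M.reached n) (x : Fin s) (h : ℕ → ℝ) :
    (M.sh n X x : ℝ) + (if (M.nx n X x).2.2 = true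
        then 1 + hat s (w.map Fin.val) h ((M.nx n X x).2.1 / (s + 1))
        else hat s (w.map Fin.val) h (M.nx n X x).2.1) =
      if M.printed n X (M.known n X x) = true
        then 1 + hat s (w.map Fin.val) h (rd s X.2.1 (M.next X.1) x / (s + 1))
        else hat s (w.map Fin.val) h (rd s X.2.1 (M.next X.1) x) := by
  have hdead := fun k => hV.not_live_of_reached hM hX x (k := k)
  have e1 : ((M.nx n X x).2.1 : ℕ) = rd s X.2.1 (M.next X.1) x / (s + 1) ^ M.sh n X x := by
    rw [nx, augStep_knowledge hM, learn_known, sh]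
  have e2 : (M.nx n X x).2.2 = true ↔ M.sh n X x = 0 ∧ M.printed n X (M.known n X x) = true := by
    rw [nx, augStep_flag, sh]
  generalize M.sh n X x = k at *
  rcases Nat.eq_zero_or_pos k with h0 | h0
  · simp only [e2, e1]
    simp [h0]
  · rw [if_neg (by rw [e2]; omega), e1]
    split_ifs with hp
    · obtain ⟨k', rfl⟩ : ∃ k', k = k' + 1 := ⟨k - 1, by omega⟩
      rw [hat_of_forall_not_live (by omega) h k' (K := rd s X.2.1 (M.next X.1) x / (s + 1)) fun j hj => by
        rw [Nat.div_div_eq_div_mul, ← pow_succ']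
        exact hdead (j + 1) (by omega) (by omega), Nat.div_div_eq_div_mul, ← pow_succ']
      push_cast
      ring
    · rw [hat_of_forall_not_live (by omega) h k fun j hj => hdead j hj fun _ => by simpa using hp]

theorem isMatch_lt {q : Q} {x : Fin s} (h : M.IsMatch q x) : M.next q < (w.map Fin.val).length := by
  rw [List.length_map]
  exact M.next_lt q h.1

/-- The gain of a valid machine is at most the optimal gain, with two letters at least. -/
theorem Valid.gain_le (hs : 1 < s) {pad : Fin s} [Finite Q] (hV : M.Valid pad) (hM : M.OrderLE n)
    {π : Fin s → ℝ} (hπ : π ∈ stdSimplex ℝ (Fin s))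
    {gM hM' : AugState s n Q → ℝ} (hg : ∀ X, (avg π fun x => gM (M.nx n X x)) = gM X)
    (hr : ∀ X, (avg π fun x => (M.sh n X x : ℝ)) + (avg π fun x => hM' (M.nx n X x)) = gM X + hM' X)
    {σ : ℕ → ℕ} {g : ℝ} {h : ℕ → ℝ} (H : OptimalStrategy (w.map Fin.val) n π σ g h) :
    gM (M.augInit n) ≤ g := by
  have hs0 : 0 < s := by omega
  -- A position which was printed but not yet left is worth one shift plus the value of the shifted
  -- knowledge.
  refine gain_le_of_superharmonic (φ := fun X : AugState s n Q => if X.2.2 = true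
      then 1 + hat s (w.map Fin.val) h (X.2.1 / (s + 1)) else hat s (w.map Fin.val) h X.2.1)
    hπ hg hr (R := M.reached n) (fun X hX x => nx_mem_reached hM hX x) (fun X hX => ?_) _
    (augInit_mem_reached pad)
  rw [← avg_add]
  simp only [sh_add_hat hs hV hM hX]
  have hK : (X.2.1 : ℕ) < (s + 1) ^ (n + 1) := X.2.1.2
  have hi := hM X.1
  by_cases hflag : X.2.2 = true
  · have hp : ∀ x, M.printed n X (M.known n X x) = true := fun x => printed_eq_true.mpr (Or.inl hflag)
    simp only [hp, hflag, if_true]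
    rw [avg_const_add hπ]
    linarith [H.avg_hat_rd_div_le hs0 hπ hK hi]
  · rw [if_neg hflag]
    have hp : ∀ x, M.printed n X (M.known n X x) = true → Prints s (w.map Fin.val) X.2.1 (M.next X.1) x :=
      fun x hx => ⟨isMatch_lt ((printed_eq_true.mp hx).resolve_left hflag),
        hV.full_of_reached hs hM hX x hx⟩
    by_cases hl : Live s (w.map Fin.val) X.2.1
    · rw [hat_of_live hs0 _ hl, add_comm (h _)]
      refine le_trans (avg_mono hπ fun x => ?_) (H.avg_le _ hK hl _ hi)
      split_ifs with hx
      · rw [after, if_pos (hp x hx)]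
      · exact H.hat_rd_le_after hs0 hK hi x
    · have hx : ∀ x, ¬ M.printed n X (M.known n X x) = true := fun x hx =>
        hl ((hp x hx).2.live.of_rd x.2)
      simp only [hx]
      exact H.avg_hat_rd_le hs0 hπ hK _ hi

theorem live_of_subsingleton {w : List (Fin 1)} (K : ℕ) : Live 1 (w.map Fin.val) K := fun j hj => by
  rw [List.length_map] at hj
  rw [getD_map_val w hj]
  have := dig_le 1 K j
  omega

/-- The gain of a valid machine is at most one, with one letter. -/
theorem Valid.gain_le_one {w : List (Fin 1)} {M : MatchingMachine (Fin 1) Q w} {pad : Fin 1} [Finite Q]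
    (hV : M.Valid pad) (hM : M.OrderLE n) {π : Fin 1 → ℝ} (hπ : π ∈ stdSimplex ℝ (Fin 1))
    {gM hM' : AugState 1 n Q → ℝ} (hg : ∀ X, (avg π fun x => gM (M.nx n X x)) = gM X)
    (hr : ∀ X, (avg π fun x => (M.sh n X x : ℝ)) + (avg π fun x => hM' (M.nx n X x)) = gM X + hM' X) :
    gM (M.augInit n) ≤ 1 := by
  refine gain_le_of_superharmonic (φ := fun _ => 0) hπ hg hr (R := M.reached n)
    (fun X hX x => nx_mem_reached hM hX x) (fun X hX => ?_) _ (augInit_mem_reached pad)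
  rw [avg_const hπ, add_zero, zero_add]
  refine avg_le_const hπ fun x => ?_
  -- With one letter every knowledge is live, so no position but the current one can ever be
  -- skipped. Knowledge of the printed occurrences, which may fail in this case, is not needed.
  have h : M.sh n X x ≤ 1 := by
    by_contra! hlt
    exact hV.not_live_of_reached hM hX x hlt (by omega) (live_of_subsingleton _)
  exact_mod_cast h

/-- The speed of a valid machine is at most the optimal gain. -/
theorem Valid.exists_hasSpeed_le [Fintype Q] {pad : Fin s} (hV : M.Valid pad) (hM : M.OrderLE n)
    (hw : w ≠ []) (hn : w.length ≤ n + 1) {π : Fin s → ℝ} (hπ : π ∈ stdSimplex ℝ (Fin s))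
    {σ : ℕ → ℕ} {g : ℝ} {h : ℕ → ℝ} (H : OptimalStrategy (w.map Fin.val) n π σ g h) :
    ∃ v, M.HasSpeed pad π v ∧ v ≤ g := by
  obtain ⟨gM, hM', hg, hr⟩ := exists_poisson hπ (M.nx n) fun X => avg π fun x => (M.sh n X x : ℝ)
  refine ⟨gM (M.augInit n), hV.hasSpeed hM hw hn hπ hg hr, ?_⟩
  rcases (show 1 < s ∨ s = 1 by have := pad.2; omega) with hs | rfl
  · exact hV.gain_le hs hM hπ hg hr H
  · exact (hV.gain_le_one hM hπ hg hr).trans (H.one_le_gain hπ (by simpa using hw)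
      (fun j hj => by rw [getD_map_val w (by simpa using hj)]; omega) (by simpa using hn))

end MatchingMachine
end PatternMatching

namespace PatternMatching

/-! ### The machine of a strategy -/

theorem target_eq (s : ℕ) (w : List ℕ) (K i x : ℕ) :
    target s w K i x = rd s K i x / (s + 1) ^ advance s w K i x := by
  unfold target advance norm
  split_ifs
  · rw [Nat.div_div_eq_div_mul, ← pow_succ', add_comm 1 (skip _ _ _)]
  · rfl

theorem target_congr {s : ℕ} (w : List ℕ) {K i x y : ℕ} (h : rd s K i x = rd s K i y) :
    target s w K i x = target s w K i y := by
  simp only [target, Prints, h]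

theorem advance_congr {s : ℕ} (w : List ℕ) {K i x y : ℕ} (h : rd s K i x = rd s K i y) :
    advance s w K i x = advance s w K i y := by
  simp only [advance, Prints, h]

/-- No occurrence is compatible with the skipped offsets, except for an occurrence which is printed. -/
theorem not_live_of_lt_advance {s : ℕ} (hs : 0 < s) {w : List ℕ} {K i x k : ℕ}
    (hk : k < advance s w K i x) (h : k = 0 → ¬ Prints s w K i x) :
    ¬ Live s w (rd s K i x / (s + 1) ^ k) := by
  unfold advance at hk
  split_ifs at hk with hp
  · obtain ⟨k, rfl⟩ : ∃ k', k = k' + 1 := ⟨k - 1, by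
      have : k ≠ 0 := fun h0 => h h0 hp
      omega⟩
    rw [pow_succ', ← Nat.div_div_eq_div_mul]
    exact (skip_spec hs w _).2 k (by omega)
  · exact (skip_spec hs w _).2 k hk

/-- A useful reading at a known offset prints and hence advances. Without advance the letter is
therefore new, and the code of the knowledge increases; this gives termination at each position. -/
theorem lt_target_of_advance_eq_zero {s : ℕ} {w : List ℕ} {K i x : ℕ} (hx : x < s)
    (hu : Useful s w K i) (h : advance s w K i x = 0) : K < target s w K i x := by
  rw [target_eq, h, pow_zero, Nat.div_one]
  rcases hu with hu | ⟨hi, hf⟩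
  · exact lt_rd hu x
  · rw [advance, if_pos ⟨hi, hf.rd hx⟩] at h
    omega

/-- This identifies printing with a match transition from a pre-match state: live knowledge of all
the other offsets agrees with `w`, so only the letter at `i` remains to be tested. -/
theorem prints_iff {s : ℕ} {w : List ℕ} {K i x : ℕ} (hx : x < s) (hK : Live s w K)
    (hd : dig s (rd s K i x) i = x + 1) : Prints s w K i x ↔
      AllButOne s w K i ∧ w.getD i 0 = x := by
  constructor
  · rintro ⟨hi, hf⟩
    refine ⟨⟨hi, fun j hj => ?_⟩, ?_⟩
    · by_contra! h
      have := hf j hj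
      rw [dig_rd_of_ne hx h.1, h.2] at this
      omega
    · have := hf i hi
      omega
  · rintro ⟨⟨hi, hj⟩, hwx⟩
    refine ⟨hi, fun j hjm => ?_⟩
    by_cases hji : j = i
    · rw [hji, hd, hwx]
    · rw [dig_rd_of_ne hx hji]
      exact (hK j hjm).resolve_left ((hj j hjm).resolve_left hji)

/-- The machine with the strategy `σ`, with the states `L` and a sink. -/
def strategyMachine {s : ℕ} (w : List (Fin s)) (σ L : List ℕ) :
    MatchingMachine (Fin s) (Fin (L.length + 1)) w where
  init := 0
  sink := Fin.last _
  prematch := {q | (q : ℕ) < L.length ∧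
    AllButOne s (w.map Fin.val) (L.getD q 0) (σ.getD (L.getD q 0) 0)}
  next q := if (q : ℕ) < L.length then σ.getD (L.getD q 0) 0 else 0
  trans q x := if (q : ℕ) < L.length
    then ⟨L.idxOf (target s (w.map Fin.val) (L.getD q 0) (σ.getD (L.getD q 0) 0) x),
      Nat.lt_succ_of_le List.idxOf_le_length⟩ else Fin.last _
  shift q x := if (q : ℕ) < L.length
    then advance s (w.map Fin.val) (L.getD q 0) (σ.getD (L.getD q 0) 0) x else 0
  next_lt q hq := by
    have h := (Finset.mem_filter.mp hq).2
    rw [if_pos h.1, ← List.length_map (f := Fin.val)]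
    exact h.2.1
  trans_sink x := by simp
  shift_sink x := by simp

section
variable {s : ℕ} {w : List (Fin s)} {σ L : List ℕ} {q : Fin (L.length + 1)}

theorem strategyMachine_next (hq : (q : ℕ) < L.length) :
    (strategyMachine w σ L).next q = σ.getD (L.getD q 0) 0 := if_pos hq

theorem strategyMachine_shift (hq : (q : ℕ) < L.length) (x : Fin s) :
    (strategyMachine w σ L).shift q x =
      advance s (w.map Fin.val) (L.getD q 0) (σ.getD (L.getD q 0) 0) x := if_pos hq

theorem strategyMachine_trans (hq : (q : ℕ) < L.length) (x : Fin s) :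
    ((strategyMachine w σ L).trans q x : ℕ) =
      L.idxOf (target s (w.map Fin.val) (L.getD q 0) (σ.getD (L.getD q 0) 0) x) := by
  simp only [strategyMachine, if_pos hq]

end

theorem map_range_eq_ofFn {α : Type*} (s : ℕ) (f : ℕ → α) :
    (List.range s).map f = List.ofFn fun x : Fin s => f x :=
  List.ext_getElem (by simp) fun i h1 h2 => by simp

theorem code_strategyMachine {s : ℕ} (w : List (Fin s)) (σ L : List ℕ) :
    (strategyMachine w σ L).code = strategyCode s (w.map Fin.val) σ L := by
  unfold MatchingMachine.code strategyCode
  refine Prod.ext rfl (Prod.ext rfl ?_)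
  dsimp only
  simp only [map_range_eq_ofFn]
  refine List.ext_getElem (by simp) fun i h1 h2 => ?_
  rw [List.getElem_ofFn]
  have hi : i < L.length + 1 := by simpa using h1
  rcases Nat.lt_succ_iff_lt_or_eq.mp hi with hi | rfl
  · rw [List.getElem_append_left (by simpa using hi), List.getElem_map]
    simp [strategyMachine, hi]
  · rw [List.getElem_append_right (by simp)]
    simp [strategyMachine]

namespace MatchingMachine

variable {s : ℕ} {w : List (Fin s)} {σ L : List ℕ} {n : ℕ} {π : Fin s → ℝ} {g : ℝ} {h : ℕ → ℝ}

/-- By induction along the order of discovery, since targets are normalised to live knowledge and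
stay in the window. -/
theorem live_label (hs : 0 < s) (hL : Explores s (w.map Fin.val) σ L)
    (H : OptimalStrategy (w.map Fin.val) n π (fun K => σ.getD K 0) g h) {q : ℕ} (hq : q < L.length) :
    L.getD q 0 < (s + 1) ^ (n + 1) ∧ Live s (w.map Fin.val) (L.getD q 0) := by
  induction q using Nat.strong_induction_on with
  | _ q ih =>
    rcases hL.2.2.2 q hq with rfl | ⟨q', hq', x, hx, he⟩
    · have h0 : L.getD 0 0 = 0 := by
        have := hL.1
        rw [List.head?_eq_getElem?] at this
        rw [List.getD_eq_getElem?_getD, this]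
        rfl
      rw [h0]
      exact ⟨by positivity, live_zero s _⟩
    · obtain ⟨h1, h2⟩ := ih q' hq' (hq'.trans hq)
      rw [← he]
      exact ⟨target_lt _ hx h1 (H.le _ h1 h2), live_target hs _ _ _ _⟩

theorem orderLE_strategyMachine (hs : 0 < s) (hL : Explores s (w.map Fin.val) σ L)
    (H : OptimalStrategy (w.map Fin.val) n π (fun K => σ.getD K 0) g h) :
    (strategyMachine w σ L).OrderLE n := fun q => by
  dsimp only [strategyMachine]
  split_ifs with hq
  · obtain ⟨h1, h2⟩ := live_label hs hL H hq
    exact H.le _ h1 h2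
  · exact Nat.zero_le _

/-- The states of the machine of a strategy are labelled by its knowledge. -/
theorem label_of_reached (hs : 0 < s) (hL : Explores s (w.map Fin.val) σ L)
    (H : OptimalStrategy (w.map Fin.val) n π (fun K => σ.getD K 0) g h) (T : ℕ → Fin s) (i : ℕ) :
    (((strategyMachine w σ L).augTrace n T i).1.1 : ℕ) < L.length ∧
      (((strategyMachine w σ L).augTrace n T i).1.2.1 : ℕ) =
        L.getD ((strategyMachine w σ L).augTrace n T i).1.1 0 := by
  induction i with
  | zero =>
    have h0 := hL.1
    rw [List.head?_eq_getElem?] at h0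
    refine ⟨(List.getElem?_eq_some_iff.mp h0).1, ?_⟩
    change 0 = L.getD 0 0
    rw [List.getD_eq_getElem?_getD, h0]
    rfl
  | succ i ih =>
    obtain ⟨h1, h2⟩ := ih
    have h3 := hL.2.2.1 _ h1 _
      ((strategyMachine w σ L).augLetter n T i).2
    rw [augTrace_succ]
    dsimp only
    rw [augStep_knowledge (orderLE_strategyMachine hs hL H), learn, h2, strategyMachine_next h1,
      strategyMachine_shift h1, augStep]
    dsimp only
    rw [strategyMachine_trans h1, List.getD_eq_getElem _ _ h3, List.getElem_idxOf, ← target_eq]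
    exact ⟨h3, rfl⟩

/-- The steps of the machine of a strategy. -/
theorem strategyMachine_step (hs : 0 < s) (hL : Explores s (w.map Fin.val) σ L)
    (H : OptimalStrategy (w.map Fin.val) n π (fun K => σ.getD K 0) g h)
    {X : AugState s n (Fin (L.length + 1))} (hX : X ∈ (strategyMachine w σ L).reached n) :
    (strategyMachine w σ L).next X.1 = σ.getD X.2.1 0 ∧
    (∀ x, (strategyMachine w σ L).shift X.1 x =
      advance s (w.map Fin.val) X.2.1 (σ.getD X.2.1 0) x) ∧
    (∀ x, (((strategyMachine w σ L).augStep n X x).2.1 : ℕ) =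
      target s (w.map Fin.val) X.2.1 (σ.getD X.2.1 0) x) ∧
    (∀ x, ((strategyMachine w σ L).IsMatch X.1 x ↔
      AllButOne s (w.map Fin.val) X.2.1 (σ.getD X.2.1 0) ∧
        (w.map Fin.val).getD (σ.getD X.2.1 0) 0 = x)) ∧
    (∀ x, (((strategyMachine w σ L).trans X.1 x : Fin (L.length + 1)) : ℕ) =
      L.idxOf (target s (w.map Fin.val) X.2.1 (σ.getD X.2.1 0) x)) ∧
    (X.2.1 : ℕ) < (s + 1) ^ (n + 1) ∧ Live s (w.map Fin.val) X.2.1 := by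
  obtain ⟨T, i, rfl⟩ := hX
  obtain ⟨hq, hK⟩ := label_of_reached hs hL H T i
  set X := ((strategyMachine w σ L).augTrace n T i).1 with hX
  have hsh : ∀ x, (strategyMachine w σ L).shift X.1 x =
      advance s (w.map Fin.val) X.2.1 (σ.getD X.2.1 0) x := fun x => by
    rw [hK, strategyMachine_shift hq]
  have hnext : (strategyMachine w σ L).next X.1 = σ.getD X.2.1 0 := by
    rw [hK, strategyMachine_next hq]
  have htr : ∀ x, (((strategyMachine w σ L).trans X.1 x : Fin (L.length + 1)) : ℕ) =
      L.idxOf (target s (w.map Fin.val) X.2.1 (σ.getD X.2.1 0) x) := fun x => by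
    rw [hK, strategyMachine_trans hq]
  refine ⟨hnext, hsh, fun x => ?_, fun x => ?_, htr, ?_⟩
  · rw [augStep_knowledge (orderLE_strategyMachine hs hL H), learn, hsh, hnext, target_eq]
  · rw [IsMatch, hnext]
    have h1 : X.1 ∈ (strategyMachine w σ L).prematch ↔
        AllButOne s (w.map Fin.val) X.2.1 (σ.getD X.2.1 0) := by
      rw [hK]
      simp only [strategyMachine, Finset.mem_filter, Finset.mem_univ, true_and, hq]
    rw [h1]
    refine and_congr_right fun h2 => ?_
    have h3 : σ.getD X.2.1 0 < w.length := by simpa using h2.1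
    rw [getD_map_val w h3, List.getElem?_eq_getElem h3, Option.some_inj, Fin.ext_iff]
  · rw [hK]
    exact live_label hs hL H hq

/-- The machine of a strategy prints an occurrence as soon as it knows it. -/
theorem isMatch_iff_prints (hs : 0 < s) (hL : Explores s (w.map Fin.val) σ L)
    (H : OptimalStrategy (w.map Fin.val) n π (fun K => σ.getD K 0) g h) (T : ℕ → Fin s) (i : ℕ) :
    (strategyMachine w σ L).IsMatch ((strategyMachine w σ L).augTrace n T i).1.1
        ((strategyMachine w σ L).augLetter n T i) ↔
      Prints s (w.map Fin.val) ((strategyMachine w σ L).augTrace n T i).1.2.1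
        (σ.getD ((strategyMachine w σ L).augTrace n T i).1.2.1 0)
        ((strategyMachine w σ L).augLetter n T i) := by
  have hM := orderLE_strategyMachine hs hL H
  obtain ⟨h1, -, -, h4, -, -, h8⟩ :=
    strategyMachine_step hs hL H (X := ((strategyMachine w σ L).augTrace n T i).1) ⟨T, i, rfl⟩
  rw [h4, prints_iff (Fin.is_lt _) h8]
  have h9 := dig_learn hM T i ((strategyMachine w σ L).next ((strategyMachine w σ L).augTrace n T i).1.1)
    (dig_rd_self_ne (Fin.is_lt _) _ _)
  rw [learn, h1] at h9
  rw [h9, augLetter, h1]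

/-- The machine of a strategy makes progress. -/
theorem le_pos_strategyMachine (hs : 0 < s) (hL : Explores s (w.map Fin.val) σ L)
    (H : OptimalStrategy (w.map Fin.val) n π (fun K => σ.getD K 0) g h) (T : ℕ → Fin s) (i : ℕ) :
    i ≤ ((strategyMachine w σ L).augTrace n T i).2 * (s + 1) ^ (n + 1) +
      ((strategyMachine w σ L).augTrace n T i).1.2.1 := by
  induction i with
  | zero => exact Nat.zero_le _
  | succ i ih =>
    obtain ⟨-, h2, h3, -, -, h7, h8⟩ :=
      strategyMachine_step hs hL H (X := ((strategyMachine w σ L).augTrace n T i).1) ⟨T, i, rfl⟩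
    rw [augTrace_succ]
    dsimp only
    rw [h2, h3]
    rcases Nat.eq_zero_or_pos (advance s (w.map Fin.val) ((strategyMachine w σ L).augTrace n T i).1.2.1
        (σ.getD ((strategyMachine w σ L).augTrace n T i).1.2.1 0)
        ((strategyMachine w σ L).augLetter n T i)) with h0 | h0
    · have := lt_target_of_advance_eq_zero (Fin.is_lt _) (H.useful _ h7 h8) h0
      rw [h0, add_zero]
      omega
    · have := Nat.mul_le_mul_right ((s + 1) ^ (n + 1)) (Nat.add_le_add_left h0
        ((strategyMachine w σ L).augTrace n T i).2)
      rw [Nat.add_mul, Nat.succ_mul, Nat.zero_mul] at this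
      omega

theorem exists_pos_le_lt (hs : 0 < s) (hL : Explores s (w.map Fin.val) σ L)
    (H : OptimalStrategy (w.map Fin.val) n π (fun K => σ.getD K 0) g h) (T : ℕ → Fin s) (p : ℕ) :
    ∃ i, ((strategyMachine w σ L).augTrace n T i).2 ≤ p ∧
      p < ((strategyMachine w σ L).augTrace n T (i + 1)).2 := by
  classical
  have hex : ∃ i, p < ((strategyMachine w σ L).augTrace n T i).2 := by
    obtain ⟨i, hi⟩ : ∃ i, i = (p + 1) * (s + 1) ^ (n + 1) := ⟨_, rfl⟩
    refine ⟨i, ?_⟩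
    have h1 := le_pos_strategyMachine hs hL H T i
    have h2 := ((strategyMachine w σ L).augTrace n T i).1.2.1.2
    by_contra hlt
    have h3 := Nat.mul_le_mul_right ((s + 1) ^ (n + 1)) (not_lt.mp hlt)
    rw [Nat.succ_mul] at hi
    omega
  obtain ⟨i, hi⟩ : ∃ i, Nat.find hex = i + 1 := Nat.exists_eq_succ_of_ne_zero fun h0 => by
    have := Nat.find_spec hex
    rw [h0] at this
    exact absurd this (Nat.not_lt_zero _)
  exact ⟨i, not_lt.mp (Nat.find_min hex (by omega)), hi ▸ Nat.find_spec hex⟩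

/-- The machine of a strategy is valid. -/
theorem valid_strategyMachine (hs : 0 < s) (hL : Explores s (w.map Fin.val) σ L)
    (H : OptimalStrategy (w.map Fin.val) n π (fun K => σ.getD K 0) g h) (pad : Fin s) :
    (strategyMachine w σ L).Valid pad := by
  have hM := orderLE_strategyMachine hs hL H
  intro t p
  set T : ℕ → Fin s := fun j => t.getD j pad with hT
  rw [occursAt_iff pad]
  have hstep := fun i => strategyMachine_step hs hL H
    (X := ((strategyMachine w σ L).augTrace n T i).1) ⟨T, i, rfl⟩
  constructor
  · rintro ⟨i, hm, rfl⟩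
    obtain ⟨h1, h2⟩ := (matchAt_iff (n := n)).mp hm
    rw [posAt_eq (n := n)]
    refine ⟨h1, fun j hj => ?_⟩
    have h3 := ((isMatch_iff_prints hs hL H T i).mp h2).2 j (by simpa using hj)
    have h4 := dig_learn hM T i j
    rw [learn, (hstep i).1, h3, getD_map_val w hj] at h4
    exact (Fin.ext (Nat.succ.inj (h4 (Nat.succ_ne_zero _)))).symm
  · rintro ⟨hp, hw⟩
    obtain ⟨i, h1, h2⟩ := exists_pos_le_lt hs hL H T p
    rw [augTrace_succ] at h2
    dsimp only at h2
    rw [(hstep i).2.1] at h2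
    obtain ⟨k, rfl⟩ := Nat.exists_eq_add_of_le h1
    -- An actual occurrence is compatible with true knowledge. The strategy can leave a live
    -- position only after printing it, so the iteration which passes `p` starts at `p` and prints.
    have hlive : Live s (w.map Fin.val) (rd s ((strategyMachine w σ L).augTrace n T i).1.2.1
        (σ.getD ((strategyMachine w σ L).augTrace n T i).1.2.1 0)
        ((strategyMachine w σ L).augLetter n T i) / (s + 1) ^ k) := fun j hj => by
      rw [List.length_map] at hj
      rw [dig_div_pow, getD_map_val w hj, ← hw j hj, or_iff_not_imp_left]
      intro hne
      have h4 := dig_learn hM T i (j + k)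
      rw [learn, (hstep i).1] at h4
      rw [h4 hne, show ((strategyMachine w σ L).augTrace n T i).2 + (j + k) =
        ((strategyMachine w σ L).augTrace n T i).2 + k + j by omega]
    have hcontra := not_live_of_lt_advance hs (Nat.lt_of_add_lt_add_left h2)
    have hk : k = 0 ∧ Prints s (w.map Fin.val) ((strategyMachine w σ L).augTrace n T i).1.2.1
        (σ.getD ((strategyMachine w σ L).augTrace n T i).1.2.1 0)
        ((strategyMachine w σ L).augLetter n T i) := by
      by_contra hk
      exact hcontra (fun h0 hp => hk ⟨h0, hp⟩) hlive
    obtain ⟨rfl, hpr⟩ := hk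
    exact ⟨i, (matchAt_iff (n := n)).mpr ⟨hp, (isMatch_iff_prints hs hL H T i).mpr hpr⟩,
      posAt_eq (n := n)⟩

/-- All the states of the machine of a strategy are reached, except for the sink. -/
theorem exists_reached (hs : 0 < s) (hL : Explores s (w.map Fin.val) σ L)
    (H : OptimalStrategy (w.map Fin.val) n π (fun K => σ.getD K 0) g h) {q : ℕ} (hq : q < L.length) :
    ∃ X ∈ (strategyMachine w σ L).reached n, (X.1 : ℕ) = q := by
  have hM := orderLE_strategyMachine hs hL H
  induction q using Nat.strong_induction_on with
  | _ q ih =>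
    rcases hL.2.2.2 q hq with rfl | ⟨q', hq', x, hx, he⟩
    · exact ⟨_, augInit_mem_reached ⟨0, hs⟩, rfl⟩
    · obtain ⟨X, hX, rfl⟩ := ih q' hq' (hq'.trans hq)
      refine ⟨_, nx_mem_reached hM hX ⟨x, hx⟩, ?_⟩
      obtain ⟨h1, -, -, -, h6, -, -⟩ := strategyMachine_step hs hL H hX
      have hrd := learn_known (M := strategyMachine w σ L) X ⟨x, hx⟩
      rw [learn, h1] at hrd
      have hK : (X.2.1 : ℕ) = L.getD X.1 0 := by
        obtain ⟨T, i, rfl⟩ := hX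
        exact (label_of_reached hs hL H T i).2
      rw [nx, augStep]
      dsimp only
      rw [h6, target_congr _ hrd, hK, he, hL.2.1 q hq]

theorem trim_strategyMachine (hs : 0 < s) (hL : Explores s (w.map Fin.val) σ L)
    (H : OptimalStrategy (w.map Fin.val) n π (fun K => σ.getD K 0) g h) (pad : Fin s) :
    (strategyMachine w σ L).Trim pad := by
  have hM := orderLE_strategyMachine hs hL H
  have hfin : ∀ (T : ℕ → Fin s) (i : ℕ), ∃ t : List (Fin s),
      ((strategyMachine w σ L).augTrace n T i).2 + w.length ≤ t.length ∧
      (strategyMachine w σ L).augTrace n (fun j => t.getD j pad) i =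
        (strategyMachine w σ L).augTrace n T i ∧
      (strategyMachine w σ L).augLetter n (fun j => t.getD j pad) i =
        (strategyMachine w σ L).augLetter n T i := fun T i =>
    ⟨prefixOf T (((strategyMachine w σ L).augTrace n T i).2 + n + 1 + w.length), by
      rw [length_prefixOf]; omega, augTrace_prefixOf hM T pad (by omega) i le_rfl⟩
  constructor
  · intro q hq
    have hq' : (q : ℕ) < L.length := by
      have h1 := q.2
      have h2 : (q : ℕ) ≠ L.length := fun h => hq (Fin.ext h)
      omega
    obtain ⟨X, ⟨T, i, rfl⟩, hX⟩ := exists_reached hs hL H hq'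
    obtain ⟨t, h1, h2, -⟩ := hfin T i
    refine ⟨t, i, (running_iff (n := n)).mpr (by rwa [h2]), ?_⟩
    rw [stateAt, config_eq (n := n), h2]
    exact Fin.ext hX
  · intro q hq
    have hq' : (q : ℕ) < L.length := (Finset.mem_filter.mp hq).2.1
    obtain ⟨X, hXR, hX⟩ := exists_reached hs hL H hq'
    obtain rfl : X.1 = q := Fin.ext hX
    obtain ⟨h1, -, -, h4, -, h7, h8⟩ := strategyMachine_step hs hL H hXR
    have hi : σ.getD X.2.1 0 < w.length := h1 ▸ (strategyMachine w σ L).next_lt _ hq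
    -- If the letter at the chosen offset is already known, usefulness means that the occurrence is
    -- certain, so the known letter is that of `w`. In either case the matching letter can be read.
    have hknown : (strategyMachine w σ L).known n X w[σ.getD X.2.1 0] = w[σ.getD X.2.1 0] := by
      unfold known
      split_ifs with hd
      · rfl
      · rw [h1] at hd
        refine Fin.ext ?_
        rcases H.useful _ h7 h8 with hu | hu
        · exact absurd hu hd
        · dsimp only
          rw [h1, hu.2 _ hu.1, getD_map_val w hi, Nat.add_sub_cancel]
    obtain ⟨T, i, hT, hl⟩ := exists_augLetter hM hXR w[σ.getD X.2.1 0]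
    obtain ⟨t, e1, e2, e3⟩ := hfin T i
    refine ⟨t, i, (matchAt_iff (n := n)).mpr ⟨by rwa [e2], ?_⟩, by
      rw [stateAt, config_eq (n := n), e2, hT]⟩
    rw [e2, e3, hT, hl, hknown]
    exact ⟨hq, by rw [h1, List.getElem?_eq_getElem hi]⟩

/-- The speed of the machine of an optimal strategy is at least the optimal gain. -/
theorem exists_le_hasSpeed (hs : 0 < s) (hL : Explores s (w.map Fin.val) σ L)
    (H : OptimalStrategy (w.map Fin.val) n π (fun K => σ.getD K 0) g h) (pad : Fin s) (hw : w ≠ [])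
    (hn : w.length ≤ n + 1) (hπ : π ∈ stdSimplex ℝ (Fin s)) :
    ∃ v, (strategyMachine w σ L).HasSpeed pad π v ∧ g ≤ v := by
  have hM := orderLE_strategyMachine hs hL H
  obtain ⟨gM, hM', hg, hr⟩ := exists_poisson hπ ((strategyMachine w σ L).nx n) fun X =>
    avg π fun x => ((strategyMachine w σ L).sh n X x : ℝ)
  refine ⟨_, (valid_strategyMachine hs hL H pad).hasSpeed hM hw hn hπ hg hr, ?_⟩
  -- On reached states the memory is exactly the knowledge of the strategy, so its bias `h` serves
  -- as the comparison function.
  refine le_gain_of_subharmonic (φ := fun X => h X.2.1) hπ hg hr (R := (strategyMachine w σ L).reached n)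
    (fun X hX x => nx_mem_reached hM hX x) (fun X hX => ?_) _ (augInit_mem_reached pad)
  obtain ⟨h1, h2, h3, -, -, h7, h8⟩ := strategyMachine_step hs hL H hX
  rw [← avg_add, add_comm]
  refine (H.le_avg _ h7 h8).trans_eq ?_
  congr 1
  funext x
  have hrd := learn_known (M := strategyMachine w σ L) X x
  rw [learn, h1] at hrd
  rw [after_eq, nx, sh, h2, h3, target_congr _ hrd, advance_congr _ hrd]

end MatchingMachine
end PatternMatching

theorem mainTheorem3 :
    ∃ F : PatternMatching.ExactAlgorithm (ℕ × List ℕ × ℕ) PatternMatching.MachineCode,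
      Computable F ∧
      ∀ (s : ℕ) (w : List (Fin s)) (n : ℕ) (π : Fin s → ℝ),
        w ≠ [] → w.length ≤ n + 1 → π ∈ stdSimplex ℝ (Fin s) →
        ∃ (m : ℕ) (M : PatternMatching.MatchingMachine (Fin s) (Fin m) w),
          F.Outputs (s, w.map Fin.val, n) (PatternMatching.letterProbs π) M.code ∧
          M.order ≤ n ∧
          ∀ pad : Fin s,
            M.Trim pad ∧ M.Valid pad ∧
            ∃ v : ℝ, M.HasSpeed pad π v ∧
              ∀ (Q : Type) [Fintype Q] (M' : PatternMatching.MatchingMachine (Fin s) Q w),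
                M'.Valid pad → M'.order ≤ n →
                  ∃ v' : ℝ, M'.HasSpeed pad π v' ∧ v' ≤ v := by
  open PatternMatching MatchingMachine in
  refine ⟨search, computable_search, fun s w n π hw hn hπ => ?_⟩
  have hs : 0 < s := by
    obtain ⟨x, -⟩ := List.exists_mem_of_ne_nil w hw
    exact x.pos
  obtain ⟨σ, L, g, h, H, hL, hout⟩ := PatternMatching.search_spec (w := w.map Fin.val) hs
    (by simpa using hw) (by simpa using hn) hπ
  refine ⟨L.length + 1, strategyMachine w σ L, by rwa [code_strategyMachine],
    Finset.sup_le fun q _ => orderLE_strategyMachine hs hL H q, fun pad =>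
    ⟨trim_strategyMachine hs hL H pad, valid_strategyMachine hs hL H pad, ?_⟩⟩
  obtain ⟨v, hv, hgv⟩ := exists_le_hasSpeed hs hL H pad hw hn hπ
  refine ⟨v, hv, fun Q _ M' hV hM => ?_⟩
  obtain ⟨v', hv', hle⟩ := hV.exists_hasSpeed_le
    (fun q => (Finset.le_sup (Finset.mem_univ q)).trans hM) hw hn hπ H
  exact ⟨v', hv', hle.trans hgv⟩
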